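/- **Setting.** Let $f_t\in\mathbb R^K$, $t\in\mathbb Z$, be a zero-mean factor process ($K$ fixed, known) and, for each $N$, let $y_t=D(\rho)Wy_t+Bf_t+\varepsilon_t$, where $y_t,\varepsilon_t\in\mathbb R^N$, $D(\rho)=\mathrm{diag}(\rho_1,\dots,\rho_N)$, $W$ is an $N\times N$ weight matrix and $B$ is $N\times K$ ($y_t,\varepsilon_t,\rho,W,B$ may depend on $N$). Put $S=I_N-D(\rho)W$, $\Lambda=S^{-1}B$, $\xi_t=S^{-1}\varepsilon_t$, so that $y_t=\Lambda f_t+\xi_t$. Assume that, for some constants $\gamma>2$ and $C$ not depending on $N$ and for all large $N$: 1. $(y_t,f_t)$ is strictly stationary and $\alpha$-mixing with coefficients satisfying $\sum_{k\ge1}\alpha_N(k)^{1-2/\gamma}\le C$; 2. $W$ has zero diagonal, $S$ is invertible, and all row and column sums of $|W|$ and of $|S^{-1}|$ (entrywise absolute values) are at most $C$; 3. $\varepsilon_t$ is white noise (mean zero, serially uncorrelated), $\mathrm{Cov}(y_{t-j},\varepsilon_t)=0$ for $j\ge1$ and $\mathrm{Cov}(f_{t-k},\varepsilon_t)=0$ for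 $k\ge0$; 4. $\frac1N\Lambda'\Lambda=\frac1NB'(S^{-1})'S^{-1}B=I_K$; 5. $E|f_{j,t}|^{2\gamma}\le C$ and $E|\varepsilon_{i,t}|^{2\gamma}\le C$ for all $i,j,t$; 6. for some constants $c_1,c_2>0$ not depending on $N$, $P(|v'f_t|>x)\le c_1e^{-c_2x}$ and $P(|w'\varepsilon_t|>x)\le c_1e^{-c_2x}$ for all $x>0$, all $t$ and all $v\in\mathbb R^K$, $w\in\mathbb R^N$ of Euclidean norm $1$ (sub-exponential tails); 7. for the prescribed integer $k_0$, the matrix $R=\sum_{k=1}^{k_0}\Sigma_f(k)\Sigma_f(k)'$ is positive definite, where $\Sigma_f(k)=\mathrm{Cov}(f_t,f_{t-k})$. **Estimators.** Let $\hat\Sigma_y(k)=\frac1T\sum_{t=k+1}^Ty_ty_{t-k}'$ and $\hat M=\sum_{k=1}^{k_0}\hat\Sigma_y(k)\hat\Sigma_y(k)'$. Let $\hat\Lambda$ (measurable, $N\times K$, defined for $N\ge K$) have as columns eigenvectors of $\hat M$ for its $K$ largest eigenvalues in decreasing order, with $\hat\Lambda'\hat\Lambda=NI_K$. Let $\hat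 f_t=\frac1N\hat\Lambda'y_t$, $K_{NT}=\frac1N\hat\Lambda'\Lambda$ and $H_{NT}'=\sum_{k=1}^{k_0}G_{1,k}G_{1,k}'\Lambda'\hat\Lambda\hat V_{NT}^{-1}$, where $G_{1,k}=\frac1T\sum_{t=k+1}^T(f_tf_{t-k}'\Lambda'+f_t\xi_{t-k}')$ and $\hat V_{NT}$ is the diagonal matrix of the $K$ largest eigenvalues of $\hat M$. **(i)** As $N,T\to\infty$, $K_{NT}$ is invertible with probability tending to one, and $$\max_{1\le t\le T}\|\hat f_t-K_{NT}f_t\|_2=O_p\Big\{\Big(\tfrac1{\sqrt N}+\tfrac1{\sqrt T}\Big)\log T\Big\}.$$ **(ii)** Suppose in addition that the eigenvalues of $R$ are distinct; let $H$ be an orthogonal matrix whose rows are eigenvectors of $R$ in decreasing order of the eigenvalues, and let the signs of the columns of $\hat\Lambda$ be chosen such that the diagonal entries of $K_{NT}H'$ are nonnegative. Then, as $N,T\to\infty$ with $N=o(T)$, $K_{NT}\to H$ and $H_{NT}\to H$ in probability. Moreover, let $p_i$ be the $i$-th column of $\Lambda'S^{-1}$ and let $t\ge1$ be such that, as $N\to\infty$,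 $\frac1{\sqrt N}\sum_{i=1}^Np_i\varepsilon_{i,t}\to_dN(0,\Gamma_t)$ with $\Gamma_t=\lim_{N\to\infty}\frac1N\sum_{i=1}^N\sum_{j=1}^Np_ip_j'E(\varepsilon_{i,t}\varepsilon_{j,t})$. Then, as $N,T\to\infty$ with $N=o(T)$, $$\sqrt N(\hat f_t-K_{NT}f_t)=H\frac1{\sqrt N}\sum_{i=1}^Np_i\varepsilon_{i,t}+o_p(1)\longrightarrow_dN(0,H\Gamma_tH').$$ -/

import Mathlib

open MeasureTheory ProbabilityTheory Filter Topology Matrix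
open scoped NNReal ENNReal

noncomputable section

namespace SpatialFactor

/-! ### Processes: strict stationarity, strong mixing, stochastic order -/

section Processes

variable {Ω : Type*} [MeasurableSpace Ω] (μ : Measure Ω)

/-- Strict stationarity of a process indexed by `ℤ`: every time shift leaves the law of the whole
trajectory unchanged. -/
def IsStrictlyStationary {E : Type*} [MeasurableSpace E] (Z : ℤ → Ω → E) : Prop :=
  ∀ h : ℤ, IdentDistrib (fun ω t => Z (t + h) ω) (fun ω t => Z t ω) μ μ

/-- The σ-field generated by `Z t`, `t ≤ i`. -/
@[reducible] def pastSigma {E : Type*} [MeasurableSpace E] (Z : ℤ → Ω → E) (i : ℤ) : MeasurableSpace Ω :=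
  ⨆ t : Set.Iic i, MeasurableSpace.comap (Z t) inferInstance

/-- The σ-field generated by `Z t`, `i ≤ t`. -/
@[reducible] def futureSigma {E : Type*} [MeasurableSpace E] (Z : ℤ → Ω → E) (i : ℤ) : MeasurableSpace Ω :=
  ⨆ t : Set.Ici i, MeasurableSpace.comap (Z t) inferInstance

/-- The strong (`α`-) mixing coefficient at lag `k`; the set on the right is nonempty and bounded
by `1` when `μ` is a probability measure. -/
def alphaMixing {E : Type*} [MeasurableSpace E] (Z : ℤ → Ω → E) (k : ℕ) : ℝ :=
  sSup {x : ℝ | ∃ (i : ℤ) (A D : Set Ω), MeasurableSet[pastSigma Z i] A ∧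
    MeasurableSet[futureSigma Z (i + k)] D ∧
    x = |μ.real (A ∩ D) - μ.real A * μ.real D|}

/-- `X = O_p(r)` along the filter `l`. -/
def IsBigOInProb {ι : Type*} (X : ι → Ω → ℝ) (l : Filter ι) (r : ι → ℝ) : Prop :=
  ∀ δ : ℝ, 0 < δ → ∃ M : ℝ, ∀ᶠ p in l, μ {ω | M * r p < |X p ω|} ≤ ENNReal.ofReal δ

end Processes

/-! ### The spatial panel model with common factors -/

/-- The data of the model in cross-sectional dimension `N` with `K` factors: the spatial
coefficients `ρ`, the weight matrix `W`, the loadings `B`, the panel `y` and the noise `ε`. -/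
structure Panel (Ω : Type*) (K N : ℕ) where
  /-- spatial coefficients -/
  rho : Fin N → ℝ
  /-- spatial weight matrix -/
  W : Matrix (Fin N) (Fin N) ℝ
  /-- loadings of the factors -/
  B : Matrix (Fin N) (Fin K) ℝ
  /-- observed panel -/
  y : ℤ → Ω → Fin N → ℝ
  /-- noise -/
  eps : ℤ → Ω → Fin N → ℝ

namespace Panel

variable {Ω : Type*} {K N : ℕ} (P : Panel Ω K N)

/-- `S = I - D(ρ) W`. -/
def S : Matrix (Fin N) (Fin N) ℝ := 1 - Matrix.diagonal P.rho * P.W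

/-- `Λ = S⁻¹ B`, the loading matrix of the reduced form `y_t = Λ f_t + ξ_t`. -/
def Lam : Matrix (Fin N) (Fin K) ℝ := P.S⁻¹ * P.B

/-- `ξ_t = S⁻¹ ε_t`. -/
def xi (t : ℤ) (ω : Ω) : Fin N → ℝ := P.S⁻¹ *ᵥ P.eps t ω

/-- `p_i`, the `i`-th column of `Λ' S⁻¹`. -/
def p (i : Fin N) : Fin K → ℝ := fun j => (P.Lamᵀ * P.S⁻¹) j i

/-- The scaled score `N^{-1/2} ∑ i, p_i ε_{i,t}`. -/
def score (t : ℤ) (ω : Ω) : Fin K → ℝ := (√(N : ℝ))⁻¹ • ∑ i, P.eps t ω i • P.p i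

/-- Sample lag-`k` autocovariance matrix `T⁻¹ ∑_{t=k+1}^T y_t y_{t-k}'` of the panel. -/
def sampleAutocov (T k : ℕ) (ω : Ω) : Matrix (Fin N) (Fin N) ℝ :=
  (T : ℝ)⁻¹ • ∑ t ∈ Finset.Icc ((k : ℤ) + 1) (T : ℤ), vecMulVec (P.y t ω) (P.y (t - k) ω)

/-- `M̂ = ∑_{k=1}^{k₀} Σ̂_y(k) Σ̂_y(k)'`. -/
def Mhat (k₀ T : ℕ) (ω : Ω) : Matrix (Fin N) (Fin N) ℝ :=
  ∑ k ∈ Finset.Icc 1 k₀, P.sampleAutocov T k ω * (P.sampleAutocov T k ω)ᵀ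

lemma isHermitian_Mhat (k₀ T : ℕ) (ω : Ω) : (P.Mhat k₀ T ω).IsHermitian := by
  rw [Matrix.IsHermitian, Matrix.conjTranspose_eq_transpose_of_trivial, Mhat,
    Matrix.transpose_sum]
  simp [Matrix.transpose_mul]

/-- The `(j+1)`-st largest eigenvalue of `M̂`, for `j = 0, …, K - 1` (only used when `K ≤ N`). -/
def topEigenvalue (k₀ T : ℕ) (ω : Ω) (j : Fin K) : ℝ :=
  if h : (j : ℕ) < N then
    (P.isHermitian_Mhat k₀ T ω).eigenvalues₀ ⟨j, by simpa using h⟩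
  else 0

/-- `L` is a value of the loading estimator: its columns are eigenvectors of `M̂` for the `K`
largest eigenvalues in decreasing order, orthogonal to each other and of norm `√N`. -/
def IsLoadingEstimate (k₀ T : ℕ) (ω : Ω) (L : Matrix (Fin N) (Fin K) ℝ) : Prop :=
  Lᵀ * L = (N : ℝ) • (1 : Matrix (Fin K) (Fin K) ℝ) ∧
    P.Mhat k₀ T ω * L = L * Matrix.diagonal (P.topEigenvalue k₀ T ω)

/-- The factor estimate `f̂_t = Λ̂' y_t / N` computed with the loading estimate `L`. -/
def fhat (L : Matrix (Fin N) (Fin K) ℝ) (t : ℤ) (ω : Ω) : Fin K → ℝ :=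
  (N : ℝ)⁻¹ • (Lᵀ *ᵥ P.y t ω)

/-- The rotation matrix `K_NT = Λ̂' Λ / N`. -/
def KNT (L : Matrix (Fin N) (Fin K) ℝ) : Matrix (Fin K) (Fin K) ℝ := (N : ℝ)⁻¹ • (Lᵀ * P.Lam)

/-- `G_{1,k} = T⁻¹ ∑_{t=k+1}^T (f_t f_{t-k}' Λ' + f_t ξ_{t-k}')`. -/
def G1 (f : ℤ → Ω → Fin K → ℝ) (T k : ℕ) (ω : Ω) : Matrix (Fin K) (Fin N) ℝ :=
  (T : ℝ)⁻¹ • ∑ t ∈ Finset.Icc ((k : ℤ) + 1) (T : ℤ),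
    (vecMulVec (f t ω) (f (t - k) ω) * P.Lamᵀ + vecMulVec (f t ω) (P.xi (t - k) ω))

/-- The rotation matrix `H_NT`, with `H_NT' = ∑_{k=1}^{k₀} G_{1,k} G_{1,k}' Λ' Λ̂ V̂⁻¹`, where `V̂` is
the diagonal matrix of the `K` largest eigenvalues of `M̂`. -/
def HNT (f : ℤ → Ω → Fin K → ℝ) (k₀ T : ℕ) (ω : Ω) (L : Matrix (Fin N) (Fin K) ℝ) :
    Matrix (Fin K) (Fin K) ℝ :=
  ((∑ k ∈ Finset.Icc 1 k₀, P.G1 f T k ω * (P.G1 f T k ω)ᵀ) * P.Lamᵀ * L *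
    (Matrix.diagonal (P.topEigenvalue k₀ T ω))⁻¹)ᵀ

end Panel

/-! ### Assumptions -/

section Assumptions

variable {Ω : Type*} [MeasurableSpace Ω] (μ : Measure Ω) {K N : ℕ}

/-- The structural model: measurable processes with `y_t = D(ρ) W y_t + B f_t + ε_t`. -/
structure IsModel (f : ℤ → Ω → Fin K → ℝ) (P : Panel Ω K N) : Prop where
  measurable_f : ∀ t, Measurable (f t)
  measurable_y : ∀ t, Measurable (P.y t)
  measurable_eps : ∀ t, Measurable (P.eps t)
  eqn : ∀ t ω, P.y t ω =
    (Matrix.diagonal P.rho * P.W) *ᵥ P.y t ω + P.B *ᵥ f t ω + P.eps t ω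

/-- The basic assumptions on the model in dimension `N`, with exponent `γ` and constant `C`. -/
structure BasicAssumptions (γ C : ℝ) (f : ℤ → Ω → Fin K → ℝ) (P : Panel Ω K N) : Prop where
  /-- `(y_t, f_t)` is strictly stationary … -/
  stationary : IsStrictlyStationary μ (fun t ω => (P.y t ω, f t ω))
  /-- … and strongly mixing with `∑_{k ≥ 1} α_N(k)^{1 - 2/γ} ≤ C`. -/
  mixing_summable :
    Summable fun k : ℕ => alphaMixing μ (fun t ω => (P.y t ω, f t ω)) (k + 1) ^ (1 - 2 / γ)
  mixing_le :
    ∑' k : ℕ, alphaMixing μ (fun t ω => (P.y t ω, f t ω)) (k + 1) ^ (1 - 2 / γ) ≤ C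
  /-- The weight matrix has zero diagonal, `S` is invertible, and the row and column sums of `|W|`
  and `|S⁻¹|` are bounded. -/
  W_diag : ∀ i, P.W i i = 0
  S_isUnit : IsUnit P.S
  W_row : ∀ i, ∑ j, |P.W i j| ≤ C
  W_col : ∀ j, ∑ i, |P.W i j| ≤ C
  Sinv_row : ∀ i, ∑ j, |P.S⁻¹ i j| ≤ C
  Sinv_col : ∀ j, ∑ i, |P.S⁻¹ i j| ≤ C
  /-- The factors have mean zero. -/
  f_mean : ∀ t j, ∫ ω, f t ω j ∂μ = 0
  /-- `ε` is white noise, uncorrelated with past `y` and with past and present `f`. -/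
  eps_mean : ∀ t i, ∫ ω, P.eps t ω i ∂μ = 0
  eps_white : ∀ s t i j, s ≠ t →
    cov[fun ω => P.eps s ω i, fun ω => P.eps t ω j; μ] = 0
  y_eps : ∀ s t i j, s < t → cov[fun ω => P.y s ω i, fun ω => P.eps t ω j; μ] = 0
  f_eps : ∀ s t i j, s ≤ t → cov[fun ω => f s ω i, fun ω => P.eps t ω j; μ] = 0
  /-- Normalization `B' S⁻¹' S⁻¹ B / N = I` of the loadings. -/
  loading : (N : ℝ)⁻¹ • (P.Bᵀ * (P.S⁻¹)ᵀ * P.S⁻¹ * P.B) = 1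
  /-- Bounded moments of order `2γ`. -/
  f_moment : ∀ t j, ∫⁻ ω, ‖f t ω j‖ₑ ^ (2 * γ) ∂μ ≤ ENNReal.ofReal C
  eps_moment : ∀ t i, ∫⁻ ω, ‖P.eps t ω i‖ₑ ^ (2 * γ) ∂μ ≤ ENNReal.ofReal C

/-- Sub-exponential tails of a vector process, with constants `c₁` and `c₂`, in every direction
given by a vector of Euclidean norm one. -/
def SubExponential (c₁ c₂ : ℝ) {n : ℕ} (X : ℤ → Ω → Fin n → ℝ) : Prop :=
  ∀ v : Fin n → ℝ, v ⬝ᵥ v = 1 → ∀ (t : ℤ) (x : ℝ), 0 < x →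
    μ.real {ω | x < |v ⬝ᵥ X t ω|} ≤ c₁ * Real.exp (-(c₂ * x))

/-- `Σ_f(k) = Cov(f_t, f_{t-k})`, evaluated at `t = 0` (it does not depend on `t` for a stationary
process). -/
def autocov (f : ℤ → Ω → Fin K → ℝ) (k : ℕ) : Matrix (Fin K) (Fin K) ℝ :=
  Matrix.of fun i j => cov[fun ω => f 0 ω i, fun ω => f (-(k : ℤ)) ω j; μ]

/-- `∑_{k=1}^{k₀} Σ_f(k) Σ_f(k)'`. -/
def factorM (f : ℤ → Ω → Fin K → ℝ) (k₀ : ℕ) : Matrix (Fin K) (Fin K) ℝ :=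
  ∑ k ∈ Finset.Icc 1 k₀, autocov μ f k * (autocov μ f k)ᵀ

/-- `∑_i ∑_j p_i p_j' E(ε_{i,t} ε_{j,t}) / N`. -/
def scoreCov (P : Panel Ω K N) (t : ℤ) : Matrix (Fin K) (Fin K) ℝ :=
  (N : ℝ)⁻¹ • ∑ i, ∑ j, (∫ ω, P.eps t ω i * P.eps t ω j ∂μ) • vecMulVec (P.p i) (P.p j)

/-- The cross-sectional central limit theorem at time `t`: `N^{-1/2} ∑ i, p_i ε_{i,t} → N(0, Γ)` in
distribution as `N → ∞`, where `Γ = lim N⁻¹ ∑_i ∑_j p_i p_j' E(ε_{i,t} ε_{j,t})`. -/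
def CrossSectionalCLT [IsProbabilityMeasure μ] (P : ∀ N, Panel Ω K N) (t : ℤ)
    (Γ : Matrix (Fin K) (Fin K) ℝ) : Prop :=
  Tendsto (fun N => scoreCov μ (P N) t) atTop (𝓝 Γ) ∧
    TendstoInDistribution (fun N ω => WithLp.toLp 2 ((P N).score t ω)) atTop id (fun _ => μ)
      (multivariateGaussian (0 : EuclideanSpace ℝ (Fin K)) Γ)

end Assumptions

end SpatialFactor

end

/-! # Factor estimation in spatial panels from sample autocovariances

Divide the loadings by `√N`: the columns of `U = Λ / √N` and of `V = Λ̂ / √N` are orthonormal, and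
`K_NT = V' U`. Since `y_t = Λ f_t + ξ_t`, the estimation error is
`√N (f̂_t - K_NT f_t) = V' ξ_t = K_NT U' ξ_t + (V - U U' V)' ξ_t`, and `U' ξ_t` is exactly the score
`N^{-1/2} ∑ p_i ε_{i,t}`. Everything rests on the size of the component `V - U U' V` of the
estimated loadings off the true loading space, and on the limit of `K_NT`.

**Loading space.** `Σ̂_y(k) / N = U F_k + E_k`, where `F_k = G_{1,k} / √N` is close to `Σ_f(k) U'` and
`E_k` collects the sample moments of `ξ_t` with `f_{t-k}` and with `ξ_{t-k}`. These moments have mean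
zero, because `ε_t` is uncorrelated with the past, so that mixing alone gives `‖E_k‖ = O_p(1/√T)` in
the Frobenius norm (`exists_measure_not_close_le`). The error of `F_k` is `O_p(1/√N + 1/√T)`: the
term in `1/√N` is due to `Cov(f_t, ξ_{t-k})`, which need not vanish. The variances are bounded with
a covariance inequality of Davydov type, which truncation reduces to bounded variables
(`abs_integral_mul_sub_le_of_moment`), and a sum over lags (`variance_sum_le`). By the min-max
principle the `K` largest eigenvalues of `M̂ / N²` stay away from zero
(`le_eigenvalues₀_of_forall_le`). As `V = (M̂ / N²) V D⁻¹` for the diagonal matrix `D` of these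
eigenvalues, and `1 - U U'` annihilates the part `U F_k`, the component `V - U U' V` inherits the rate
`1/√T` of `E_k` alone (`IsFactorApprox.norm_sub_projection_le`). In particular `K_NT K_NT'` is close
to the identity.

**Uniform rate.** Sub-exponential tails pass to `ξ_t = S⁻¹ ε_t` and to the score, because the row
and column sums of `S⁻¹` bound its operator norm. A root mean square has exponential moments as soon
as its components have them, whatever their dependence (`expMomentLE_sqrt_mean_sq`). The union bound
over `t ≤ T` costs a factor `log T`.

**Rotations and limit law.** The eigenvalue equation shows that `Q = K_NT H'` approximately
intertwines two decreasing diagonal matrices, one with distinct entries. An orthogonal intertwiner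
with nonnegative diagonal is the identity, and compactness makes this stable
(`exists_delta_abs_sub_one_le`), so `K_NT → H`. `H_NT` is asymptotically equal to `K_NT` by the
eigenvalue equation. If `N = o(T)`, the term `(V - U U' V)' ξ_t = O_p(√(N/T))` vanishes, and the
limit law follows by Slutsky's lemma.
-/

noncomputable section

namespace SpatialFactor

/-! ### Covariance inequality for strongly mixing σ-fields -/

/-- If the integrals of `V` over the sets of a σ-field are at most `b`, the conditional expectation
of `V` has `L¹`-norm at most `2 b`, hence `V` integrates against bounded functions measurable for
the σ-field accordingly. -/
lemma abs_integral_mul_le_of_abs_setIntegral_le {Ω : Type*} {m m0 : MeasurableSpace Ω}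
    {μ : Measure Ω} [IsProbabilityMeasure μ] (hm : m ≤ m0) {X V : Ω → ℝ} {M b : ℝ}
    (hX : Measurable[m] X) (hXM : ∀ ω, |X ω| ≤ M) (hV : Integrable V μ)
    (h : ∀ A, MeasurableSet[m] A → |∫ ω in A, V ω ∂μ| ≤ b) :
    |∫ ω, X ω * V ω ∂μ| ≤ 2 * M * b := by
  have hM : 0 ≤ M := by
    obtain ⟨ω⟩ : Nonempty Ω := μ.nonempty_of_neZero
    exact (abs_nonneg _).trans (hXM ω)
  set g := μ[V|m] with hg
  have hgi : Integrable g μ := integrable_condExp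
  have hgm : Measurable[m] g := stronglyMeasurable_condExp.measurable
  have hXVi : Integrable (fun ω => X ω * V ω) μ :=
    hV.bdd_mul (hX.mono hm le_rfl).aestronglyMeasurable (ae_of_all _ hXM)
  have h1 : ∫ ω, X ω * V ω ∂μ = ∫ ω, X ω * g ω ∂μ := by
    rw [← integral_condExp hm (f := fun ω => X ω * V ω)]
    exact integral_congr_ae (condExp_mul_of_stronglyMeasurable_left hX.stronglyMeasurable hXVi hV)
  have hA : MeasurableSet[m] {ω | 0 ≤ g ω} := measurableSet_le measurable_const hgm
  have h2 : ∫ ω, |g ω| ∂μ ≤ 2 * b := by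
    rw [← integral_add_compl (hm _ hA) hgi.abs]
    have e1 : ∫ ω in {ω | 0 ≤ g ω}, |g ω| ∂μ = ∫ ω in {ω | 0 ≤ g ω}, V ω ∂μ := by
      rw [← setIntegral_condExp hm hV hA]
      exact setIntegral_congr_fun (hm _ hA) fun ω hω => abs_of_nonneg hω
    have e2 : ∫ ω in {ω | 0 ≤ g ω}ᶜ, |g ω| ∂μ = -∫ ω in {ω | 0 ≤ g ω}ᶜ, V ω ∂μ := by
      rw [← setIntegral_condExp hm hV hA.compl, ← integral_neg]
      exact setIntegral_congr_fun (hm _ hA.compl) fun ω hω =>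
        abs_of_nonpos (le_of_lt (not_le.mp hω))
    have := abs_le.mp (h _ hA)
    have := abs_le.mp (h _ hA.compl)
    rw [e1, e2]; linarith
  calc |∫ ω, X ω * V ω ∂μ| = |∫ ω, X ω * g ω ∂μ| := by rw [h1]
    _ ≤ ∫ ω, |X ω * g ω| ∂μ := abs_integral_le_integral_abs
    _ ≤ ∫ ω, M * |g ω| ∂μ := by
        refine integral_mono_of_nonneg (ae_of_all _ fun _ => abs_nonneg _) (hgi.abs.const_mul _)
          (ae_of_all _ fun ω => ?_)
        simp only [abs_mul]
        gcongr
        exact hXM ω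
    _ = M * ∫ ω, |g ω| ∂μ := integral_const_mul _ _
    _ ≤ M * (2 * b) := by gcongr
    _ = 2 * M * b := by ring

/-- The covariance inequality for bounded random variables. -/
lemma abs_integral_mul_sub_le_of_bounded {Ω : Type*} {m₁ m₂ m0 : MeasurableSpace Ω}
    {μ : Measure Ω} [IsProbabilityMeasure μ] (hm₁ : m₁ ≤ m0) (hm₂ : m₂ ≤ m0) {X Y : Ω → ℝ}
    {M a : ℝ} (hX : Measurable[m₁] X) (hY : Measurable[m₂] Y) (hXM : ∀ ω, |X ω| ≤ M)
    (hYM : ∀ ω, |Y ω| ≤ M)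
    (h : ∀ A D, MeasurableSet[m₁] A → MeasurableSet[m₂] D →
      |μ.real (A ∩ D) - μ.real A * μ.real D| ≤ a) :
    |∫ ω, X ω * Y ω ∂μ - (∫ ω, X ω ∂μ) * ∫ ω, Y ω ∂μ| ≤ 4 * M ^ 2 * a := by
  have hXi : Integrable X μ :=
    Integrable.of_bound (hX.mono hm₁ le_rfl).aestronglyMeasurable M (ae_of_all _ hXM)
  have hYi : Integrable Y μ :=
    Integrable.of_bound (hY.mono hm₂ le_rfl).aestronglyMeasurable M (ae_of_all _ hYM)
  have hXYi : Integrable (fun ω => X ω * Y ω) μ :=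
    hYi.bdd_mul (hX.mono hm₁ le_rfl).aestronglyMeasurable (ae_of_all _ hXM)
  have key : ∀ A, MeasurableSet[m₁] A → |∫ ω in A, (Y ω - ∫ ω, Y ω ∂μ) ∂μ| ≤ 2 * M * a := by
    intro A hA
    have hA0 : MeasurableSet[m0] A := hm₁ _ hA
    have hind : Integrable (A.indicator (1 : Ω → ℝ)) μ :=
      (integrable_const (1 : ℝ)).indicator hA0
    have e : ∫ ω in A, (Y ω - ∫ ω, Y ω ∂μ) ∂μ =
        ∫ ω, Y ω * (A.indicator 1 ω - μ.real A) ∂μ := by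
      rw [integral_sub hYi.integrableOn (integrable_const _)]
      have e1 : ∀ ω, Y ω * (A.indicator 1 ω - μ.real A) =
          A.indicator Y ω - Y ω * μ.real A := by
        intro ω
        by_cases hω : ω ∈ A <;> simp [hω, mul_sub]
      simp_rw [e1]
      rw [integral_sub (hYi.indicator hA0) (hYi.mul_const _), integral_indicator hA0,
        integral_mul_const]
      simp [mul_comm]
    rw [e]
    refine abs_integral_mul_le_of_abs_setIntegral_le hm₂ hY hYM
      (hind.sub (integrable_const _)) fun D hD => ?_
    have hD0 : MeasurableSet[m0] D := hm₂ _ hD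
    rw [integral_sub hind.integrableOn (integrable_const _), setIntegral_indicator hA0]
    have := h A D hA hD
    simpa [Set.inter_comm, mul_comm] using this
  have := abs_integral_mul_le_of_abs_setIntegral_le hm₁ hX hXM (hYi.sub (integrable_const _)) key
  have e : ∫ ω, X ω * (Y ω - ∫ ω, Y ω ∂μ) ∂μ =
      ∫ ω, X ω * Y ω ∂μ - (∫ ω, X ω ∂μ) * ∫ ω, Y ω ∂μ := by
    simp_rw [mul_sub]
    rw [integral_sub hXYi (hXi.mul_const _), integral_mul_const]
  rw [← e]
  refine this.trans (le_of_eq ?_)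
  ring

lemma pow_le_rpow_mul_rpow_of_lt {M x : ℝ} (hM : 0 < M) (hx : M < x) (n : ℕ) {γ : ℝ}
    (hn : (n : ℝ) ≤ γ) :
    x ^ n ≤ M ^ ((n : ℝ) - γ) * x ^ γ := by
  have hx0 : 0 < x := hM.trans hx
  have h1 : x ^ n = x ^ ((n : ℝ) - γ) * x ^ γ := by
    rw [← Real.rpow_add hx0, sub_add_cancel, Real.rpow_natCast]
  rw [h1]
  exact mul_le_mul_of_nonneg_right
    (Real.rpow_le_rpow_of_nonpos hM hx.le (by linarith)) (by positivity)

lemma abs_integral_le_of_abs_le {Ω : Type*} [MeasurableSpace Ω] {μ : Measure Ω} {X g : Ω → ℝ}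
    (hg : Integrable g μ) (h : ∀ ω, |X ω| ≤ g ω) : |∫ ω, X ω ∂μ| ≤ ∫ ω, g ω ∂μ :=
  norm_integral_le_of_norm_le (f := X) hg (ae_of_all _ h)

/-- The covariance inequality of Davydov, with an unoptimized constant: both variables are truncated
at the level `a ^ (-1/γ)`. -/
lemma abs_integral_mul_sub_le_of_moment {Ω : Type*} {m₁ m₂ m0 : MeasurableSpace Ω}
    {μ : Measure Ω} [IsProbabilityMeasure μ] (hm₁ : m₁ ≤ m0) (hm₂ : m₂ ≤ m0) {X Y : Ω → ℝ}
    {γ A a : ℝ} (hγ : 2 < γ) (ha : 0 < a) (ha1 : a ≤ 1)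
    (hX : Measurable[m₁] X) (hY : Measurable[m₂] Y)
    (hXi : Integrable (fun ω => |X ω| ^ γ) μ) (hXA : ∫ ω, |X ω| ^ γ ∂μ ≤ A)
    (hYi : Integrable (fun ω => |Y ω| ^ γ) μ) (hYA : ∫ ω, |Y ω| ^ γ ∂μ ≤ A)
    (h : ∀ A D, MeasurableSet[m₁] A → MeasurableSet[m₂] D →
      |μ.real (A ∩ D) - μ.real A * μ.real D| ≤ a) :
    |∫ ω, X ω * Y ω ∂μ - (∫ ω, X ω ∂μ) * ∫ ω, Y ω ∂μ| ≤
      (4 + 4 * A + A ^ 2) * a ^ (1 - 2 / γ) := by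
  have hX0 : Measurable[m0] X := hX.mono hm₁ le_rfl
  have hY0 : Measurable[m0] Y := hY.mono hm₂ le_rfl
  have hA0 : 0 ≤ A := (integral_nonneg fun ω => Real.rpow_nonneg (abs_nonneg _) _).trans hXA
  set M : ℝ := a ^ (-1 / γ) with hM
  have hγ0 : 0 < γ := by linarith
  have hM0 : 0 < M := Real.rpow_pos_of_pos ha _
  have hM1 : 1 ≤ M := Real.one_le_rpow_of_pos_of_le_one_of_nonpos ha ha1
    (div_nonpos_of_nonpos_of_nonneg (by norm_num) hγ0.le)
  have hMa : M ^ 2 * a = a ^ (1 - 2 / γ) := by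
    rw [hM, ← Real.rpow_natCast, ← Real.rpow_mul ha.le]
    nth_rw 2 [← Real.rpow_one a]
    rw [← Real.rpow_add ha]
    congr 1; push_cast; field_simp; ring
  have hMg : M ^ (2 - γ) = a ^ (1 - 2 / γ) := by
    rw [hM, ← Real.rpow_mul ha.le]
    congr 1; field_simp; ring
  set r : ℝ := M ^ (2 - γ) with hr
  have hr0 : 0 < r := Real.rpow_pos_of_pos hM0 _
  have hrM : M ^ (1 - γ) * M = r := by
    nth_rw 2 [← Real.rpow_one M]
    rw [hr, ← Real.rpow_add hM0]; congr 1; ring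
  have hs0 : 0 < M ^ (1 - γ) := Real.rpow_pos_of_pos hM0 _
  have hsr : M ^ (1 - γ) ≤ M := by
    calc M ^ (1 - γ) ≤ M ^ (1 : ℝ) := Real.rpow_le_rpow_of_exponent_le hM1 (by linarith)
      _ = M := Real.rpow_one M
  let τ : ℝ → ℝ := fun x => if |x| ≤ M then x else 0
  have hτm : Measurable τ :=
    Measurable.ite (measurableSet_le (by fun_prop) measurable_const) measurable_id measurable_const
  have hτM : ∀ x, |τ x| ≤ M := by
    intro x; simp only [τ]; split_ifs with hx
    · exact hx
    · simpa using hM0.le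
  -- the truncation error, on its own and in a product
  have hτ1 : ∀ x, |x - τ x| ≤ M ^ (1 - γ) * |x| ^ γ := by
    intro x; simp only [τ]; split_ifs with hx
    · simp only [sub_self, abs_zero]; positivity
    · have := pow_le_rpow_mul_rpow_of_lt hM0 (not_le.mp hx) 1 (γ := γ) (by push_cast; linarith)
      simpa using this
  have hτ2 : ∀ x y, |x * y - τ x * τ y| ≤ r * (|x| ^ γ + |y| ^ γ) := by
    intro x y
    have hxg : 0 ≤ |x| ^ γ := by positivity
    have hyg : 0 ≤ |y| ^ γ := by positivity
    by_cases hx : |x| ≤ M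
    · by_cases hy : |y| ≤ M
      · simp only [τ, hx, hy, if_true, sub_self, abs_zero]; positivity
      · have hy' := pow_le_rpow_mul_rpow_of_lt hM0 (not_le.mp hy) 2 (γ := γ) (by push_cast; linarith)
        have : |x * y| ≤ |y| ^ 2 := by
          rw [abs_mul, sq]
          exact mul_le_mul_of_nonneg_right (hx.trans (not_le.mp hy).le) (abs_nonneg _)
        simp only [τ, hy, if_false, mul_zero, sub_zero]
        push_cast at hy'
        nlinarith
    · have hx0 : τ x = 0 := by simp [τ, hx]
      rw [hx0, zero_mul, sub_zero, abs_mul]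
      have hx' := pow_le_rpow_mul_rpow_of_lt hM0 (not_le.mp hx) 2 (γ := γ) (by push_cast; linarith)
      push_cast at hx'
      rcases le_total |y| |x| with hxy | hxy
      · have : |x| * |y| ≤ |x| ^ 2 := by rw [sq]; gcongr
        nlinarith
      · have hy' := pow_le_rpow_mul_rpow_of_lt hM0 ((not_le.mp hx).trans_le hxy) 2 (γ := γ)
          (by push_cast; linarith)
        push_cast at hy'
        have : |x| * |y| ≤ |y| ^ 2 := by rw [sq]; gcongr
        nlinarith
  have bτ : ∀ {Z : Ω → ℝ}, Measurable[m0] Z → Integrable (fun ω => τ (Z ω)) μ := fun hZ =>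
    Integrable.of_bound (hτm.comp hZ).aestronglyMeasurable M (ae_of_all _ fun _ => hτM _)
  have dτ : ∀ {Z : Ω → ℝ}, Measurable[m0] Z → Integrable (fun ω => |Z ω| ^ γ) μ →
      Integrable (fun ω => Z ω - τ (Z ω)) μ := fun hZ hZi =>
    (hZi.const_mul (M ^ (1 - γ))).mono' (hZ.sub (hτm.comp hZ)).aestronglyMeasurable
      (ae_of_all _ fun _ => hτ1 _)
  have iZ : ∀ {Z : Ω → ℝ}, Measurable[m0] Z → Integrable (fun ω => |Z ω| ^ γ) μ →
      Integrable Z μ := fun hZ hZi =>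
    ((dτ hZ hZi).add (bτ hZ)).congr (ae_of_all _ fun ω => by simp)
  have bE : ∀ {Z : Ω → ℝ}, Measurable[m0] Z → |∫ ω, τ (Z ω) ∂μ| ≤ M := by
    intro Z hZ
    simpa using abs_integral_le_of_abs_le (μ := μ) (integrable_const M) fun ω => hτM (Z ω)
  have dE : ∀ {Z : Ω → ℝ}, Measurable[m0] Z → Integrable (fun ω => |Z ω| ^ γ) μ →
      ∫ ω, |Z ω| ^ γ ∂μ ≤ A → |∫ ω, Z ω ∂μ - ∫ ω, τ (Z ω) ∂μ| ≤ M ^ (1 - γ) * A := by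
    intro Z hZ hZi hZA
    rw [← integral_sub (iZ hZ hZi) (bτ hZ)]
    calc |∫ ω, (Z ω - τ (Z ω)) ∂μ| ≤ ∫ ω, M ^ (1 - γ) * |Z ω| ^ γ ∂μ :=
          abs_integral_le_of_abs_le (hZi.const_mul _) fun _ => hτ1 _
      _ = M ^ (1 - γ) * ∫ ω, |Z ω| ^ γ ∂μ := integral_const_mul _ _
      _ ≤ M ^ (1 - γ) * A := by gcongr
  have iττ : Integrable (fun ω => τ (X ω) * τ (Y ω)) μ :=
    (bτ hY0).bdd_mul (hτm.comp hX0).aestronglyMeasurable (ae_of_all _ fun _ => hτM _)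
  have iXYd : Integrable (fun ω => X ω * Y ω - τ (X ω) * τ (Y ω)) μ :=
    ((hXi.add hYi).const_mul r).mono' ((hX0.mul hY0).sub
      ((hτm.comp hX0).mul (hτm.comp hY0))).aestronglyMeasurable (ae_of_all _ fun _ => hτ2 _ _)
  have iXY : Integrable (fun ω => X ω * Y ω) μ :=
    (iXYd.add iττ).congr (ae_of_all _ fun ω => by simp)
  have t1 : |∫ ω, X ω * Y ω ∂μ - ∫ ω, τ (X ω) * τ (Y ω) ∂μ| ≤ r * (2 * A) := by
    rw [← integral_sub iXY iττ]
    calc |∫ ω, (X ω * Y ω - τ (X ω) * τ (Y ω)) ∂μ| ≤ ∫ ω, r * (|X ω| ^ γ + |Y ω| ^ γ) ∂μ :=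
          abs_integral_le_of_abs_le ((hXi.add hYi).const_mul r) fun _ => hτ2 _ _
      _ = r * (∫ ω, |X ω| ^ γ ∂μ + ∫ ω, |Y ω| ^ γ ∂μ) := by
          rw [integral_const_mul, integral_add hXi hYi]
      _ ≤ r * (2 * A) := by rw [two_mul]; gcongr
  have t2 := abs_integral_mul_sub_le_of_bounded hm₁ hm₂ (hτm.comp hX) (hτm.comp hY)
    (fun ω => hτM (X ω)) (fun ω => hτM (Y ω)) h
  simp only [Function.comp_apply] at t2
  set ex := ∫ ω, X ω ∂μ
  set ey := ∫ ω, Y ω ∂μ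
  set ux := ∫ ω, τ (X ω) ∂μ
  set uy := ∫ ω, τ (Y ω) ∂μ
  have t3 : |ex * ey - ux * uy| ≤ r * (A * (2 + A)) := by
    have d1 := dE hX0 hXi hXA
    have d2 := dE hY0 hYi hYA
    have b1 : |ux| ≤ M := bE hX0
    have b2 : |uy| ≤ M := bE hY0
    have b3 : |ey| ≤ M * (1 + A) := by
      calc |ey| = |(ey - uy) + uy| := by ring_nf
        _ ≤ |ey - uy| + |uy| := abs_add_le _ _
        _ ≤ M ^ (1 - γ) * A + M := add_le_add d2 b2
        _ ≤ M * A + M := by gcongr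
        _ = _ := by ring
    calc |ex * ey - ux * uy| = |(ex - ux) * ey + ux * (ey - uy)| := by ring_nf
      _ ≤ |ex - ux| * |ey| + |ux| * |ey - uy| := by
          rw [← abs_mul, ← abs_mul]; exact abs_add_le _ _
      _ ≤ (M ^ (1 - γ) * A) * (M * (1 + A)) + M * (M ^ (1 - γ) * A) := by gcongr
      _ = (M ^ (1 - γ) * M) * (A * (2 + A)) := by ring
      _ = _ := by rw [hrM]
  set p := ∫ ω, X ω * Y ω ∂μ
  set q := ∫ ω, τ (X ω) * τ (Y ω) ∂μ
  have t2' : |q - ux * uy| ≤ 4 * r := by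
    refine t2.trans (le_of_eq ?_)
    rw [hMg, ← hMa]; ring
  calc |p - ex * ey| = |(p - q) + (q - ux * uy) + -(ex * ey - ux * uy)| := by ring_nf
    _ ≤ |p - q| + |q - ux * uy| + |-(ex * ey - ux * uy)| := abs_add_three _ _ _
    _ ≤ r * (2 * A) + 4 * r + r * (A * (2 + A)) := by rw [abs_neg]; gcongr
    _ = (4 + 4 * A + A ^ 2) * r := by ring
    _ = _ := by rw [hMg]

section Mixing

variable {Ω : Type*} [MeasurableSpace Ω] {μ : Measure Ω} [IsProbabilityMeasure μ]
  {E : Type*} [MeasurableSpace E] {Z : ℤ → Ω → E}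

lemma abs_measureReal_inter_sub_le_one (A D : Set Ω) :
    |μ.real (A ∩ D) - μ.real A * μ.real D| ≤ 1 := by
  have h1 : μ.real (A ∩ D) ≤ 1 := measureReal_le_one
  have h2 : μ.real A ≤ 1 := measureReal_le_one
  have h3 : μ.real D ≤ 1 := measureReal_le_one
  have h4 : 0 ≤ μ.real A := measureReal_nonneg
  have h5 : 0 ≤ μ.real D := measureReal_nonneg
  have h6 : 0 ≤ μ.real (A ∩ D) := measureReal_nonneg
  rw [abs_le]; constructor <;> nlinarith

lemma le_alphaMixing (k : ℕ) (i : ℤ) {A D : Set Ω} (hA : MeasurableSet[pastSigma Z i] A)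
    (hD : MeasurableSet[futureSigma Z (i + k)] D) :
    |μ.real (A ∩ D) - μ.real A * μ.real D| ≤ alphaMixing μ Z k :=
  le_csSup ⟨1, by rintro x ⟨j, A, D, -, -, rfl⟩; exact abs_measureReal_inter_sub_le_one A D⟩
    ⟨i, A, D, hA, hD, rfl⟩

lemma alphaMixing_nonneg (k : ℕ) : 0 ≤ alphaMixing μ Z k := by
  refine (abs_nonneg _).trans (le_alphaMixing (μ := μ) (Z := Z) k 0 (A := ∅) (D := ∅) ?_ ?_)
  · exact @MeasurableSet.empty _ (_)
  · exact @MeasurableSet.empty _ (_)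

lemma alphaMixing_le_one (k : ℕ) : alphaMixing μ Z k ≤ 1 := by
  refine csSup_le ?_ ?_
  · exact ⟨_, 0, ∅, ∅, @MeasurableSet.empty _ (_), @MeasurableSet.empty _ (_), rfl⟩
  · rintro x ⟨j, A, D, -, -, rfl⟩; exact abs_measureReal_inter_sub_le_one A D

lemma pastSigma_le (hZ : ∀ t, Measurable (Z t)) (i : ℤ) : pastSigma Z i ≤ ‹MeasurableSpace Ω› :=
  iSup_le fun t => (hZ t).comap_le

lemma futureSigma_le (hZ : ∀ t, Measurable (Z t)) (i : ℤ) :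
    futureSigma Z i ≤ ‹MeasurableSpace Ω› :=
  iSup_le fun t => (hZ t).comap_le

/-- The covariance of a function of the past with a function of the future at lag `k` is controlled
by the mixing coefficient. -/
lemma abs_covariance_le_alphaMixing (hZ : ∀ t, Measurable (Z t)) {X Y : Ω → ℝ} {γ A : ℝ}
    (hγ : 2 < γ) (k : ℕ) (i : ℤ) (hX : Measurable[pastSigma Z i] X)
    (hY : Measurable[futureSigma Z (i + k)] Y)
    (hXi : Integrable (fun ω => |X ω| ^ γ) μ) (hXA : ∫ ω, |X ω| ^ γ ∂μ ≤ A)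
    (hYi : Integrable (fun ω => |Y ω| ^ γ) μ) (hYA : ∫ ω, |Y ω| ^ γ ∂μ ≤ A) :
    |∫ ω, X ω * Y ω ∂μ - (∫ ω, X ω ∂μ) * ∫ ω, Y ω ∂μ| ≤
      (4 + 4 * A + A ^ 2) * alphaMixing μ Z k ^ (1 - 2 / γ) := by
  have h0 : 0 < 1 - 2 / γ := by
    rw [sub_pos, div_lt_one (by linarith)]; exact hγ
  have key : ∀ a : ℝ, 0 < a → a ≤ 1 → alphaMixing μ Z k ≤ a →
      |∫ ω, X ω * Y ω ∂μ - (∫ ω, X ω ∂μ) * ∫ ω, Y ω ∂μ| ≤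
      (4 + 4 * A + A ^ 2) * a ^ (1 - 2 / γ) := fun a ha ha1 hka =>
    abs_integral_mul_sub_le_of_moment (pastSigma_le hZ i) (futureSigma_le hZ _) hγ ha ha1 hX hY
      hXi hXA hYi hYA fun A D hA hD => (le_alphaMixing k i hA hD).trans hka
  rcases (alphaMixing_nonneg (μ := μ) (Z := Z) k).eq_or_lt with h | h
  · -- a vanishing coefficient is approximated by positive ones
    have hc : Tendsto (fun a : ℝ => (4 + 4 * A + A ^ 2) * a ^ (1 - 2 / γ)) (𝓝[>] 0)
        (𝓝 ((4 + 4 * A + A ^ 2) * (0 : ℝ) ^ (1 - 2 / γ))) :=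
      ((Real.continuousAt_rpow_const 0 _ (Or.inr h0.le)).tendsto.mono_left
        nhdsWithin_le_nhds).const_mul _
    rw [← h]
    refine ge_of_tendsto hc ?_
    filter_upwards [Ioo_mem_nhdsGT (zero_lt_one' ℝ)] with a ha
    exact key a ha.1 ha.2.le (h ▸ ha.1.le)
  · exact key _ h (alphaMixing_le_one k) le_rfl

end Mixing

/-! ### Exponential and absolute moments -/

section Moments

variable {Ω : Type*} [MeasurableSpace Ω] {μ : Measure Ω}

/-- `E exp(c |X|) ≤ A`, including the integrability of `exp(c |X|)`. -/
def ExpMomentLE (μ : Measure Ω) (c A : ℝ) (X : Ω → ℝ) : Prop :=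
  Integrable (fun ω => Real.exp (c * |X ω|)) μ ∧ ∫ ω, Real.exp (c * |X ω|) ∂μ ≤ A

/-- `E |X| ^ p ≤ A`, including the integrability of `|X| ^ p`. -/
def MomentLE (μ : Measure Ω) (p A : ℝ) (X : Ω → ℝ) : Prop :=
  Integrable (fun ω => |X ω| ^ p) μ ∧ ∫ ω, |X ω| ^ p ∂μ ≤ A

lemma integrable_and_integral_le_of_lintegral_le {g : Ω → ℝ} (hg : Measurable g)
    (hg0 : ∀ ω, 0 ≤ g ω) {A : ℝ≥0∞} (hA : A ≠ ∞) (h : ∫⁻ ω, ENNReal.ofReal (g ω) ∂μ ≤ A) :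
    Integrable g μ ∧ ∫ ω, g ω ∂μ ≤ A.toReal := by
  refine ⟨(lintegral_ofReal_ne_top_iff_integrable hg.aestronglyMeasurable
    (ae_of_all _ hg0)).mp (h.trans_lt hA.lt_top).ne, ?_⟩
  rw [integral_eq_lintegral_of_nonneg_ae (ae_of_all _ hg0) hg.aestronglyMeasurable]
  exact ENNReal.toReal_mono hA h

/-- A random variable with tails `c₁ exp(-2 c x)` has a bounded exponential moment of order `c`:
`exp(c |X|)` is dominated by its values at the integers. -/
lemma expMomentLE_of_tail [IsProbabilityMeasure μ] {c c₁ : ℝ} (hc : 0 < c) :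
    ∃ A : ℝ, 1 ≤ A ∧ ∀ X : Ω → ℝ, Measurable X →
      (∀ x : ℝ, 0 < x → μ.real {ω | x < |X ω|} ≤ c₁ * Real.exp (-(2 * c * x))) →
      ExpMomentLE μ c A X := by
  have hq : ENNReal.ofReal (Real.exp (-c)) < 1 := by
    rw [ENNReal.ofReal_lt_one]; exact Real.exp_lt_one_iff.mpr (by linarith)
  set A : ℝ≥0∞ := ENNReal.ofReal (Real.exp c) +
    ENNReal.ofReal c₁ * (1 - ENNReal.ofReal (Real.exp (-c)))⁻¹ with hA
  have hAtop : A ≠ ∞ := by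
    refine ENNReal.add_ne_top.mpr ⟨ENNReal.ofReal_ne_top,
      ENNReal.mul_ne_top ENNReal.ofReal_ne_top (ENNReal.inv_ne_top.mpr ?_)⟩
    exact (tsub_pos_iff_lt.mpr hq).ne'
  refine ⟨A.toReal, ?_, fun X hX hT => ?_⟩
  · rw [← ENNReal.ofReal_le_iff_le_toReal hAtop, ENNReal.ofReal_one]
    refine le_add_right ?_
    rw [ENNReal.one_le_ofReal]
    exact Real.one_le_exp hc.le
  · refine integrable_and_integral_le_of_lintegral_le (by fun_prop)
      (fun ω => (Real.exp_pos _).le) hAtop ?_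
    have hS : ∀ n : ℕ, MeasurableSet {ω | (n : ℝ) + 1 < |X ω|} := fun n =>
      measurableSet_lt measurable_const (by fun_prop)
    have hpt : ∀ ω, ENNReal.ofReal (Real.exp (c * |X ω|)) ≤ ENNReal.ofReal (Real.exp c) +
        ∑' n : ℕ, {ω | (n : ℝ) + 1 < |X ω|}.indicator
          (fun _ => ENNReal.ofReal (Real.exp (c * (n + 2)))) ω := by
      intro ω
      by_cases h1 : |X ω| ≤ 1
      · refine le_add_right (ENNReal.ofReal_le_ofReal (Real.exp_le_exp.mpr ?_))
        nlinarith
      · refine le_add_left ?_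
        rw [not_le] at h1
        have h2 : 1 < ⌈|X ω|⌉₊ := Nat.lt_ceil.mpr (by exact_mod_cast h1)
        obtain ⟨n, hn⟩ : ∃ n : ℕ, ⌈|X ω|⌉₊ = n + 2 := ⟨⌈|X ω|⌉₊ - 2, by omega⟩
        have h3 : ((n + 1 : ℕ) : ℝ) < |X ω| := Nat.lt_ceil.mp (by omega)
        have h4 : |X ω| ≤ ((n + 2 : ℕ) : ℝ) := Nat.ceil_le.mp hn.le
        push_cast at h3 h4
        refine le_trans ?_ (ENNReal.le_tsum n)
        rw [Set.indicator_of_mem (by exact h3)]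
        exact ENNReal.ofReal_le_ofReal (Real.exp_le_exp.mpr (by gcongr))
    have hterm : ∀ n : ℕ, ENNReal.ofReal (Real.exp (c * (n + 2))) *
        μ {ω | (n : ℝ) + 1 < |X ω|} ≤
        ENNReal.ofReal c₁ * ENNReal.ofReal (Real.exp (-c)) ^ n := by
      intro n
      rw [← ofReal_measureReal, ← ENNReal.ofReal_mul (Real.exp_pos _).le,
        ← ENNReal.ofReal_pow (Real.exp_pos _).le,
        ← ENNReal.ofReal_mul' (pow_nonneg (Real.exp_pos _).le _)]
      refine ENNReal.ofReal_le_ofReal ?_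
      calc Real.exp (c * (n + 2)) * μ.real {ω | (n : ℝ) + 1 < |X ω|}
          ≤ Real.exp (c * (n + 2)) * (c₁ * Real.exp (-(2 * c * (n + 1)))) := by
            gcongr; exact hT _ (by positivity)
        _ = c₁ * Real.exp (-c) ^ n := by
            rw [mul_left_comm, ← Real.exp_add, ← Real.exp_nat_mul]
            congr 2; ring
    calc ∫⁻ ω, ENNReal.ofReal (Real.exp (c * |X ω|)) ∂μ
        ≤ ∫⁻ ω, (ENNReal.ofReal (Real.exp c) +
          ∑' n : ℕ, {ω | (n : ℝ) + 1 < |X ω|}.indicator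
            (fun _ => ENNReal.ofReal (Real.exp (c * (n + 2)))) ω) ∂μ := lintegral_mono hpt
      _ = ENNReal.ofReal (Real.exp c) + ∑' n : ℕ, ENNReal.ofReal (Real.exp (c * (n + 2))) *
          μ {ω | (n : ℝ) + 1 < |X ω|} := by
          rw [lintegral_add_left measurable_const, lintegral_tsum fun n =>
            (measurable_const.indicator (hS n)).aemeasurable]
          congr 1
          · simp
          · exact tsum_congr fun n => lintegral_indicator_const (hS n) _
      _ ≤ ENNReal.ofReal (Real.exp c) +
          ∑' n : ℕ, ENNReal.ofReal c₁ * ENNReal.ofReal (Real.exp (-c)) ^ n := by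
          exact add_le_add_right (ENNReal.tsum_le_tsum hterm) _
      _ = A := by rw [ENNReal.tsum_mul_left, ENNReal.tsum_geometric]

lemma ExpMomentLE.of_mul_abs_le {c c' A : ℝ} {X Y : Ω → ℝ} (h : ExpMomentLE μ c A X)
    (hY : Measurable Y) (hXY : ∀ ω, c' * |Y ω| ≤ c * |X ω|) : ExpMomentLE μ c' A Y := by
  have hle : ∀ ω, Real.exp (c' * |Y ω|) ≤ Real.exp (c * |X ω|) := fun ω =>
    Real.exp_le_exp.mpr (hXY ω)
  have hi : Integrable (fun ω => Real.exp (c' * |Y ω|)) μ :=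
    h.1.mono' (by fun_prop) (ae_of_all _ fun ω => by
      rw [Real.norm_eq_abs, Real.abs_exp]; exact hle ω)
  exact ⟨hi, (integral_mono hi h.1 hle).trans h.2⟩

/-- Linear combinations of the coordinates of a vector process with sub-exponential tails have
exponential moments that only depend on a bound for the Euclidean norm of the coefficients. -/
lemma SubExponential.exists_expMomentLE [IsProbabilityMeasure μ] (c₁ : ℝ) {c₂ : ℝ} (hc₂ : 0 < c₂) :
    ∃ A : ℝ, 1 ≤ A ∧ ∀ (n : ℕ) (X : ℤ → Ω → Fin n → ℝ), (∀ t, Measurable (X t)) →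
      SubExponential μ c₁ c₂ X → ∀ (D : ℝ), 0 < D → ∀ (v : Fin n → ℝ), v ⬝ᵥ v ≤ D ^ 2 →
      ∀ t, ExpMomentLE μ (c₂ / 2 / D) A fun ω => v ⬝ᵥ X t ω := by
  obtain ⟨A, hA1, hA⟩ := expMomentLE_of_tail (μ := μ) (c₁ := c₁) (half_pos hc₂)
  refine ⟨A, hA1, fun n X hXm hX D hD v hv t => ?_⟩
  have hm : ∀ w : Fin n → ℝ, Measurable fun ω => w ⬝ᵥ X t ω := by
    intro w
    simp only [dotProduct]
    exact Finset.measurable_sum _ fun i _ => ((measurable_pi_apply i).comp (hXm t)).const_mul _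
  have hv0 : 0 ≤ v ⬝ᵥ v := Finset.sum_nonneg fun i _ => mul_self_nonneg _
  rcases hv0.eq_or_lt with h0 | h0
  · have : v = 0 := by rw [← dotProduct_self_eq_zero]; exact h0.symm
    subst this
    refine ⟨by simp, by simpa using hA1⟩
  · set s := √(v ⬝ᵥ v) with hs
    have hs0 : 0 < s := Real.sqrt_pos.mpr h0
    have hss : s * s = v ⬝ᵥ v := Real.mul_self_sqrt h0.le
    have hsD : s ≤ D := Real.sqrt_le_iff.mpr ⟨hD.le, hv⟩
    have hu : (s⁻¹ • v) ⬝ᵥ (s⁻¹ • v) = 1 := by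
      rw [smul_dotProduct, dotProduct_smul, ← hss, smul_eq_mul, smul_eq_mul]
      field_simp
    have h := hA _ (hm (s⁻¹ • v)) fun x hx => by
      have := hX _ hu t x hx
      rwa [mul_div_cancel₀ _ (two_ne_zero' ℝ)]
    refine h.of_mul_abs_le (hm v) fun ω => ?_
    have e : v ⬝ᵥ X t ω = s * ((s⁻¹ • v) ⬝ᵥ X t ω) := by
      rw [smul_dotProduct, smul_eq_mul, mul_inv_cancel_left₀ hs0.ne']
    rw [e, abs_mul, abs_of_pos hs0, ← mul_assoc]
    gcongr
    rw [div_mul_eq_mul_div, div_le_iff₀ hD]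
    gcongr

lemma ExpMomentLE.momentLE {c A : ℝ} {X : Ω → ℝ} (hX : Measurable X) (h : ExpMomentLE μ c A X)
    (hc : 0 < c) {p : ℝ} (hp : 0 ≤ p) : MomentLE μ p ((p / c) ^ p * A) X := by
  have hle : ∀ ω, |X ω| ^ p ≤ (p / c) ^ p * Real.exp (c * |X ω|) := fun ω => by
    simpa [abs_of_pos hc] using rpow_abs_le_mul_exp_abs (X ω) hp hc.ne'
  have hi : Integrable (fun ω => |X ω| ^ p) μ :=
    (h.1.const_mul _).mono' (by fun_prop) (ae_of_all _ fun ω => by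
      rw [Real.norm_eq_abs, abs_of_nonneg (by positivity)]; exact hle ω)
  refine ⟨hi, (integral_mono hi (h.1.const_mul _) hle).trans ?_⟩
  rw [integral_const_mul]
  gcongr
  exact h.2

lemma MomentLE.mul {p A : ℝ} {X Y : Ω → ℝ} (hX : Measurable X) (hY : Measurable Y)
    (hp : 0 ≤ p) (h : MomentLE μ (2 * p) A X) (h' : MomentLE μ (2 * p) A Y) :
    MomentLE μ p (2 * A) fun ω => X ω * Y ω := by
  have hle : ∀ ω, |X ω * Y ω| ^ p ≤ |X ω| ^ (2 * p) + |Y ω| ^ (2 * p) := fun ω => by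
    have e : ∀ x : ℝ, |x| ^ (2 * p) = (|x| ^ p) ^ 2 := fun x => by
      rw [mul_comm, Real.rpow_mul (abs_nonneg _)]; norm_cast
    rw [abs_mul, Real.mul_rpow (abs_nonneg _) (abs_nonneg _), e, e]
    nlinarith [sq_nonneg (|X ω| ^ p - |Y ω| ^ p), sq_nonneg (|X ω| ^ p), sq_nonneg (|Y ω| ^ p)]
  have hi : Integrable (fun ω => |X ω * Y ω| ^ p) μ :=
    (h.1.add h'.1).mono' (by fun_prop) (ae_of_all _ fun ω => by
      rw [Real.norm_eq_abs, abs_of_nonneg (by positivity)]; exact hle ω)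
  refine ⟨hi, (integral_mono hi (h.1.add h'.1) hle).trans ?_⟩
  rw [integral_add' h.1 h'.1]
  linarith [h.2, h'.2]

lemma sq_le_one_add_abs_rpow {p : ℝ} (hp : 2 ≤ p) (x : ℝ) : x ^ 2 ≤ 1 + |x| ^ p := by
  rw [← sq_abs]
  rcases le_total |x| 1 with h | h
  · have : 0 ≤ |x| ^ p := by positivity
    nlinarith [abs_nonneg x]
  · have := Real.rpow_le_rpow_of_exponent_le h hp
    rw [Real.rpow_two] at this
    linarith

lemma MomentLE.memLp_two [IsProbabilityMeasure μ] {p A : ℝ} {X : Ω → ℝ} (hX : Measurable X)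
    (hp : 2 ≤ p) (h : MomentLE μ p A X) : MemLp X 2 μ := by
  rw [memLp_two_iff_integrable_sq hX.aestronglyMeasurable]
  exact ((integrable_const (1 : ℝ)).add h.1).mono' (by fun_prop) (ae_of_all _ fun ω => by
    rw [Real.norm_eq_abs, abs_of_nonneg (sq_nonneg _)]; exact sq_le_one_add_abs_rpow hp _)

lemma MomentLE.integral_sq_le [IsProbabilityMeasure μ] {p A : ℝ} {X : Ω → ℝ} (hX : Measurable X)
    (hp : 2 ≤ p) (h : MomentLE μ p A X) : ∫ ω, X ω ^ 2 ∂μ ≤ 1 + A := by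
  have h2 := integral_mono (h.memLp_two hX hp).integrable_sq
    ((integrable_const (1 : ℝ)).add h.1) fun ω => sq_le_one_add_abs_rpow hp (X ω)
  rw [integral_add' (integrable_const _) h.1] at h2
  simp only [integral_const, probReal_univ, smul_eq_mul, mul_one] at h2
  linarith [h.2]

/-- Chernoff bound. -/
lemma ExpMomentLE.measure_le {c A : ℝ} {X : Ω → ℝ} (h : ExpMomentLE μ c A X) [IsFiniteMeasure μ]
    (hc : 0 < c) (x : ℝ) :
    μ {ω | x < |X ω|} ≤ ENNReal.ofReal (A * Real.exp (-(c * x))) := by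
  have h1 := mul_meas_ge_le_integral_of_nonneg
    (ae_of_all μ fun ω => (Real.exp_pos (c * |X ω|)).le) h.1 (Real.exp (c * x))
  have h2 : μ.real {ω | x < |X ω|} ≤ μ.real {ω | Real.exp (c * x) ≤ Real.exp (c * |X ω|)} :=
    measureReal_mono fun ω hω => Real.exp_le_exp.mpr (by
      have : x < |X ω| := hω
      gcongr)
  rw [← ofReal_measureReal]
  refine ENNReal.ofReal_le_ofReal ?_
  rw [Real.exp_neg, ← div_eq_mul_inv, le_div_iff₀ (Real.exp_pos _)]
  have := mul_le_mul_of_nonneg_left h2 (Real.exp_pos (c * x)).le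
  linarith [h.2]

/-- Maximal inequality over the times `1, …, T`, by the union bound. -/
lemma ExpMomentLE.measure_exists_le {c A : ℝ} [IsFiniteMeasure μ] {X : ℤ → Ω → ℝ} (T : ℕ)
    (h : ∀ t, ExpMomentLE μ c A (X t)) (hc : 0 < c) (x : ℝ) :
    μ {ω | ∃ t ∈ Finset.Icc (1 : ℤ) T, x < |X t ω|} ≤
      ENNReal.ofReal (T * (A * Real.exp (-(c * x)))) := by
  have e : {ω | ∃ t ∈ Finset.Icc (1 : ℤ) T, x < |X t ω|} =
      ⋃ t ∈ Finset.Icc (1 : ℤ) T, {ω | x < |X t ω|} := by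
    ext ω; simp
  rw [e]
  refine (measure_biUnion_finset_le _ _).trans ?_
  refine (Finset.sum_le_sum fun t _ => (h t).measure_le hc x).trans ?_
  rw [Finset.sum_const, Int.card_Icc, nsmul_eq_mul, ENNReal.ofReal_mul (Nat.cast_nonneg T),
    ENNReal.ofReal_natCast]
  simp only [add_sub_cancel_right, Int.toNat_natCast, le_refl]

lemma cosh_mul_sqrt_mean_sq_le {n : ℕ} (hn : 0 < n) (c : ℝ) (x : Fin n → ℝ) :
    Real.cosh (c * √((n : ℝ)⁻¹ * ∑ i, x i ^ 2)) ≤ (n : ℝ)⁻¹ * ∑ i, Real.cosh (c * x i) := by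
  have hn' : (n : ℝ) ≠ 0 := by positivity
  -- compare the power series of both sides term by term, with the inequality of power means
  refine hasSum_le (fun k => ?_) (Real.hasSum_cosh _)
    ((hasSum_sum fun i _ => Real.hasSum_cosh (c * x i)).mul_left (n : ℝ)⁻¹)
  have h := Real.pow_arith_mean_le_arith_mean_pow Finset.univ (fun _ : Fin n => (n : ℝ)⁻¹)
    (fun i => x i ^ 2) (fun _ _ => by positivity) (by simp [hn']) (fun _ _ => sq_nonneg _) k
  simp only [← Finset.mul_sum, ← pow_mul] at h
  rw [← Finset.sum_div, mul_div_assoc']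
  gcongr
  simp_rw [mul_pow, ← Finset.mul_sum]
  rw [pow_mul (√_), Real.sq_sqrt (by positivity), mul_left_comm]
  gcongr
  exact (even_two_mul k).pow_nonneg _

lemma exp_le_two_mul_cosh (x : ℝ) : Real.exp x ≤ 2 * Real.cosh x := by
  rw [Real.cosh_eq]; linarith [Real.exp_pos (-x)]

lemma cosh_le_exp_abs (x : ℝ) : Real.cosh x ≤ Real.exp |x| := by
  rw [← Real.cosh_abs, Real.cosh_eq]
  have : Real.exp (-|x|) ≤ Real.exp |x| :=
    Real.exp_le_exp.mpr (by linarith [abs_nonneg x])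
  linarith

/-- The root mean square of random variables with a common exponential moment bound has an
exponential moment bound, whatever the dependence between them. -/
lemma expMomentLE_sqrt_mean_sq {n : ℕ} (hn : 0 < n) {c A : ℝ} (hc : 0 < c) {X : Ω → Fin n → ℝ}
    (hX : Measurable X) (h : ∀ i, ExpMomentLE μ c A fun ω => X ω i) :
    ExpMomentLE μ c (2 * A) fun ω => √((n : ℝ)⁻¹ * ∑ i, X ω i ^ 2) := by
  have hn' : (n : ℝ) ≠ 0 := by positivity
  have hle : ∀ ω, Real.exp (c * |√((n : ℝ)⁻¹ * ∑ i, X ω i ^ 2)|) ≤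
      2 * ((n : ℝ)⁻¹ * ∑ i, Real.exp (c * |X ω i|)) := fun ω => by
    rw [abs_of_nonneg (Real.sqrt_nonneg _)]
    refine (exp_le_two_mul_cosh _).trans ?_
    gcongr
    refine (cosh_mul_sqrt_mean_sq_le hn c _).trans ?_
    gcongr with i
    refine (cosh_le_exp_abs _).trans (le_of_eq ?_)
    rw [abs_mul, abs_of_pos hc]
  have hgi : Integrable (fun ω => 2 * ((n : ℝ)⁻¹ * ∑ i, Real.exp (c * |X ω i|))) μ :=
    ((integrable_finsetSum _ fun i _ => (h i).1).const_mul _).const_mul _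
  have hi : Integrable (fun ω => Real.exp (c * |√((n : ℝ)⁻¹ * ∑ i, X ω i ^ 2)|)) μ :=
    hgi.mono' (by fun_prop) (ae_of_all _ fun ω => by
      rw [Real.norm_eq_abs, Real.abs_exp]; exact hle ω)
  refine ⟨hi, (integral_mono hi hgi hle).trans ?_⟩
  rw [integral_const_mul, integral_const_mul, integral_finsetSum _ fun i _ => (h i).1]
  gcongr
  calc (n : ℝ)⁻¹ * ∑ i, ∫ ω, Real.exp (c * |X ω i|) ∂μ ≤ (n : ℝ)⁻¹ * ∑ _i : Fin n, A := by
        gcongr with i; exact (h i).2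
    _ = A := by simp [hn']

end Moments

/-! ### Variances of sums and sample cross moments of mixing processes -/

section Sums

open scoped Matrix.Norms.Frobenius

lemma sum_natAbs_sub_le {g : ℕ → ℝ} (hg0 : ∀ n, 0 ≤ g n) (hg : Summable g) (s : ℤ)
    (I : Finset ℤ) : ∑ t ∈ I, g (s - t).natAbs ≤ 2 * ∑' n, g n := by
  have aux : ∀ J : Finset ℤ, Set.InjOn (fun t : ℤ => (s - t).natAbs) J →
      ∑ t ∈ J, g (s - t).natAbs ≤ ∑' n, g n := fun J hJ => by
    rw [← Finset.sum_image (f := g) hJ]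
    exact hg.sum_le_tsum _ fun n _ => hg0 n
  rw [← Finset.sum_filter_add_sum_filter_not I (fun t => t ≤ s), two_mul]
  refine add_le_add (aux _ ?_) (aux _ ?_)
  · intro a ha b hb hab
    simp only [Finset.coe_filter, Set.mem_ofPred_eq] at ha hb hab
    omega
  · intro a ha b hb hab
    simp only [Finset.coe_filter, Set.mem_ofPred_eq] at ha hb hab
    omega

variable {Ω : Type*}

/-- The sample cross moment `T⁻¹ ∑_{t=k+1}^T u_t v_{t-k}'`. -/
def crossMoment {m n : ℕ} (u : ℤ → Ω → Fin m → ℝ) (v : ℤ → Ω → Fin n → ℝ) (T k : ℕ) (ω : Ω) :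
    Matrix (Fin m) (Fin n) ℝ :=
  (T : ℝ)⁻¹ • ∑ t ∈ Finset.Icc ((k : ℤ) + 1) (T : ℤ), vecMulVec (u t ω) (v (t - k) ω)

lemma crossMoment_apply {m n : ℕ} (u : ℤ → Ω → Fin m → ℝ) (v : ℤ → Ω → Fin n → ℝ) (T k : ℕ)
    (ω : Ω) (i : Fin m) (j : Fin n) : crossMoment u v T k ω i j =
      (T : ℝ)⁻¹ * ∑ t ∈ Finset.Icc ((k : ℤ) + 1) (T : ℤ), u t ω i * v (t - k) ω j := by
  simp [crossMoment, Matrix.sum_apply, vecMulVec_apply]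

lemma frobenius_norm_sq {m n : ℕ} (A : Matrix (Fin m) (Fin n) ℝ) :
    ‖A‖ ^ 2 = ∑ i, ∑ j, A i j ^ 2 := by
  rw [frobenius_norm_def, ← Real.sqrt_eq_rpow, Real.sq_sqrt (by positivity)]
  simp

variable [MeasurableSpace Ω] {μ : Measure Ω} [IsProbabilityMeasure μ]
  {E : Type*} [MeasurableSpace E] {Z : ℤ → Ω → E}

lemma abs_covariance_le_of_integral_sq_le {X Y : Ω → ℝ} {A : ℝ} (hX : MemLp X 2 μ)
    (hY : MemLp Y 2 μ) (hXA : ∫ ω, X ω ^ 2 ∂μ ≤ A) (hYA : ∫ ω, Y ω ^ 2 ∂μ ≤ A) :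
    |cov[X, Y; μ]| ≤ A := by
  have h1 : |cov[X, Y; μ]| ≤ (Var[X; μ] + Var[Y; μ]) / 2 := by
    have a := variance_nonneg (X + Y) μ
    have b := variance_nonneg (X - Y) μ
    rw [variance_add hX hY] at a
    rw [variance_sub hX hY] at b
    rw [abs_le]; constructor <;> linarith
  have hx := variance_le_expectation_sq (μ := μ) hX.1
  have hy := variance_le_expectation_sq (μ := μ) hY.1
  simp only [Pi.pow_apply] at hx hy
  linarith

/-- The constant in the variance bound for sums of a mixing process with dependence lag `k`,
moments bounded by `A` and summed mixing coefficients bounded by `C`. -/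
def varianceConst (A C : ℝ) (k : ℕ) : ℝ :=
  2 * ((k + 1) * (1 + A) + (4 + 4 * A + A ^ 2) * C)

/-- The variance of a sum of `T` consecutive terms of a mixing process is of order `T`. Each term
may depend on the underlying process at the times `t - k, …, t`. -/
lemma variance_sum_le {γ A C : ℝ} (hγ : 2 < γ) {k : ℕ} (hZ : ∀ t, Measurable (Z t))
    (hsum : Summable fun n : ℕ => alphaMixing μ Z (n + 1) ^ (1 - 2 / γ))
    (hle : ∑' n : ℕ, alphaMixing μ Z (n + 1) ^ (1 - 2 / γ) ≤ C) {X : ℤ → Ω → ℝ}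
    (hX₁ : ∀ t, Measurable[pastSigma Z t] (X t))
    (hX₂ : ∀ t, Measurable[futureSigma Z (t - k)] (X t))
    (hX : ∀ t, MomentLE μ γ A (X t)) (T : ℕ) :
    Var[fun ω => ∑ t ∈ Finset.Icc ((k : ℤ) + 1) T, X t ω; μ] ≤ varianceConst A C k * T := by
  have hA0 : 0 ≤ A := (integral_nonneg fun ω => Real.rpow_nonneg (abs_nonneg _) _).trans (hX 0).2
  have hXm : ∀ t, Measurable (X t) := fun t => (hX₁ t).mono (pastSigma_le hZ t) le_rfl
  have hX2 : ∀ t, MemLp (X t) 2 μ := fun t => (hX t).memLp_two (hXm t) hγ.le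
  set D := 4 + 4 * A + A ^ 2 with hD
  have hD0 : 0 ≤ D := by positivity
  let g : ℕ → ℝ := fun n => if n ≤ k then 1 + A else D * alphaMixing μ Z (n - k) ^ (1 - 2 / γ)
  have hg0 : ∀ n, 0 ≤ g n := fun n => by
    simp only [g]; split_ifs
    · positivity
    · exact mul_nonneg hD0 (Real.rpow_nonneg (alphaMixing_nonneg _) _)
  have hgs : ∀ n, g (n + (k + 1)) = D * alphaMixing μ Z (n + 1) ^ (1 - 2 / γ) := fun n => by
    simp only [g]
    rw [if_neg (by omega), show n + (k + 1) - k = n + 1 by omega]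
  have hgsum : Summable g := by
    rw [← summable_nat_add_iff (k + 1)]
    simp_rw [hgs]
    exact hsum.mul_left D
  have hgle : 2 * ∑' n, g n ≤ varianceConst A C k := by
    rw [← hgsum.sum_add_tsum_nat_add (k + 1)]
    simp_rw [hgs]
    rw [tsum_mul_left]
    have : ∑ i ∈ Finset.range (k + 1), g i = (k + 1) * (1 + A) := by
      rw [Finset.sum_congr rfl fun i hi => show g i = 1 + A from
        if_pos (by have := Finset.mem_range.mp hi; omega)]
      simp only [Finset.sum_const, Finset.card_range, nsmul_eq_mul]
      push_cast; ring
    rw [this, varianceConst]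
    gcongr
  have hlag : ∀ s t : ℤ, s + k < t → |cov[X s, X t; μ]| ≤ g (s - t).natAbs := fun s t hst => by
    have hn : ¬ (s - t).natAbs ≤ k := by omega
    simp only [g, if_neg hn]
    rw [covariance_eq_sub (hX2 s) (hX2 t)]
    refine abs_covariance_le_alphaMixing hZ hγ _ s (hX₁ s) ?_ (hX s).1 (hX s).2 (hX t).1 (hX t).2
    have : s + (((s - t).natAbs - k : ℕ) : ℤ) = t - k := by omega
    rw [this]; exact hX₂ t
  have hcov : ∀ s t : ℤ, cov[X s, X t; μ] ≤ g (s - t).natAbs := fun s t => by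
    refine (le_abs_self _).trans ?_
    rcases lt_or_ge (s + k) t with h | h
    · exact hlag s t h
    · rcases lt_or_ge (t + k) s with h' | h'
      · rw [covariance_comm, ← neg_sub, Int.natAbs_neg]; exact hlag t s h'
      · simp only [g]
        rw [if_pos (by omega)]
        exact abs_covariance_le_of_integral_sq_le (hX2 s) (hX2 t)
          ((hX s).integral_sq_le (hXm s) hγ.le) ((hX t).integral_sq_le (hXm t) hγ.le)
  have hV0 : 0 ≤ varianceConst A C k :=
    le_trans (mul_nonneg zero_le_two (tsum_nonneg hg0)) hgle
  rw [variance_fun_sum' fun t _ => hX2 t]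
  calc ∑ s ∈ Finset.Icc ((k : ℤ) + 1) T, ∑ t ∈ Finset.Icc ((k : ℤ) + 1) T, cov[X s, X t; μ]
      ≤ ∑ s ∈ Finset.Icc ((k : ℤ) + 1) T, varianceConst A C k := by
        refine Finset.sum_le_sum fun s _ => ?_
        exact (Finset.sum_le_sum fun t _ => hcov s t).trans
          ((sum_natAbs_sub_le hg0 hgsum s _).trans hgle)
    _ ≤ varianceConst A C k * T := by
        rw [Finset.sum_const, Int.card_Icc, nsmul_eq_mul, mul_comm]
        refine mul_le_mul_of_nonneg_left ?_ hV0
        exact_mod_cast (by omega : ((T : ℤ) + 1 - (k + 1)).toNat ≤ T)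

/-- The entrywise expectation of the sample cross moment. -/
def meanCrossMoment (μ : Measure Ω) {m n : ℕ} (u : ℤ → Ω → Fin m → ℝ) (v : ℤ → Ω → Fin n → ℝ)
    (T k : ℕ) : Matrix (Fin m) (Fin n) ℝ :=
  Matrix.of fun i j => (T : ℝ)⁻¹ * ∑ t ∈ Finset.Icc ((k : ℤ) + 1) (T : ℤ),
    ∫ ω, u t ω i * v (t - k) ω j ∂μ

/-- Law of large numbers with rate for sample cross moments of functions `u`, `v` of a mixing
process: the error is at most of the order `√(m n / T)`, in the Frobenius norm, in probability. -/
lemma measure_norm_crossMoment_sub_le {γ A C : ℝ} (hγ : 2 < γ) {k : ℕ}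
    (hZ : ∀ t, Measurable (Z t))
    (hsum : Summable fun n : ℕ => alphaMixing μ Z (n + 1) ^ (1 - 2 / γ))
    (hle : ∑' n : ℕ, alphaMixing μ Z (n + 1) ^ (1 - 2 / γ) ≤ C) {m n : ℕ}
    {u : ℤ → Ω → Fin m → ℝ} {v : ℤ → Ω → Fin n → ℝ}
    (hu : ∀ t i, Measurable[MeasurableSpace.comap (Z t) inferInstance] fun ω => u t ω i)
    (hv : ∀ t i, Measurable[MeasurableSpace.comap (Z t) inferInstance] fun ω => v t ω i)
    (huA : ∀ t i, MomentLE μ (2 * γ) A fun ω => u t ω i)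
    (hvA : ∀ t i, MomentLE μ (2 * γ) A fun ω => v t ω i) {T : ℕ} (hT : 0 < T) {x : ℝ}
    (hx : 0 < x) :
    μ {ω | x < ‖crossMoment u v T k ω - meanCrossMoment μ u v T k‖} ≤
      ENNReal.ofReal (m * n * varianceConst (2 * A) C k / (T * x ^ 2)) := by
  have hT' : (0 : ℝ) < T := by exact_mod_cast hT
  have hum : ∀ t i, Measurable fun ω => u t ω i := fun t i => (hu t i).mono (hZ t).comap_le le_rfl
  have hvm : ∀ t i, Measurable fun ω => v t ω i := fun t i => (hv t i).mono (hZ t).comap_le le_rfl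
  have hmom : ∀ t i j, MomentLE μ γ (2 * A) fun ω => u t ω i * v (t - k) ω j := fun t i j =>
    MomentLE.mul (hum _ _) (hvm _ _) (by linarith) (huA t i) (hvA _ j)
  have hle1 : ∀ t s : ℤ, s ≤ t → MeasurableSpace.comap (Z s) inferInstance ≤ pastSigma Z t :=
    fun t s hst => le_iSup (fun r : Set.Iic t => MeasurableSpace.comap (Z r) inferInstance)
      ⟨s, hst⟩
  have hle2 : ∀ t s : ℤ, t ≤ s → MeasurableSpace.comap (Z s) inferInstance ≤ futureSigma Z t :=
    fun t s hst => le_iSup (fun r : Set.Ici t => MeasurableSpace.comap (Z r) inferInstance)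
      ⟨s, hst⟩
  have hpm : ∀ t i j, Measurable fun ω => u t ω i * v (t - k) ω j := fun t i j =>
    (hum t i).mul (hvm _ j)
  have hp2 : ∀ t i j, MemLp (fun ω => u t ω i * v (t - k) ω j) 2 μ := fun t i j =>
    (hmom t i j).memLp_two (hpm t i j) hγ.le
  have hvar : ∀ i j, Var[fun ω => crossMoment u v T k ω i j; μ] ≤
      varianceConst (2 * A) C k / T := fun i j => by
    simp_rw [crossMoment_apply]
    rw [variance_const_mul]
    have h := variance_sum_le (k := k) (C := C) hγ hZ hsum hle
      (X := fun t ω => u t ω i * v (t - k) ω j)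
      (fun t => ((hu t i).mono (hle1 _ _ le_rfl) le_rfl).mul
        ((hv _ j).mono (hle1 _ _ (by omega)) le_rfl))
      (fun t => ((hu t i).mono (hle2 _ _ (by omega)) le_rfl).mul
        ((hv _ j).mono (hle2 _ _ le_rfl) le_rfl)) (fun t => hmom t i j) T
    calc _ ≤ ((T : ℝ)⁻¹) ^ 2 * (varianceConst (2 * A) C k * T) := by gcongr
      _ = _ := by field_simp
  have hmean : ∀ i j, ∫ ω, crossMoment u v T k ω i j ∂μ = meanCrossMoment μ u v T k i j :=
    fun i j => by
      simp_rw [crossMoment_apply]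
      rw [integral_const_mul, integral_finsetSum _ fun t _ => (hp2 t i j).integrable one_le_two]
      rfl
  have hW2 : ∀ i j, MemLp (fun ω => crossMoment u v T k ω i j) 2 μ := fun i j => by
    simp_rw [crossMoment_apply]
    exact (memLp_finsetSum _ fun t _ => hp2 t i j).const_mul _
  have hsq : ∀ i j, ∫ ω, (crossMoment u v T k ω i j - meanCrossMoment μ u v T k i j) ^ 2 ∂μ ≤
      varianceConst (2 * A) C k / T := fun i j => by
    rw [← hmean, ← variance_eq_integral (hW2 i j).1.aemeasurable]
    exact hvar i j
  have hsqi : ∀ i j, Integrable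
      (fun ω => (crossMoment u v T k ω i j - meanCrossMoment μ u v T k i j) ^ 2) μ := fun i j =>
    ((hW2 i j).sub (memLp_const _)).integrable_sq
  have hn : ∀ ω, ‖crossMoment u v T k ω - meanCrossMoment μ u v T k‖ ^ 2 =
      ∑ i, ∑ j, (crossMoment u v T k ω i j - meanCrossMoment μ u v T k i j) ^ 2 := fun ω => by
    rw [frobenius_norm_sq]; rfl
  have hni : Integrable (fun ω => ‖crossMoment u v T k ω - meanCrossMoment μ u v T k‖ ^ 2) μ := by
    simp_rw [hn]
    exact integrable_finsetSum _ fun i _ => integrable_finsetSum _ fun j _ => hsqi i j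
  have hnle : ∫ ω, ‖crossMoment u v T k ω - meanCrossMoment μ u v T k‖ ^ 2 ∂μ ≤
      m * n * varianceConst (2 * A) C k / T := by
    simp_rw [hn]
    rw [integral_finsetSum _ fun i _ => integrable_finsetSum _ fun j _ => hsqi i j]
    simp_rw [integral_finsetSum _ fun j _ => hsqi _ j]
    calc _ ≤ ∑ _i : Fin m, ∑ _j : Fin n, varianceConst (2 * A) C k / T := by
          gcongr with i _ j _; exact hsq i j
      _ = _ := by simp; ring
  have hmk := mul_meas_ge_le_integral_of_nonneg (ae_of_all μ fun ω => sq_nonneg _) hni (x ^ 2)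
  rw [← ofReal_measureReal]
  refine ENNReal.ofReal_le_ofReal ?_
  have hmono : μ.real {ω | x < ‖crossMoment u v T k ω - meanCrossMoment μ u v T k‖} ≤
      μ.real {ω | x ^ 2 ≤ ‖crossMoment u v T k ω - meanCrossMoment μ u v T k‖ ^ 2} :=
    measureReal_mono fun ω hω => pow_le_pow_left₀ hx.le (le_of_lt hω) 2
  rw [← div_div, le_div_iff₀ (by positivity), mul_comm]
  exact (mul_le_mul_of_nonneg_left hmono (by positivity)).trans (hmk.trans hnle)

end Sums

/-! ### Perturbation of eigenvectors -/

section Eigenvalues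

variable {n : ℕ} {A : Matrix (Fin n) (Fin n) ℝ}

lemma inner_toLp_mulVec (x y : Fin n → ℝ) :
    inner ℝ (WithLp.toLp 2 x) (WithLp.toLp 2 y) = x ⬝ᵥ y := by
  simp [PiLp.inner_apply, dotProduct, mul_comm]

lemma dotProduct_mulVec_eq_sum_eigenvalues (hA : A.IsHermitian) (x : Fin n → ℝ) :
    x ⬝ᵥ (A *ᵥ x) = ∑ i, hA.eigenvalues i *
      inner ℝ (hA.eigenvectorBasis i) (WithLp.toLp 2 x) ^ 2 := by
  have hs : Aᵀ = A := by rw [← conjTranspose_eq_transpose_of_trivial]; exact hA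
  rw [← inner_toLp_mulVec, ← hA.eigenvectorBasis.sum_inner_mul_inner]
  refine Finset.sum_congr rfl fun i _ => ?_
  have h1 : inner ℝ (hA.eigenvectorBasis i) (WithLp.toLp 2 (A *ᵥ x)) =
      hA.eigenvalues i * inner ℝ (hA.eigenvectorBasis i) (WithLp.toLp 2 x) := by
    have e : hA.eigenvectorBasis i = WithLp.toLp 2 (WithLp.ofLp (hA.eigenvectorBasis i)) := rfl
    rw [e, inner_toLp_mulVec, inner_toLp_mulVec, dotProduct_mulVec, ← mulVec_transpose, hs,
      hA.mulVec_eigenvectorBasis, smul_dotProduct, smul_eq_mul]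
  rw [h1, real_inner_comm]
  ring

lemma dotProduct_self_eq_sum_inner_sq (hA : A.IsHermitian) (x : Fin n → ℝ) :
    x ⬝ᵥ x = ∑ i, inner ℝ (hA.eigenvectorBasis i) (WithLp.toLp 2 x) ^ 2 := by
  rw [← inner_toLp_mulVec, ← hA.eigenvectorBasis.sum_inner_mul_inner]
  refine Finset.sum_congr rfl fun i _ => ?_
  rw [real_inner_comm]; ring

lemma exists_pos_mul_le_of_posDef (hA : A.PosDef) :
    ∃ c : ℝ, 0 < c ∧ ∀ x : Fin n → ℝ, c * (x ⬝ᵥ x) ≤ x ⬝ᵥ (A *ᵥ x) := by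
  obtain ⟨c, hc, hcle⟩ : ∃ c : ℝ, 0 < c ∧ ∀ i, c ≤ hA.1.eigenvalues i := by
    rcases isEmpty_or_nonempty (Fin n) with h | h
    · exact ⟨1, one_pos, fun i => (h.false i).elim⟩
    · obtain ⟨i, hi⟩ := Finite.exists_min hA.1.eigenvalues
      exact ⟨_, hA.eigenvalues_pos i, hi⟩
  refine ⟨c, hc, fun x => ?_⟩
  rw [dotProduct_mulVec_eq_sum_eigenvalues hA.1, dotProduct_self_eq_sum_inner_sq hA.1,
    Finset.mul_sum]
  gcongr with i
  exact hcle i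

/-- One half of the min-max principle: if the quadratic form of `A` is at least `c` on the unit
sphere of a `K`-dimensional subspace, then the `K` largest eigenvalues are at least `c`. -/
lemma le_eigenvalues₀_of_forall_le (hA : A.IsHermitian) {K : ℕ} {U : Matrix (Fin n) (Fin K) ℝ}
    (hU : Uᵀ * U = 1) {c : ℝ} (h : ∀ x, c * (x ⬝ᵥ x) ≤ (U *ᵥ x) ⬝ᵥ (A *ᵥ (U *ᵥ x)))
    (j : Fin (Fintype.card (Fin n))) (hj : (j : ℕ) < K) : c ≤ hA.eigenvalues₀ j := by
  set e : Fin (Fintype.card (Fin n)) ≃ Fin n := Fintype.equivOfCardEq (Fintype.card_fin _) with he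
  -- a vector of the subspace that is orthogonal to the eigenvectors preceding the `j`-th one
  let φ : (Fin K → ℝ) →ₗ[ℝ] (Fin j → ℝ) := Matrix.toLin' (Matrix.of fun (i : Fin j) =>
    Uᵀ *ᵥ WithLp.ofLp (hA.eigenvectorBasis (e ⟨i, i.2.trans j.2⟩)))
  obtain ⟨x, hx, hx0⟩ : ∃ x, φ x = 0 ∧ x ≠ 0 := by
    have : LinearMap.ker φ ≠ ⊥ := LinearMap.ker_ne_bot_of_finrank_lt (by simpa using hj)
    obtain ⟨x, hx, hx0⟩ := (Submodule.ne_bot_iff _).mp this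
    exact ⟨x, hx, hx0⟩
  have horth : ∀ i, e.symm i < j →
      inner ℝ (hA.eigenvectorBasis i) (WithLp.toLp 2 (U *ᵥ x)) = 0 := by
    intro i hi
    have h1 := congrFun hx ⟨e.symm i, hi⟩
    simp only [φ, toLin'_apply, mulVec, of_apply, Fin.eta, Equiv.apply_symm_apply,
      Pi.zero_apply] at h1
    have e1 : hA.eigenvectorBasis i = WithLp.toLp 2 (WithLp.ofLp (hA.eigenvectorBasis i)) := rfl
    rw [e1, inner_toLp_mulVec, dotProduct_mulVec, ← mulVec_transpose]
    exact h1
  have hUx : (U *ᵥ x) ⬝ᵥ (U *ᵥ x) = x ⬝ᵥ x := by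
    rw [dotProduct_mulVec, ← mulVec_transpose, mulVec_mulVec, hU, one_mulVec]
  have hpos : 0 < x ⬝ᵥ x :=
    lt_of_le_of_ne (Finset.sum_nonneg fun i _ => mul_self_nonneg _)
      (Ne.symm (fun h0 => hx0 (dotProduct_self_eq_zero.mp h0)))
  have hup : (U *ᵥ x) ⬝ᵥ (A *ᵥ (U *ᵥ x)) ≤ hA.eigenvalues₀ j * (x ⬝ᵥ x) := by
    rw [← hUx, dotProduct_mulVec_eq_sum_eigenvalues hA, dotProduct_self_eq_sum_inner_sq hA,
      Finset.mul_sum]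
    refine Finset.sum_le_sum fun i _ => ?_
    rcases lt_or_ge (e.symm i) j with hi | hi
    · rw [horth i hi]; simp
    · exact mul_le_mul_of_nonneg_right (hA.eigenvalues₀_antitone hi) (sq_nonneg _)
  exact le_of_mul_le_mul_right ((h x).trans hup) hpos

end Eigenvalues

section Alignment

variable {K : ℕ}

/-- An orthogonal matrix that conjugates one decreasing diagonal matrix into another one with
distinct entries, and has nonnegative diagonal, is the identity. -/
lemma eq_one_of_orthogonal_of_sub_mul_eq_zero {Q : Matrix (Fin K) (Fin K) ℝ} {v d : Fin K → ℝ}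
    (hQ : Q * Qᵀ = 1) (hv : Antitone v) (hd : StrictAnti d) (h : ∀ i j, (v i - d j) * Q i j = 0)
    (hdiag : ∀ j, 0 ≤ Q j j) : Q = 1 := by
  have hrow : ∀ i, ∑ j, Q i j * Q i j = 1 := fun i => by
    have := congrFun (congrFun hQ i) i
    simpa [mul_apply] using this
  have hex : ∀ i, ∃ j, Q i j ≠ 0 := fun i => by
    by_contra! hc
    have := hrow i
    simp [hc] at this
  choose σ hσ using hex
  have hval : ∀ i j, Q i j ≠ 0 → v i = d j := fun i j hij =>
    sub_eq_zero.mp ((mul_eq_zero.mp (h i j)).resolve_right hij)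
  have hzero : ∀ i j, j ≠ σ i → Q i j = 0 := fun i j hj => by
    by_contra hc
    exact hj (hd.injective ((hval i j hc).symm.trans (hval i _ (hσ i))))
  have hinj : Function.Injective σ := fun i i' hii => by
    by_contra hne
    have h1 := congrFun (congrFun hQ i) i'
    rw [mul_apply, Finset.sum_eq_single (σ i), one_apply_ne hne, transpose_apply] at h1
    · exact (mul_ne_zero (hσ i) (hii ▸ hσ i')) h1
    · intro j _ hj; rw [hzero i j hj, zero_mul]
    · simp
  have hmono : Monotone σ := fun i i' hii => by
    have := hv hii
    rw [hval i _ (hσ i), hval i' _ (hσ i')] at this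
    exact hd.le_iff_ge.mp this
  have hsm : StrictMono σ := hmono.strictMono_of_injective hinj
  have hid : ∀ i, σ i = i := fun i => le_antisymm hsm.apply_le hsm.le_apply
  ext i j
  rcases eq_or_ne i j with rfl | hij
  · rw [one_apply_eq]
    have h1 := hrow i
    rw [Finset.sum_eq_single i (fun j _ hj => by rw [hzero i j (by rw [hid]; exact hj), zero_mul])
      (by simp)] at h1
    nlinarith [hdiag i]
  · rw [one_apply_ne hij, hzero i j (by rw [hid]; exact hij.symm)]

/-- The stability version of `eq_one_of_orthogonal_of_sub_mul_eq_zero`, by compactness. -/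
lemma exists_delta_abs_sub_one_le {d : Fin K → ℝ} (hd : StrictAnti d) {ε : ℝ} (hε : 0 < ε) :
    ∃ δ : ℝ, 0 < δ ∧ ∀ (Q : Matrix (Fin K) (Fin K) ℝ) (v : Fin K → ℝ), Antitone v →
      (∀ i j, |(Q * Qᵀ - 1) i j| ≤ δ) → (∀ i j, |(v i - d j) * Q i j| ≤ δ) →
      (∀ j, 0 ≤ Q j j) → ∀ i j, |(Q - 1) i j| ≤ ε := by
  by_contra! hcon
  have hpos : ∀ m : ℕ, (0 : ℝ) < 1 / (2 * (m + 1)) := fun m => by positivity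
  choose Q v hv hQ hQv hQd a b hab using fun m : ℕ => hcon _ (hpos m)
  have hδ : ∀ m : ℕ, (1 : ℝ) / (2 * (m + 1)) ≤ 1 / 2 := fun m => by
    apply one_div_le_one_div_of_le (by norm_num)
    have : (0 : ℝ) ≤ m := by positivity
    linarith
  have hδ0 : Tendsto (fun m : ℕ => (1 : ℝ) / (2 * (m + 1))) atTop (𝓝 0) := by
    have := (tendsto_one_div_add_atTop_nhds_zero_nat (𝕜 := ℝ)).const_mul (1 / 2)
    rw [mul_zero] at this
    refine this.congr fun m => ?_
    field_simp
  have hrow : ∀ m i, |∑ j, Q m i j ^ 2 - 1| ≤ 1 / 2 := fun m i => by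
    have := (hQ m i i).trans (hδ m)
    simpa [mul_apply, Matrix.sub_apply, sq] using this
  have hQb : ∀ m i j, |Q m i j| ≤ 2 := fun m i j => by
    have h1 := (abs_le.mp (hrow m i)).2
    have h2 : Q m i j ^ 2 ≤ ∑ j, Q m i j ^ 2 :=
      Finset.single_le_sum (f := fun j => Q m i j ^ 2) (fun j _ => sq_nonneg _)
        (Finset.mem_univ j)
    exact abs_le_of_sq_le_sq (by linarith) (by norm_num)
  obtain ⟨B, hB⟩ : ∃ B : ℝ, ∀ j, |d j| ≤ B := by
    obtain ⟨B, hB⟩ := (Set.finite_range fun j => |d j|).bddAbove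
    exact ⟨B, fun j => hB ⟨j, rfl⟩⟩
  have hvb : ∀ m i, |v m i| ≤ 2 * (K * ((1 / 2 + B * 2) * 2)) := fun m i => by
    have hB0 : 0 ≤ B := (abs_nonneg _).trans (hB i)
    have h1 := (abs_le.mp (hrow m i)).1
    have h2 : ∀ j, |v m i * Q m i j ^ 2| ≤ (1 / 2 + B * 2) * 2 := fun j => by
      have e : v m i * Q m i j ^ 2 = ((v m i - d j) * Q m i j + d j * Q m i j) * Q m i j := by ring
      rw [e, abs_mul]
      gcongr
      · refine (abs_add_le _ _).trans (add_le_add ((hQv m i j).trans (hδ m)) ?_)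
        rw [abs_mul]
        gcongr
        · exact hB j
        · exact hQb m i j
      · exact hQb m i j
    have h3 : |v m i| * ∑ j, Q m i j ^ 2 ≤ K * ((1 / 2 + B * 2) * 2) := by
      rw [Finset.mul_sum]
      calc ∑ j, |v m i| * Q m i j ^ 2 ≤ ∑ _j : Fin K, (1 / 2 + B * 2) * 2 := by
            refine Finset.sum_le_sum fun j _ => ?_
            have := h2 j
            rwa [abs_mul, abs_of_nonneg (sq_nonneg (Q m i j))] at this
        _ = _ := by simp
    nlinarith [abs_nonneg (v m i)]
  let w : ℕ → (Fin K → Fin K → ℝ) × (Fin K → ℝ) := fun m => (fun i j => Q m i j, v m)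
  have hbdd : Bornology.IsBounded (Set.range w) := by
    set R := max 2 (2 * (K * ((1 / 2 + B * 2) * 2)))
    have hR : 0 ≤ R := le_trans (by norm_num) (le_max_left _ _)
    refine isBounded_iff_forall_norm_le.mpr ⟨R, ?_⟩
    rintro _ ⟨m, rfl⟩
    refine norm_prod_le_iff.mpr ⟨?_, ?_⟩
    · exact (pi_norm_le_iff_of_nonneg hR).mpr fun i => (pi_norm_le_iff_of_nonneg hR).mpr fun j =>
        (hQb m i j).trans (le_max_left _ _)
    · exact (pi_norm_le_iff_of_nonneg hR).mpr fun i => (hvb m i).trans (le_max_right _ _)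
  obtain ⟨⟨Q₀, v₀⟩, -, φ, hφ, hlim⟩ := tendsto_subseq_of_bounded hbdd (fun m => ⟨m, rfl⟩)
  have hφt := hφ.tendsto_atTop
  have hQl : ∀ i j, Tendsto (fun m => Q (φ m) i j) atTop (𝓝 (Q₀ i j)) := fun i j =>
    tendsto_pi_nhds.mp (tendsto_pi_nhds.mp ((continuous_fst.tendsto _).comp hlim) i) j
  have hvl : ∀ i, Tendsto (fun m => v (φ m) i) atTop (𝓝 (v₀ i)) := fun i =>
    tendsto_pi_nhds.mp ((continuous_snd.tendsto _).comp hlim) i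
  have hsmall := hδ0.comp hφt
  have hQ₀ : (Matrix.of Q₀) = 1 := by
    refine eq_one_of_orthogonal_of_sub_mul_eq_zero (v := v₀) (d := d) ?_ ?_ hd ?_ ?_
    · rw [← sub_eq_zero]
      ext i j
      have h1 : Tendsto (fun m => (Q (φ m) * (Q (φ m))ᵀ - 1) i j) atTop
          (𝓝 ((Matrix.of Q₀ * (Matrix.of Q₀)ᵀ - 1) i j)) := by
        simp only [Matrix.sub_apply, mul_apply, transpose_apply, of_apply]
        exact (tendsto_finsetSum _ fun l _ => (hQl i l).mul (hQl j l)).sub_const _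
      have h2 := le_of_tendsto_of_tendsto h1.abs hsmall
        (Eventually.of_forall fun m => hQ (φ m) i j)
      exact abs_nonpos_iff.mp h2
    · exact fun i j hij => le_of_tendsto_of_tendsto (hvl j) (hvl i)
        (Eventually.of_forall fun m => hv (φ m) hij)
    · intro i j
      have h2 := le_of_tendsto_of_tendsto (((hvl i).sub_const (d j)).mul (hQl i j)).abs hsmall
        (Eventually.of_forall fun m => hQv (φ m) i j)
      exact abs_nonpos_iff.mp h2
    · exact fun j => ge_of_tendsto (hQl j j) (Eventually.of_forall fun m => hQd (φ m) j)
  -- along the subsequence all entries come close to those of the identity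
  have hall : ∀ᶠ m in atTop, ∀ i j, |(Q (φ m) - 1) i j| < ε := by
    rw [eventually_all]; intro i
    rw [eventually_all]; intro j
    have h1 : Tendsto (fun m => |(Q (φ m) - 1) i j|) atTop (𝓝 |(Matrix.of Q₀ - 1) i j|) :=
      ((hQl i j).sub_const _).abs
    rw [hQ₀, sub_self, Matrix.zero_apply, abs_zero] at h1
    exact h1.eventually_lt_const hε
  obtain ⟨m, hm⟩ := hall.exists
  exact (hab (φ m)).not_gt (hm _ _)

end Alignment

/-! ### The estimated loading space -/

section Loadings

open scoped Matrix.Norms.Frobenius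

variable {K N : ℕ}

lemma norm_eq_sqrt_of_transpose_mul_self {L : Matrix (Fin N) (Fin K) ℝ} (hL : Lᵀ * L = 1) :
    ‖L‖ = √K := by
  rw [← Real.sqrt_sq (norm_nonneg L), frobenius_norm_sq, Finset.sum_comm]
  congr 1
  have : ∀ j, ∑ i, L i j ^ 2 = 1 := fun j => by
    have := congrFun (congrFun hL j) j
    simpa [mul_apply, sq] using this
  simp [this]

lemma norm_mul_le_of_le {l m n : ℕ} {A : Matrix (Fin l) (Fin m) ℝ} {B : Matrix (Fin m) (Fin n) ℝ}
    {a b : ℝ} (hA : ‖A‖ ≤ a) (hB : ‖B‖ ≤ b) : ‖A * B‖ ≤ a * b :=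
  (frobenius_norm_mul A B).trans
    (mul_le_mul hA hB (norm_nonneg _) ((norm_nonneg _).trans hA))

/-- The matrices `F k`, `E k` (`k ∈ I`) are close to `A k Λ'` and to `0`, and `Λ` has orthonormal
columns. The matrices `Λ F k + E k` are then close to the matrices `Λ (A k) Λ'` of rank `K`. -/
structure IsFactorApprox (I : Finset ℕ) (A : ℕ → Matrix (Fin K) (Fin K) ℝ) (a z e : ℝ)
    (Λ : Matrix (Fin N) (Fin K) ℝ) (F : ℕ → Matrix (Fin K) (Fin N) ℝ)
    (E : ℕ → Matrix (Fin N) (Fin N) ℝ) : Prop where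
  orth : Λᵀ * Λ = 1
  norm_A : ∀ k ∈ I, ‖A k‖ ≤ a
  norm_F : ∀ k ∈ I, ‖F k - A k * Λᵀ‖ ≤ z
  norm_E : ∀ k ∈ I, ‖E k‖ ≤ e
  e_le : e ≤ z
  z_le : z ≤ 1

/-- The sum of the matrices `Y k (Y k)'` over `k ∈ I`. -/
def gramSum {m n : ℕ} (I : Finset ℕ) (Y : ℕ → Matrix (Fin m) (Fin n) ℝ) :
    Matrix (Fin m) (Fin m) ℝ :=
  ∑ k ∈ I, Y k * (Y k)ᵀ

lemma transpose_gramSum {m n : ℕ} (I : Finset ℕ) (Y : ℕ → Matrix (Fin m) (Fin n) ℝ) :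
    (gramSum I Y)ᵀ = gramSum I Y := by
  simp [gramSum, Matrix.transpose_sum, Matrix.transpose_mul]

/-- A bound for `‖Λ F k + E k‖`. -/
def obsBound (K : ℕ) (a : ℝ) : ℝ := √K * (a * √K + 1) + 1

/-- The Lipschitz constant for the approximation of `M̂` by its limit. -/
def gramConst (K : ℕ) (I : Finset ℕ) (a : ℝ) : ℝ :=
  I.card * ((√K + 1) * (obsBound K a + √K * a * √K))

namespace IsFactorApprox

variable {I : Finset ℕ} {A : ℕ → Matrix (Fin K) (Fin K) ℝ} {a z e : ℝ}
  {Λ : Matrix (Fin N) (Fin K) ℝ} {F : ℕ → Matrix (Fin K) (Fin N) ℝ}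
  {E : ℕ → Matrix (Fin N) (Fin N) ℝ} (h : IsFactorApprox I A a z e Λ F E)

include h

lemma norm_load : ‖Λ‖ = √K := norm_eq_sqrt_of_transpose_mul_self h.orth

lemma norm_load_transpose : ‖Λᵀ‖ = √K := by rw [frobenius_norm_transpose, h.norm_load]

lemma norm_F_le {k : ℕ} (hk : k ∈ I) : ‖F k‖ ≤ a * √K + 1 := by
  have e1 : F k = A k * Λᵀ + (F k - A k * Λᵀ) := by abel
  rw [e1]
  refine (norm_add_le _ _).trans (add_le_add ?_ ((h.norm_F k hk).trans h.z_le))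
  exact norm_mul_le_of_le (h.norm_A k hk) h.norm_load_transpose.le

lemma norm_obs_le {k : ℕ} (hk : k ∈ I) : ‖Λ * F k + E k‖ ≤ obsBound K a :=
  (norm_add_le _ _).trans (add_le_add (norm_mul_le_of_le h.norm_load.le (h.norm_F_le hk))
    ((h.norm_E k hk).trans (h.e_le.trans h.z_le)))

lemma norm_obs_sub_le {k : ℕ} (hk : k ∈ I) :
    ‖(Λ * F k + E k) - Λ * A k * Λᵀ‖ ≤ (√K + 1) * z := by
  have e1 : (Λ * F k + E k) - Λ * A k * Λᵀ = Λ * (F k - A k * Λᵀ) + E k := by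
    rw [Matrix.mul_sub, Matrix.mul_assoc]; abel
  rw [e1, add_mul, one_mul]
  exact (norm_add_le _ _).trans (add_le_add (norm_mul_le_of_le h.norm_load.le (h.norm_F k hk))
    ((h.norm_E k hk).trans h.e_le))

lemma norm_gramSum_sub_le :
    ‖gramSum I (fun k => Λ * F k + E k) - Λ * gramSum I A * Λᵀ‖ ≤ gramConst K I a * z := by
  have e1 : gramSum I (fun k => Λ * F k + E k) - Λ * gramSum I A * Λᵀ =
      ∑ k ∈ I, (((Λ * F k + E k) - Λ * A k * Λᵀ) * (Λ * F k + E k)ᵀ +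
        Λ * A k * Λᵀ * ((Λ * F k + E k) - Λ * A k * Λᵀ)ᵀ) := by
    rw [gramSum, gramSum, Matrix.mul_sum, Matrix.sum_mul, ← Finset.sum_sub_distrib]
    refine Finset.sum_congr rfl fun k _ => ?_
    generalize Λ * F k + E k = Y
    have e2 : Λ * A k * Λᵀ * (Λ * A k * Λᵀ)ᵀ = Λ * (A k * (A k)ᵀ) * Λᵀ := by
      calc Λ * A k * Λᵀ * (Λ * A k * Λᵀ)ᵀ = Λ * A k * (Λᵀ * Λ) * (A k)ᵀ * Λᵀ := by
            simp only [transpose_mul, transpose_transpose, Matrix.mul_assoc]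
        _ = _ := by rw [h.orth]; simp only [Matrix.mul_assoc, Matrix.one_mul]
    rw [transpose_sub, Matrix.mul_sub, Matrix.sub_mul, e2]
    abel
  rw [e1]
  refine (norm_sum_le_of_le I fun k hk => ?_ :
    _ ≤ ∑ _k ∈ I, (√K + 1) * (obsBound K a + √K * a * √K) * z).trans (le_of_eq ?_)
  · have h1 := norm_mul_le_of_le (h.norm_obs_sub_le hk)
      ((frobenius_norm_transpose (Λ * F k + E k)).le.trans (h.norm_obs_le hk))
    have h2 := norm_mul_le_of_le (norm_mul_le_of_le (norm_mul_le_of_le h.norm_load.le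
      (h.norm_A k hk)) h.norm_load_transpose.le)
      ((frobenius_norm_transpose _).le.trans (h.norm_obs_sub_le hk))
    refine (norm_add_le _ _).trans ((add_le_add h1 h2).trans (le_of_eq ?_))
    ring
  · rw [Finset.sum_const, nsmul_eq_mul, gramConst]; ring

/-- The quadratic form of `M̂` on the column space of `Λ` is close to the one of the limit. -/
lemma mul_dotProduct_le {c : ℝ} (hc : ∀ x, c * (x ⬝ᵥ x) ≤ x ⬝ᵥ (gramSum I A *ᵥ x))
    (x : Fin K → ℝ) :
    (c - √K * (gramConst K I a * z) * √K) * (x ⬝ᵥ x) ≤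
      (Λ *ᵥ x) ⬝ᵥ (gramSum I (fun k => Λ * F k + E k) *ᵥ (Λ *ᵥ x)) := by
  set M := gramSum I (fun k => Λ * F k + E k)
  set D := Λᵀ * (M - Λ * gramSum I A * Λᵀ) * Λ with hD
  have hDn : ‖D‖ ≤ √K * (gramConst K I a * z) * √K :=
    norm_mul_le_of_le (norm_mul_le_of_le h.norm_load_transpose.le h.norm_gramSum_sub_le)
      h.norm_load.le
  have e1 : Λᵀ * M * Λ = D + gramSum I A := by
    have : Λᵀ * (Λ * gramSum I A * Λᵀ) * Λ = (Λᵀ * Λ) * gramSum I A * (Λᵀ * Λ) := by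
      simp only [Matrix.mul_assoc]
    rw [hD, Matrix.mul_sub, Matrix.sub_mul, this, h.orth, Matrix.one_mul, Matrix.mul_one]
    abel
  have e2 : (Λ *ᵥ x) ⬝ᵥ (M *ᵥ (Λ *ᵥ x)) = x ⬝ᵥ (D *ᵥ x) + x ⬝ᵥ (gramSum I A *ᵥ x) := by
    rw [← dotProduct_add, ← add_mulVec, ← e1, mulVec_mulVec, dotProduct_comm, dotProduct_mulVec,
      ← mulVec_transpose, dotProduct_comm, mulVec_mulVec, ← Matrix.mul_assoc]
  have h3 : |x ⬝ᵥ (D *ᵥ x)| ≤ ‖D‖ * (x ⬝ᵥ x) := by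
    have hc' : ‖replicateCol Unit (D *ᵥ x)‖ ≤ ‖D‖ * ‖replicateCol Unit x‖ := by
      rw [replicateCol_mulVec]; exact frobenius_norm_mul _ _
    rw [frobenius_norm_replicateCol, frobenius_norm_replicateCol] at hc'
    have hi := abs_real_inner_le_norm (WithLp.toLp 2 x) (WithLp.toLp 2 (D *ᵥ x))
    rw [inner_toLp_mulVec] at hi
    have hxx : ‖WithLp.toLp 2 x‖ * ‖WithLp.toLp 2 x‖ = x ⬝ᵥ x := by
      rw [← real_inner_self_eq_norm_mul_norm, inner_toLp_mulVec]
    calc |x ⬝ᵥ (D *ᵥ x)| ≤ _ := hi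
      _ ≤ ‖WithLp.toLp 2 x‖ * (‖D‖ * ‖WithLp.toLp 2 x‖) := by gcongr
      _ = ‖D‖ * (‖WithLp.toLp 2 x‖ * ‖WithLp.toLp 2 x‖) := by ring
      _ = _ := by rw [hxx]
  have hx0 : 0 ≤ x ⬝ᵥ x := Finset.sum_nonneg fun i _ => mul_self_nonneg _
  rw [e2, sub_mul]
  have := (abs_le.mp h3).1
  have := mul_le_mul_of_nonneg_right hDn hx0
  linarith [hc x]

variable {L : Matrix (Fin N) (Fin K) ℝ} {v : Fin K → ℝ} (hL : Lᵀ * L = 1)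
  (heig : gramSum I (fun k => Λ * F k + E k) * L = L * diagonal v)

include hL heig

omit h hL in
lemma transpose_mul_gramSum :
    Lᵀ * gramSum I (fun k => Λ * F k + E k) = diagonal v * Lᵀ := by
  have := congrArg transpose heig
  rwa [transpose_mul, transpose_mul, transpose_gramSum, diagonal_transpose] at this

/-- The rotation `L'Λ` approximately intertwines the estimated eigenvalues with the limit of
`M̂`. -/
lemma norm_diagonal_mul_sub_le :
    ‖diagonal v * (Lᵀ * Λ) - Lᵀ * Λ * gramSum I A‖ ≤ √K * (gramConst K I a * z) * √K := by
  have e1 : diagonal v * (Lᵀ * Λ) - Lᵀ * Λ * gramSum I A =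
      Lᵀ * (gramSum I (fun k => Λ * F k + E k) - Λ * gramSum I A * Λᵀ) * Λ := by
    have : Lᵀ * (Λ * gramSum I A * Λᵀ) * Λ = Lᵀ * Λ * gramSum I A * (Λᵀ * Λ) := by
      simp only [Matrix.mul_assoc]
    rw [Matrix.mul_sub, Matrix.sub_mul, this, h.orth, Matrix.mul_one,
      transpose_mul_gramSum heig]
    simp only [Matrix.mul_assoc]
  rw [e1]
  refine norm_mul_le_of_le (norm_mul_le_of_le ?_ h.norm_gramSum_sub_le) h.norm_load.le
  rw [frobenius_norm_transpose, norm_eq_sqrt_of_transpose_mul_self hL]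

variable {c : ℝ} (hc : 0 < c) (hv : ∀ j, c ≤ v j)

include hc hv

omit h hL heig in
lemma norm_inv_diagonal_le : ‖(diagonal v)⁻¹‖ ≤ √K / c := by
  have hne : ∀ j, v j ≠ 0 := fun j => (hc.trans_le (hv j)).ne'
  have e1 : (diagonal v)⁻¹ = diagonal fun j => (v j)⁻¹ := by
    refine inv_eq_left_inv ?_
    rw [diagonal_mul_diagonal]
    simp [hne]
  rw [e1, frobenius_norm_diagonal, EuclideanSpace.norm_eq]
  calc √(∑ j, ‖(v j)⁻¹‖ ^ 2) ≤ √(∑ _j : Fin K, (c⁻¹) ^ 2) := by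
        gcongr with j
        rw [norm_inv, Real.norm_of_nonneg (hc.le.trans (hv j))]
        gcongr
        exact hv j
    _ = √K / c := by
        rw [Finset.sum_const, Finset.card_univ, Fintype.card_fin, nsmul_eq_mul,
          Real.sqrt_mul (Nat.cast_nonneg _), Real.sqrt_sq (by positivity), div_eq_mul_inv]

omit h hL heig in
lemma diagonal_mul_inv : diagonal v * (diagonal v)⁻¹ = 1 := by
  refine mul_nonsing_inv _ ?_
  rw [det_diagonal, isUnit_iff_ne_zero]
  exact Finset.prod_ne_zero_iff.mpr fun j _ => (hc.trans_le (hv j)).ne'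

/-- The component of the estimated loadings orthogonal to the true loading space only comes from
the error matrices `E k`. -/
lemma norm_sub_projection_le :
    ‖L - Λ * (Λᵀ * L)‖ ≤ I.card * ((1 + K) * obsBound K a * √K * (√K / c)) * e := by
  have e1 : L = gramSum I (fun k => Λ * F k + E k) * L * (diagonal v)⁻¹ := by
    rw [heig, Matrix.mul_assoc, diagonal_mul_inv hc hv, Matrix.mul_one]
  have e2 : L - Λ * (Λᵀ * L) =
      ∑ k ∈ I, (E k - Λ * (Λᵀ * E k)) * (Λ * F k + E k)ᵀ * L * (diagonal v)⁻¹ := by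
    have e3 : L - Λ * (Λᵀ * L) = (1 - Λ * Λᵀ) * L := by
      rw [Matrix.sub_mul, Matrix.one_mul, Matrix.mul_assoc]
    rw [e3]
    nth_rw 1 [e1]
    rw [gramSum, Matrix.sum_mul, Matrix.sum_mul, Matrix.mul_sum]
    refine Finset.sum_congr rfl fun k _ => ?_
    have e4 : (1 - Λ * Λᵀ) * (Λ * F k + E k) = E k - Λ * (Λᵀ * E k) := by
      have : Λ * Λᵀ * (Λ * F k) = Λ * F k := by
        rw [Matrix.mul_assoc, ← Matrix.mul_assoc Λᵀ, h.orth, Matrix.one_mul]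
      rw [Matrix.sub_mul, Matrix.one_mul, Matrix.mul_add, this, Matrix.mul_assoc]
      abel
    rw [← e4]
    simp only [Matrix.mul_assoc]
  rw [e2]
  refine (norm_sum_le_of_le I fun k hk => ?_ :
    _ ≤ ∑ _k ∈ I, ((1 + K) * e * obsBound K a * √K * (√K / c))).trans (le_of_eq ?_)
  · refine norm_mul_le_of_le (norm_mul_le_of_le (norm_mul_le_of_le ?_ ?_)
      (norm_eq_sqrt_of_transpose_mul_self hL).le) (norm_inv_diagonal_le hc hv)
    · refine (norm_sub_le _ _).trans ?_
      have := norm_mul_le_of_le h.norm_load.le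
        (norm_mul_le_of_le h.norm_load_transpose.le (h.norm_E k hk))
      rw [← mul_assoc, Real.mul_self_sqrt (Nat.cast_nonneg _)] at this
      linarith [h.norm_E k hk]
    · rw [frobenius_norm_transpose]; exact h.norm_obs_le hk
  · rw [Finset.sum_const, nsmul_eq_mul]; ring

lemma norm_mul_transpose_sub_one_le :
    ‖(Lᵀ * Λ) * (Lᵀ * Λ)ᵀ - 1‖ ≤
      √K * (I.card * ((1 + K) * obsBound K a * √K * (√K / c)) * e) := by
  have e1 : (Lᵀ * Λ) * (Lᵀ * Λ)ᵀ - 1 = -(Lᵀ * (L - Λ * (Λᵀ * L))) := by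
    rw [Matrix.mul_sub, hL, transpose_mul, transpose_transpose, Matrix.mul_assoc]
    abel
  rw [e1, norm_neg]
  refine norm_mul_le_of_le ?_ (h.norm_sub_projection_le hL heig hc hv)
  rw [frobenius_norm_transpose, norm_eq_sqrt_of_transpose_mul_self hL]

/-- The two rotation matrices of the factor estimates are close to each other. -/
lemma norm_rotation_sub_le :
    ‖(gramSum I F * Λᵀ * L * (diagonal v)⁻¹)ᵀ - Lᵀ * Λ‖ ≤
      (I.card * (a * √K + (a * √K + 1)) * K + √K * gramConst K I a * √K) * (√K / c) * z := by
  have hg : ‖gramSum I F - gramSum I A‖ ≤ I.card * (a * √K + (a * √K + 1)) * z := by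
    have e1 : gramSum I F - gramSum I A =
        ∑ k ∈ I, (A k * Λᵀ * (F k - A k * Λᵀ)ᵀ + (F k - A k * Λᵀ) * (F k)ᵀ) := by
      rw [gramSum, gramSum, ← Finset.sum_sub_distrib]
      refine Finset.sum_congr rfl fun k _ => ?_
      have e2 : A k * Λᵀ * (A k * Λᵀ)ᵀ = A k * (A k)ᵀ := by
        rw [transpose_mul, transpose_transpose, Matrix.mul_assoc, ← Matrix.mul_assoc Λᵀ, h.orth,
          Matrix.one_mul]
      rw [transpose_sub, Matrix.mul_sub, Matrix.sub_mul, e2]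
      abel
    rw [e1]
    refine (norm_sum_le_of_le I fun k hk => ?_ :
      _ ≤ ∑ _k ∈ I, (a * √K + (a * √K + 1)) * z).trans (le_of_eq ?_)
    · have h1 := norm_mul_le_of_le
        (norm_mul_le_of_le (h.norm_A k hk) h.norm_load_transpose.le)
        ((frobenius_norm_transpose _).le.trans (h.norm_F k hk))
      have h2 := norm_mul_le_of_le (h.norm_F k hk)
        ((frobenius_norm_transpose (F k)).le.trans (h.norm_F_le hk))
      refine (norm_add_le _ _).trans ((add_le_add h1 h2).trans (le_of_eq (by ring)))
    · rw [Finset.sum_const, nsmul_eq_mul]; ring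
  have hd := h.norm_diagonal_mul_sub_le hL heig
  have hi := norm_inv_diagonal_le hc hv
  have hLn := norm_eq_sqrt_of_transpose_mul_self hL
  have e3 : (gramSum I F * Λᵀ * L * (diagonal v)⁻¹)ᵀ - Lᵀ * Λ =
      ((gramSum I F - gramSum I A) * (Λᵀ * L) * (diagonal v)⁻¹ -
        (diagonal v * (Lᵀ * Λ) - Lᵀ * Λ * gramSum I A)ᵀ * (diagonal v)⁻¹)ᵀ := by
    have e4 : (diagonal v * (Lᵀ * Λ) - Lᵀ * Λ * gramSum I A)ᵀ =
        Λᵀ * L * diagonal v - gramSum I A * (Λᵀ * L) := by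
      simp only [transpose_sub, transpose_mul, transpose_transpose, transpose_gramSum,
        diagonal_transpose]
    have e5 : Λᵀ * L * diagonal v * (diagonal v)⁻¹ = Λᵀ * L := by
      rw [Matrix.mul_assoc, diagonal_mul_inv hc hv, Matrix.mul_one]
    have e6 : Lᵀ * Λ = (Λᵀ * L)ᵀ := by rw [transpose_mul, transpose_transpose]
    rw [e4, e6, ← transpose_sub, Matrix.sub_mul, Matrix.sub_mul, Matrix.sub_mul, e5]
    congr 1
    simp only [Matrix.mul_assoc]
    abel
  rw [e3, frobenius_norm_transpose]
  refine (norm_sub_le _ _).trans ?_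
  have t1 := norm_mul_le_of_le (norm_mul_le_of_le hg
    (norm_mul_le_of_le h.norm_load_transpose.le hLn.le)) hi
  have t2 := norm_mul_le_of_le ((frobenius_norm_transpose _).le.trans hd) hi
  rw [Real.mul_self_sqrt (Nat.cast_nonneg _)] at t1
  refine (add_le_add t1 t2).trans (le_of_eq ?_)
  ring

end IsFactorApprox

lemma isUnit_of_norm_mul_transpose_sub_one_lt {Q : Matrix (Fin K) (Fin K) ℝ}
    (h : ‖Q * Qᵀ - 1‖ < 1) : IsUnit Q := by
  have : CompleteSpace (Matrix (Fin K) (Fin K) ℝ) := FiniteDimensional.complete ℝ _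
  have h1 : IsUnit (Q * Qᵀ) := by
    have := isUnit_one_sub_of_norm_lt_one (x := 1 - Q * Qᵀ) (by rwa [norm_sub_rev])
    rwa [sub_sub_cancel] at this
  rw [isUnit_iff_isUnit_det, det_mul] at h1
  rw [isUnit_iff_isUnit_det]
  exact isUnit_of_mul_isUnit_left h1

end Loadings

/-! ### Consequences of the assumptions in a fixed cross-sectional dimension -/

section FixedDimension

open scoped Matrix.Norms.Frobenius

/-- The Schur test: bounds on the row and column sums of `|Q|` bound the operator norm of `Q`. -/
lemma dotProduct_mulVec_self_le {N : ℕ} {Q : Matrix (Fin N) (Fin N) ℝ} {C : ℝ}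
    (hrow : ∀ i, ∑ j, |Q i j| ≤ C) (hcol : ∀ j, ∑ i, |Q i j| ≤ C) (x : Fin N → ℝ) :
    (Q *ᵥ x) ⬝ᵥ (Q *ᵥ x) ≤ C ^ 2 * (x ⬝ᵥ x) := by
  have h1 : ∀ i, (Q *ᵥ x) i * (Q *ᵥ x) i ≤ C * ∑ j, |Q i j| * x j ^ 2 := fun i => by
    have h2 : ((Q *ᵥ x) i) ^ 2 ≤ (∑ j, |Q i j|) * ∑ j, |Q i j| * x j ^ 2 :=
      Finset.sum_sq_le_sum_mul_sum_of_sq_le_mul (r := fun j => Q i j * x j) Finset.univ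
        (fun j _ => abs_nonneg _) (fun j _ => by positivity)
        (fun j _ => le_of_eq (by rw [mul_pow, ← sq_abs (Q i j)]; ring))
    rw [← sq]
    refine h2.trans ?_
    gcongr
    exact hrow i
  calc (Q *ᵥ x) ⬝ᵥ (Q *ᵥ x) ≤ ∑ i, C * ∑ j, |Q i j| * x j ^ 2 := Finset.sum_le_sum fun i _ => h1 i
    _ = C * ∑ j, (∑ i, |Q i j|) * x j ^ 2 := by
        rw [← Finset.mul_sum, Finset.sum_comm]; simp_rw [Finset.sum_mul]
    _ ≤ C * ∑ j, C * x j ^ 2 := by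
        rcases isEmpty_or_nonempty (Fin N) with h | ⟨⟨i⟩⟩
        · simp
        · have hC : 0 ≤ C := (Finset.sum_nonneg fun _ _ => abs_nonneg _).trans (hrow i)
          gcongr with j
          exact hcol j
    _ = C ^ 2 * (x ⬝ᵥ x) := by
        rw [← Finset.mul_sum]; simp only [dotProduct, sq]; ring

variable {Ω : Type*} [MeasurableSpace Ω] {μ : Measure Ω} {K N : ℕ}
  {f : ℤ → Ω → Fin K → ℝ} {P : Panel Ω K N}

lemma IsModel.y_eq (hm : IsModel f P) (hS : IsUnit P.S) (t : ℤ) (ω : Ω) :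
    P.y t ω = P.Lam *ᵥ f t ω + P.xi t ω := by
  have h1 : P.S *ᵥ P.y t ω = P.B *ᵥ f t ω + P.eps t ω := by
    rw [Panel.S, sub_mulVec, one_mulVec]
    nth_rw 1 [hm.eqn t ω]
    abel
  have hdet : IsUnit P.S.det := (isUnit_iff_isUnit_det _).mp hS
  calc P.y t ω = P.S⁻¹ *ᵥ (P.S *ᵥ P.y t ω) := by
        rw [mulVec_mulVec, nonsing_inv_mul _ hdet, one_mulVec]
    _ = _ := by rw [h1, mulVec_add, mulVec_mulVec]; rfl

lemma measurable_xi (hm : IsModel f P) (t : ℤ) : Measurable (P.xi t) := by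
  refine measurable_pi_lambda _ fun i => ?_
  simp only [Panel.xi, mulVec, dotProduct]
  exact Finset.measurable_sum _ fun j _ =>
    ((measurable_pi_apply j).comp (hm.measurable_eps t)).const_mul _

lemma measurable_score (hm : IsModel f P) (t : ℤ) : Measurable (P.score t) := by
  refine measurable_pi_lambda _ fun i => ?_
  simp only [Panel.score, Pi.smul_apply, Finset.sum_apply, smul_eq_mul]
  exact (Finset.measurable_sum _ fun j _ =>
    ((measurable_pi_apply j).comp (hm.measurable_eps t)).mul_const _).const_mul _

lemma IsModel.xi_comap_measurable (hm : IsModel f P) (hS : IsUnit P.S) (t : ℤ) (i : Fin N) :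
    Measurable[MeasurableSpace.comap (fun ω => (P.y t ω, f t ω)) inferInstance]
      fun ω => P.xi t ω i := by
  have h1 : (fun ω => P.xi t ω i) =
      (fun q : (Fin N → ℝ) × (Fin K → ℝ) => q.1 i - ∑ j, P.Lam i j * q.2 j) ∘
        fun ω => (P.y t ω, f t ω) := by
    funext ω
    simp only [Function.comp_apply]
    rw [hm.y_eq hS]
    simp [mulVec, dotProduct]
  rw [h1]
  have h2 : Measurable (fun q : (Fin N → ℝ) × (Fin K → ℝ) => q.1 i - ∑ j, P.Lam i j * q.2 j) := by
    fun_prop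
  exact h2.comp (comap_measurable _)

omit [MeasurableSpace Ω] in
lemma f_comap_measurable (t : ℤ) (j : Fin K) :
    Measurable[MeasurableSpace.comap (fun ω => (P.y t ω, f t ω)) inferInstance]
      fun ω => f t ω j := by
  have h2 : Measurable (fun q : (Fin N → ℝ) × (Fin K → ℝ) => q.2 j) := by fun_prop
  exact h2.comp (comap_measurable _)

/-- The loadings divided by `√N`; they have orthonormal columns. -/
def normLam (P : Panel Ω K N) : Matrix (Fin N) (Fin K) ℝ := (√(N : ℝ))⁻¹ • P.Lam

lemma inv_sqrt_mul_inv_sqrt (N : ℕ) : (√(N : ℝ))⁻¹ * (√(N : ℝ))⁻¹ = (N : ℝ)⁻¹ := by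
  rw [← mul_inv, Real.mul_self_sqrt (Nat.cast_nonneg _)]

lemma BasicAssumptions.normLam_orth {γ C : ℝ} (h : BasicAssumptions μ γ C f P) :
    (normLam P)ᵀ * normLam P = 1 := by
  rw [normLam, transpose_smul, smul_mul, Matrix.mul_smul, smul_smul, inv_sqrt_mul_inv_sqrt,
    ← h.loading, Panel.Lam, transpose_mul]
  simp only [Matrix.mul_assoc]

omit [MeasurableSpace Ω] in
lemma score_eq (t : ℤ) (ω : Ω) : P.score t ω = (normLam P)ᵀ *ᵥ P.xi t ω := by
  rw [normLam, transpose_smul, smul_mulVec, Panel.score, Panel.xi, mulVec_mulVec]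
  congr 1
  funext j
  simp only [Finset.sum_apply, Pi.smul_apply, Panel.p, smul_eq_mul]
  simp only [mulVec, dotProduct]
  exact Finset.sum_congr rfl fun i _ => mul_comm _ _

/-- Uniform exponential moments of the factors and of all normalized linear combinations of
`ξ_t`. -/
structure HasExpMoments (μ : Measure Ω) (c A : ℝ) (f : ℤ → Ω → Fin K → ℝ) (P : Panel Ω K N) :
    Prop where
  factor : ∀ t j, ExpMomentLE μ c A fun ω => f t ω j
  comb : ∀ t (u : Fin N → ℝ), u ⬝ᵥ u ≤ 1 → ExpMomentLE μ c A fun ω => u ⬝ᵥ P.xi t ω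

lemma HasExpMoments.xi {c A : ℝ} (h : HasExpMoments μ c A f P) (t : ℤ) (i : Fin N) :
    ExpMomentLE μ c A fun ω => P.xi t ω i := by
  have := h.comb t (Pi.single i 1) (by simp)
  simpa using this

lemma HasExpMoments.score {γ C c A : ℝ} (h : HasExpMoments μ c A f P)
    (hb : BasicAssumptions μ γ C f P) (t : ℤ) (j : Fin K) :
    ExpMomentLE μ c A fun ω => P.score t ω j := by
  simp_rw [score_eq]
  refine h.comb t (fun i => (normLam P)ᵀ j i) (le_of_eq ?_)
  have := congrFun (congrFun hb.normLam_orth j) j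
  simpa [mul_apply, dotProduct] using this

/-- The bounds on the moments are uniform in the dimension. -/
lemma exists_hasExpMoments (K : ℕ) (μ : Measure Ω) [IsProbabilityMeasure μ] (γ C c₁ : ℝ) {c₂ : ℝ}
    (hc₂ : 0 < c₂) :
    ∃ c A : ℝ, 0 < c ∧ 1 ≤ A ∧ ∀ (N : ℕ) (f : ℤ → Ω → Fin K → ℝ) (P : Panel Ω K N),
      IsModel f P → BasicAssumptions μ γ C f P → SubExponential μ c₁ c₂ f →
      SubExponential μ c₁ c₂ P.eps → HasExpMoments μ c A f P := by
  obtain ⟨A, hA1, hA⟩ := SubExponential.exists_expMomentLE (μ := μ) c₁ hc₂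
  have hD : 0 < |C| + 1 := by positivity
  refine ⟨c₂ / 2 / (|C| + 1), A, by positivity, hA1, fun N f P hm hb hf he => ⟨fun t j => ?_,
    fun t u hu => ?_⟩⟩
  · have := hA K f hm.measurable_f hf (|C| + 1) hD (Pi.single j 1)
      (by simp only [dotProduct_single, Pi.single_eq_same, mul_one]
          nlinarith [abs_nonneg C]) t
    simpa using this
  · have h1 := dotProduct_mulVec_self_le (Q := (P.S⁻¹)ᵀ) (C := C) hb.Sinv_col hb.Sinv_row u
    have := hA N P.eps hm.measurable_eps he (|C| + 1) hD ((P.S⁻¹)ᵀ *ᵥ u) ?_ t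
    · refine this.of_mul_abs_le ?_ fun ω => ?_
      · simp only [dotProduct]
        exact Finset.measurable_sum _ fun i _ =>
          ((measurable_pi_apply i).comp (measurable_xi hm t)).const_mul _
      · rw [Panel.xi, dotProduct_mulVec, ← mulVec_transpose]
    · refine h1.trans ?_
      rw [← sq_abs C]
      nlinarith [abs_nonneg C, sq_nonneg |C|]

variable [IsProbabilityMeasure μ]

/-- The vector of the means of `f_{j,s} ξ_{i,t}`, `i = 1, …, N`, has a Euclidean norm bounded
uniformly in `N`, because all normalized linear combinations of `ξ_t` have bounded moments. -/
lemma sum_sq_mean_le {c A p : ℝ} (h : HasExpMoments μ c A f P) (hm : IsModel f P)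
    (hc : 0 < c) (hp : 2 ≤ p) (s t : ℤ) (j : Fin K) :
    ∑ i, (∫ ω, f s ω j * P.xi t ω i ∂μ) ^ 2 ≤ (1 + (p / c) ^ p * A) ^ 2 := by
  set B := 1 + (p / c) ^ p * A with hB
  have hfm : Measurable fun ω => f s ω j := (measurable_pi_apply j).comp (hm.measurable_f s)
  have hxm : ∀ i, Measurable fun ω => P.xi t ω i := fun i =>
    (measurable_pi_apply i).comp (measurable_xi hm t)
  have hf := (h.factor s j).momentLE hfm hc (p := p) (by linarith)
  have hf2 := hf.memLp_two hfm hp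
  have hfB := hf.integral_sq_le hfm hp
  have hx2 : ∀ i, MemLp (fun ω => P.xi t ω i) 2 μ := fun i =>
    ((h.xi t i).momentLE (hxm i) hc (p := p) (by linarith)).memLp_two (hxm i) hp
  set r : Fin N → ℝ := fun i => ∫ ω, f s ω j * P.xi t ω i ∂μ with hr
  change ∑ i, r i ^ 2 ≤ B ^ 2
  set q := √(∑ i, r i ^ 2) with hq
  have hq2 : q ^ 2 = ∑ i, r i ^ 2 := Real.sq_sqrt (Finset.sum_nonneg fun _ _ => sq_nonneg _)
  rcases (Real.sqrt_nonneg (∑ i, r i ^ 2)).eq_or_lt with h0 | h0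
  · rw [← hq2, hq, ← h0]; nlinarith [sq_nonneg B]
  -- test the vector of means against itself, normalized
  set u : Fin N → ℝ := q⁻¹ • r with hu
  have huu : u ⬝ᵥ u ≤ 1 := by
    have hrr : r ⬝ᵥ r = q ^ 2 := by
      rw [hq2]; exact Finset.sum_congr rfl fun i _ => (sq _).symm
    rw [hu, smul_dotProduct, dotProduct_smul, hrr, smul_eq_mul, smul_eq_mul]
    refine le_of_eq ?_
    have : q ≠ 0 := h0.ne'
    field_simp
  have hum : Measurable fun ω => u ⬝ᵥ P.xi t ω := by
    simp only [dotProduct]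
    exact Finset.measurable_sum _ fun i _ => (hxm i).const_mul _
  have hum' := (h.comb t u huu).momentLE hum hc (p := p) (by linarith)
  have hu2 := hum'.memLp_two hum hp
  have huB := hum'.integral_sq_le hum hp
  have e1 : q = ∫ ω, f s ω j * (u ⬝ᵥ P.xi t ω) ∂μ := by
    have e2 : ∀ ω, f s ω j * (u ⬝ᵥ P.xi t ω) = ∑ i, u i * (f s ω j * P.xi t ω i) := fun ω => by
      simp only [dotProduct, Finset.mul_sum]
      exact Finset.sum_congr rfl fun i _ => by ring
    simp_rw [e2]
    rw [integral_finsetSum _ fun i _ =>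
      Integrable.const_mul (f := fun ω => f s ω j * P.xi t ω i) (hf2.integrable_mul (hx2 i)) _]
    simp_rw [integral_const_mul]
    have e3 : ∀ i, u i * r i = q⁻¹ * r i ^ 2 := fun i => by
      rw [hu, Pi.smul_apply, smul_eq_mul]; ring
    rw [Finset.sum_congr rfl fun i _ => e3 i, ← Finset.mul_sum, ← hq2]
    have : q ≠ 0 := h0.ne'
    field_simp
  have e4 : q ≤ B := by
    have h5 : ∫ ω, f s ω j * (u ⬝ᵥ P.xi t ω) ∂μ ≤
        ∫ ω, (1 / 2 * f s ω j ^ 2 + 1 / 2 * (u ⬝ᵥ P.xi t ω) ^ 2) ∂μ :=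
      integral_mono (hf2.integrable_mul hu2)
        ((hf2.integrable_sq.const_mul _).add (hu2.integrable_sq.const_mul _))
        fun ω => by nlinarith [sq_nonneg (f s ω j - u ⬝ᵥ P.xi t ω)]
    rw [integral_add (hf2.integrable_sq.const_mul _) (hu2.integrable_sq.const_mul _),
      integral_const_mul, integral_const_mul] at h5
    rw [e1]; linarith
  rw [← hq2]
  gcongr

/-- This bound does not depend on `N`, so that the mean of the cross moment of `f_t` and `ξ_{t-k}`
becomes negligible after division by `√N`. -/
lemma norm_meanCrossMoment_factor_xi_le {c A p : ℝ} (h : HasExpMoments μ c A f P)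
    (hm : IsModel f P) (hc : 0 < c) (hA : 0 ≤ A) (hp : 2 ≤ p) (T k : ℕ) :
    ‖meanCrossMoment μ f P.xi T k‖ ≤ √K * (1 + (p / c) ^ p * A) := by
  have hB0 : 0 ≤ 1 + (p / c) ^ p * A := by positivity
  have e1 : meanCrossMoment μ f P.xi T k = (T : ℝ)⁻¹ • ∑ t ∈ Finset.Icc ((k : ℤ) + 1) (T : ℤ),
      Matrix.of fun j i => ∫ ω, f t ω j * P.xi (t - k) ω i ∂μ := by
    ext j i
    simp [meanCrossMoment, Matrix.sum_apply]
  have h2 : ∀ t : ℤ, ‖Matrix.of fun (j : Fin K) (i : Fin N) =>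
      ∫ ω, f t ω j * P.xi (t - k) ω i ∂μ‖ ≤ √K * (1 + (p / c) ^ p * A) := fun t => by
    refine abs_le_of_sq_le_sq' ?_ (by positivity) |>.2
    rw [frobenius_norm_sq, mul_pow, Real.sq_sqrt (Nat.cast_nonneg _)]
    calc _ ≤ ∑ _j : Fin K, (1 + (p / c) ^ p * A) ^ 2 :=
          Finset.sum_le_sum fun j _ => sum_sq_mean_le h hm hc hp t (t - k) j
      _ = _ := by simp
  rw [e1, norm_smul, Real.norm_of_nonneg (by positivity)]
  rcases Nat.eq_zero_or_pos T with rfl | hT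
  · rw [Nat.cast_zero, _root_.inv_zero, zero_mul]; positivity
  have hT' : (0 : ℝ) < T := by exact_mod_cast hT
  rw [inv_mul_le_iff₀ hT']
  refine (norm_sum_le_of_le _ fun t _ => h2 t).trans ?_
  rw [Finset.sum_const, Int.card_Icc, nsmul_eq_mul]
  gcongr
  omega

lemma integral_mul_eq_zero_of_covariance {X Y : Ω → ℝ} (hX : MemLp X 2 μ) (hY : MemLp Y 2 μ)
    (hX0 : ∫ ω, X ω ∂μ = 0) (h : cov[X, Y; μ] = 0) : ∫ ω, X ω * Y ω ∂μ = 0 := by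
  rw [covariance_eq_sub hX hY, hX0, zero_mul, sub_zero] at h
  exact h

lemma BasicAssumptions.eps_memLp {γ C : ℝ} (hb : BasicAssumptions μ γ C f P) (hm : IsModel f P)
    (hγ : 2 < γ) (t : ℤ) (i : Fin N) : MemLp (fun ω => P.eps t ω i) 2 μ := by
  have hem : Measurable fun ω => P.eps t ω i :=
    (measurable_pi_apply i).comp (hm.measurable_eps t)
  have hi : MomentLE μ (2 * γ) (ENNReal.ofReal C).toReal fun ω => P.eps t ω i := by
    refine integrable_and_integral_le_of_lintegral_le (by fun_prop) (fun ω => by positivity)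
      ENNReal.ofReal_ne_top ?_
    refine le_trans (lintegral_mono fun ω => ?_) (hb.eps_moment t i)
    rw [Real.enorm_eq_ofReal_abs, ENNReal.ofReal_rpow_of_nonneg (abs_nonneg _) (by linarith)]
  exact hi.memLp_two hem (by linarith)

omit [IsProbabilityMeasure μ] in
lemma integral_mul_xi {X : Ω → ℝ} (hX : MemLp X 2 μ) (t : ℤ)
    (he : ∀ i, MemLp (fun ω => P.eps t ω i) 2 μ) (i : Fin N) :
    ∫ ω, X ω * P.xi t ω i ∂μ = ∑ l, P.S⁻¹ i l * ∫ ω, X ω * P.eps t ω l ∂μ := by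
  have e2 : ∀ ω, X ω * P.xi t ω i = ∑ l, P.S⁻¹ i l * (X ω * P.eps t ω l) := fun ω => by
    simp only [Panel.xi, mulVec, dotProduct, Finset.mul_sum]
    exact Finset.sum_congr rfl fun l _ => by ring
  simp_rw [e2]
  rw [integral_finsetSum _ fun l _ =>
    Integrable.const_mul (f := fun ω => X ω * P.eps t ω l) (hX.integrable_mul (he l)) _]
  simp_rw [integral_const_mul]

lemma meanCrossMoment_xi_factor {γ C c A : ℝ} (hb : BasicAssumptions μ γ C f P)
    (h : HasExpMoments μ c A f P) (hm : IsModel f P) (hγ : 2 < γ) (hc : 0 < c) (T k : ℕ) :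
    meanCrossMoment μ P.xi f T k = 0 := by
  ext i j
  have hfm : ∀ s, Measurable fun ω => f s ω j := fun s =>
    (measurable_pi_apply j).comp (hm.measurable_f s)
  have hf2 : ∀ s, MemLp (fun ω => f s ω j) 2 μ := fun s =>
    ((h.factor s j).momentLE (hfm s) hc (p := γ) (by linarith)).memLp_two (hfm s) hγ.le
  simp only [meanCrossMoment, of_apply, Matrix.zero_apply]
  rw [Finset.sum_eq_zero, mul_zero]
  intro t _
  simp_rw [mul_comm (P.xi t _ i)]
  rw [integral_mul_xi (hf2 _) t (hb.eps_memLp hm hγ t) i]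
  refine Finset.sum_eq_zero fun l _ => ?_
  rw [integral_mul_eq_zero_of_covariance (hf2 _) (hb.eps_memLp hm hγ t l) (hb.f_mean _ j)
    (hb.f_eps _ t j l (by omega)), mul_zero]

lemma meanCrossMoment_xi_xi {γ C c A : ℝ} (hb : BasicAssumptions μ γ C f P)
    (h : HasExpMoments μ c A f P) (hm : IsModel f P) (hγ : 2 < γ) (hc : 0 < c) (T : ℕ) {k : ℕ}
    (hk : 1 ≤ k) : meanCrossMoment μ P.xi P.xi T k = 0 := by
  ext i j
  have hxm : ∀ s, Measurable fun ω => P.xi s ω i := fun s =>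
    (measurable_pi_apply i).comp (measurable_xi hm s)
  have hx2 : ∀ s, MemLp (fun ω => P.xi s ω i) 2 μ := fun s =>
    ((h.xi s i).momentLE (hxm s) hc (p := γ) (by linarith)).memLp_two (hxm s) hγ.le
  simp only [meanCrossMoment, of_apply, Matrix.zero_apply]
  rw [Finset.sum_eq_zero, mul_zero]
  intro t _
  rw [integral_mul_xi (hx2 _) _ (hb.eps_memLp hm hγ _) j]
  refine Finset.sum_eq_zero fun l _ => ?_
  simp_rw [mul_comm (P.xi t _ i)]
  rw [integral_mul_xi (hb.eps_memLp hm hγ _ l) t (hb.eps_memLp hm hγ t) i]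
  rw [Finset.sum_eq_zero, mul_zero]
  intro l' _
  rw [integral_mul_eq_zero_of_covariance (hb.eps_memLp hm hγ _ l) (hb.eps_memLp hm hγ t l')
    (hb.eps_mean _ l) (hb.eps_white _ t l l' (by omega)), mul_zero]

lemma integral_factor_mul_factor {γ C c A : ℝ} (hb : BasicAssumptions μ γ C f P)
    (h : HasExpMoments μ c A f P) (hm : IsModel f P) (hc : 0 < c) (k : ℕ) (t : ℤ)
    (i j : Fin K) : ∫ ω, f t ω i * f (t - k) ω j ∂μ = autocov μ f k i j := by
  have hfm : ∀ s j, Measurable fun ω => f s ω j := fun s j =>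
    (measurable_pi_apply j).comp (hm.measurable_f s)
  have hf2 : ∀ s j, MemLp (fun ω => f s ω j) 2 μ := fun s j =>
    ((h.factor s j).momentLE (hfm s j) hc (p := 2) (by norm_num)).memLp_two (hfm s j) le_rfl
  have hg : Measurable fun w : ℤ → (Fin N → ℝ) × (Fin K → ℝ) =>
      (w 0).2 i * (w (-(k : ℤ))).2 j := by fun_prop
  have hst := ((hb.stationary t).comp hg).integral_eq
  simp only [Function.comp_apply, zero_add] at hst
  rw [autocov, of_apply, covariance_eq_sub (hf2 _ i) (hf2 _ j), hb.f_mean, zero_mul, sub_zero]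
  rw [show t - (k : ℤ) = -(k : ℤ) + t by ring]
  exact hst

lemma norm_meanCrossMoment_factor_sub_le {γ C c A : ℝ} (hb : BasicAssumptions μ γ C f P)
    (h : HasExpMoments μ c A f P) (hm : IsModel f P) (hc : 0 < c) {T : ℕ} (hT : 0 < T) (k : ℕ) :
    ‖meanCrossMoment μ f f T k - autocov μ f k‖ ≤ k / T * ‖autocov μ f k‖ := by
  have hT' : (0 : ℝ) < T := by exact_mod_cast hT
  have e1 : meanCrossMoment μ f f T k - autocov μ f k =
      ((T : ℝ)⁻¹ * (((T : ℤ) + 1 - (k + 1)).toNat : ℝ) - 1) • autocov μ f k := by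
    ext i j
    simp only [meanCrossMoment, Matrix.sub_apply, of_apply, Matrix.smul_apply, smul_eq_mul]
    rw [Finset.sum_congr rfl fun t _ => integral_factor_mul_factor hb h hm hc k t i j,
      Finset.sum_const, Int.card_Icc, nsmul_eq_mul]
    ring
  rw [e1, norm_smul]
  gcongr
  rw [Real.norm_eq_abs, abs_le]
  have hle : (((T : ℤ) + 1 - (k + 1)).toNat : ℝ) ≤ T :=
    Nat.cast_le.mpr (by omega)
  have hge : (T : ℝ) ≤ (((T : ℤ) + 1 - (k + 1)).toNat : ℝ) + k := by
    rw [← Nat.cast_add]; exact Nat.cast_le.mpr (by omega)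
  constructor
  · rw [neg_le_sub_iff_le_add, ← sub_nonneg]
    have : (T : ℝ)⁻¹ * (((T : ℤ) + 1 - (k + 1)).toNat : ℝ) + k / T - 1 =
      (T : ℝ)⁻¹ * ((((T : ℤ) + 1 - (k + 1)).toNat : ℝ) + k - T) := by field_simp
    rw [this]
    exact mul_nonneg (by positivity) (by linarith)
  · have : (T : ℝ)⁻¹ * (((T : ℤ) + 1 - (k + 1)).toNat : ℝ) ≤ 1 := by
      rw [inv_mul_le_iff₀ hT', mul_one]; exact hle
    have : (0 : ℝ) ≤ k / T := by positivity
    linarith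

end FixedDimension

/-! ### The sample autocovariances as perturbations of matrices of rank `K` -/

section Decomposition

open scoped Matrix.Norms.Frobenius

variable {Ω : Type*} {K N : ℕ}

/-- The matrix `G_{1,k}` divided by `√N`. -/
def normG1 (P : Panel Ω K N) (f : ℤ → Ω → Fin K → ℝ) (T k : ℕ) (ω : Ω) :
    Matrix (Fin K) (Fin N) ℝ :=
  (√(N : ℝ))⁻¹ • P.G1 f T k ω

/-- The part `T⁻¹ ∑ ξ_t y_{t-k}'` of the sample autocovariance that has mean zero, divided
by `N`. -/
def normNoise (P : Panel Ω K N) (f : ℤ → Ω → Fin K → ℝ) (T k : ℕ) (ω : Ω) :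
    Matrix (Fin N) (Fin N) ℝ :=
  (N : ℝ)⁻¹ • (crossMoment P.xi f T k ω * P.Lamᵀ + crossMoment P.xi P.xi T k ω)

lemma G1_eq (P : Panel Ω K N) (f : ℤ → Ω → Fin K → ℝ) (T k : ℕ) (ω : Ω) :
    P.G1 f T k ω = crossMoment f f T k ω * P.Lamᵀ + crossMoment f P.xi T k ω := by
  rw [Panel.G1, crossMoment, crossMoment, smul_mul, ← smul_add, Matrix.sum_mul,
    ← Finset.sum_add_distrib]

lemma normG1_eq (P : Panel Ω K N) (f : ℤ → Ω → Fin K → ℝ) (T k : ℕ) (ω : Ω) :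
    normG1 P f T k ω = crossMoment f f T k ω * (normLam P)ᵀ +
      (√(N : ℝ))⁻¹ • crossMoment f P.xi T k ω := by
  rw [normG1, G1_eq, smul_add, normLam, transpose_smul, Matrix.mul_smul]

variable [MeasurableSpace Ω] {μ : Measure Ω} {f : ℤ → Ω → Fin K → ℝ} {P : Panel Ω K N}

lemma sampleAutocov_eq (hm : IsModel f P) (hS : IsUnit P.S) (hN : 0 < N) (T k : ℕ) (ω : Ω) :
    P.sampleAutocov T k ω =
      (N : ℝ) • (normLam P * normG1 P f T k ω + normNoise P f T k ω) := by
  have hN' : (N : ℝ) ≠ 0 := by positivity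
  rw [normLam, normG1, normNoise, smul_mul, Matrix.mul_smul, smul_smul, inv_sqrt_mul_inv_sqrt,
    ← smul_add, smul_smul, mul_inv_cancel₀ hN', one_smul, Panel.G1, Panel.sampleAutocov,
    crossMoment, crossMoment, Matrix.mul_smul, smul_mul, ← smul_add, ← smul_add, Matrix.mul_sum,
    Matrix.sum_mul, ← Finset.sum_add_distrib, ← Finset.sum_add_distrib]
  congr 1
  refine Finset.sum_congr rfl fun t _ => ?_
  rw [hm.y_eq hS, hm.y_eq hS]
  simp only [add_vecMulVec, vecMulVec_add, Matrix.mul_add, vecMulVec_mul, mul_vecMulVec,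
    vecMul_transpose]
  abel

lemma Mhat_eq (hm : IsModel f P) (hS : IsUnit P.S) (hN : 0 < N) (k₀ T : ℕ) (ω : Ω) :
    P.Mhat k₀ T ω = ((N : ℝ) ^ 2) • gramSum (Finset.Icc 1 k₀)
      (fun k => normLam P * normG1 P f T k ω + normNoise P f T k ω) := by
  rw [Panel.Mhat, gramSum, Finset.smul_sum]
  refine Finset.sum_congr rfl fun k _ => ?_
  rw [sampleAutocov_eq hm hS hN, transpose_smul, smul_mul, Matrix.mul_smul, smul_smul, sq]

lemma measure_norm_crossMoment_sub_scaled_le [IsProbabilityMeasure μ] {E : Type*}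
    [MeasurableSpace E] {Z : ℤ → Ω → E} {γ A C : ℝ} (hγ : 2 < γ) {k : ℕ}
    (hZ : ∀ t, Measurable (Z t))
    (hsum : Summable fun n : ℕ => alphaMixing μ Z (n + 1) ^ (1 - 2 / γ))
    (hle : ∑' n : ℕ, alphaMixing μ Z (n + 1) ^ (1 - 2 / γ) ≤ C) {m n : ℕ}
    {u : ℤ → Ω → Fin m → ℝ} {v : ℤ → Ω → Fin n → ℝ}
    (hu : ∀ t i, Measurable[MeasurableSpace.comap (Z t) inferInstance] fun ω => u t ω i)
    (hv : ∀ t i, Measurable[MeasurableSpace.comap (Z t) inferInstance] fun ω => v t ω i)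
    (huA : ∀ t i, MomentLE μ (2 * γ) A fun ω => u t ω i)
    (hvA : ∀ t i, MomentLE μ (2 * γ) A fun ω => v t ω i) {T : ℕ} (hT : 0 < T) {M p q : ℝ}
    (hM : 0 < M) (hp0 : 0 < p) (hq0 : 0 < q) (hp : (m : ℝ) ≤ p) (hq : (n : ℝ) ≤ q) :
    μ {ω | √p * √q * M / √T < ‖crossMoment u v T k ω - meanCrossMoment μ u v T k‖} ≤
      ENNReal.ofReal (|varianceConst (2 * A) C k| / M ^ 2) := by
  have hT' : (0 : ℝ) < T := by exact_mod_cast hT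
  refine (measure_norm_crossMoment_sub_le hγ hZ hsum hle hu hv huA hvA hT (by positivity)).trans
    (ENNReal.ofReal_le_ofReal ?_)
  rw [div_pow, mul_pow, mul_pow, Real.sq_sqrt hT'.le, Real.sq_sqrt hp0.le, Real.sq_sqrt hq0.le,
    mul_div_cancel₀ _ hT'.ne', div_le_div_iff₀ (by positivity) (by positivity)]
  have h1 : (m : ℝ) * n * varianceConst (2 * A) C k ≤ p * q * |varianceConst (2 * A) C k| := by
    have h2 : (m : ℝ) * n ≤ p * q := by gcongr
    calc (m : ℝ) * n * varianceConst (2 * A) C k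
        ≤ (m : ℝ) * n * |varianceConst (2 * A) C k| := by gcongr; exact le_abs_self _
      _ ≤ _ := by gcongr
  nlinarith [sq_nonneg M]

lemma add_mul_le_of_nonneg {r q M x b s n : ℝ} (hr : 0 ≤ r) (hq : 0 ≤ q) (hM : 0 ≤ M)
    (hx : 0 ≤ x) (hb : 0 ≤ b) (hs : 0 ≤ s) (hn : 0 ≤ n) :
    r * (q * q * M + x) * s + (q * M * s + b * n) ≤
      (r * (q * q + x) + q + b) * (M + 1) * (n + s) := by
  rw [← sub_nonneg]
  have : (r * (q * q + x) + q + b) * (M + 1) * (n + s) -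
      (r * (q * q * M + x) * s + (q * M * s + b * n)) =
      r * q * q * (M * n + n + s) + r * x * (M * (n + s) + n) + q * (M * n + n + s) +
        b * (M * (n + s) + s) := by ring
  rw [this]
  positivity

section Closeness

variable [IsProbabilityMeasure μ] {γ C c A A' a κ₁ κ₂ M : ℝ} {T k k₀ : ℕ} {ω : Ω}

lemma norm_normG1_sub_le (hN : 0 < N) (hm : IsModel f P) (hb : BasicAssumptions μ γ C f P)
    (he : HasExpMoments μ c A f P) (hγ : 2 < γ) (hc : 0 < c) (hA : 0 ≤ A) (hT : 0 < T)
    (hM : 0 ≤ M) (hk : k ≤ k₀) (ha : ‖autocov μ f k‖ ≤ a)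
    (hA' : A' = (2 * γ / c) ^ (2 * γ) * A)
    (hκ₁ : κ₁ = √K * (√((K : ℝ) + 1) * √((K : ℝ) + 1) + k₀ * a) + √((K : ℝ) + 1) +
      √K * (1 + A'))
    (h₁ : ‖crossMoment f f T k ω - meanCrossMoment μ f f T k‖ ≤
      √((K : ℝ) + 1) * √((K : ℝ) + 1) * M / √T)
    (h₂ : ‖crossMoment f P.xi T k ω - meanCrossMoment μ f P.xi T k‖ ≤
      √((K : ℝ) + 1) * √N * M / √T) :
    ‖normG1 P f T k ω - autocov μ f k * (normLam P)ᵀ‖ ≤ κ₁ * (M + 1) * (1 / √N + 1 / √T) := by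
  have hA'0 : 0 ≤ A' := by rw [hA']; positivity
  have ha0 : 0 ≤ a := (norm_nonneg _).trans ha
  have hT' : (0 : ℝ) < T := by exact_mod_cast hT
  have hN' : (0 : ℝ) < N := by exact_mod_cast hN
  set q : ℝ := √((K : ℝ) + 1) with hq
  set n : ℝ := √(N : ℝ) with hn
  set s : ℝ := √(T : ℝ) with hs
  have hsN : 0 < n := Real.sqrt_pos.mpr hN'
  have hsT : 0 < s := Real.sqrt_pos.mpr hT'
  have hq0 : 0 ≤ q := Real.sqrt_nonneg _
  have hn1 : 0 < 1 / n := by positivity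
  have hs1 : 0 < 1 / s := by positivity
  have hΛt : ‖(normLam P)ᵀ‖ = √K := by
    rw [frobenius_norm_transpose, norm_eq_sqrt_of_transpose_mul_self hb.normLam_orth]
  have hkT : (k : ℝ) / T ≤ k₀ * (1 / s) := by
    have h1 : (k : ℝ) ≤ k₀ := by exact_mod_cast hk
    have h2 : (1 : ℝ) ≤ s := by
      rw [hs, Real.one_le_sqrt]; exact_mod_cast hT
    have h3 : (1 : ℝ) / T ≤ 1 / s := by
      apply one_div_le_one_div_of_le hsT
      rw [← Real.mul_self_sqrt hT'.le]
      exact le_mul_of_one_le_left hsT.le h2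
    rw [div_eq_mul_one_div]
    gcongr
  have e1 : normG1 P f T k ω - autocov μ f k * (normLam P)ᵀ =
      ((crossMoment f f T k ω - meanCrossMoment μ f f T k) +
        (meanCrossMoment μ f f T k - autocov μ f k)) * (normLam P)ᵀ +
      n⁻¹ • ((crossMoment f P.xi T k ω - meanCrossMoment μ f P.xi T k) +
        meanCrossMoment μ f P.xi T k) := by
    rw [normG1_eq, sub_add_sub_cancel, sub_add_cancel, Matrix.sub_mul]
    abel
  have g1 : ‖(crossMoment f f T k ω - meanCrossMoment μ f f T k) +
        (meanCrossMoment μ f f T k - autocov μ f k)‖ ≤ q * q * M / s + k₀ * (1 / s) * a := by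
    refine (norm_add_le _ _).trans (add_le_add h₁ ?_)
    refine (norm_meanCrossMoment_factor_sub_le hb he hm hc hT k).trans ?_
    exact mul_le_mul hkT ha (norm_nonneg _) (by positivity)
  have g2 : ‖(crossMoment f P.xi T k ω - meanCrossMoment μ f P.xi T k) +
        meanCrossMoment μ f P.xi T k‖ ≤ q * n * M / s + √K * (1 + A') := by
    refine (norm_add_le _ _).trans (add_le_add h₂ ?_)
    rw [hA']
    exact norm_meanCrossMoment_factor_xi_le he hm hc hA (by linarith) T k
  have g4 : ‖n⁻¹ • ((crossMoment f P.xi T k ω - meanCrossMoment μ f P.xi T k) +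
        meanCrossMoment μ f P.xi T k)‖ ≤ n⁻¹ * (q * n * M / s + √K * (1 + A')) := by
    rw [norm_smul, Real.norm_of_nonneg (by positivity)]
    exact mul_le_mul_of_nonneg_left g2 (by positivity)
  have e5 : n⁻¹ * (q * n * M / s + √K * (1 + A')) =
      q * M * (1 / s) + √K * (1 + A') * (1 / n) := by
    field_simp
  have e6 : (q * q * M / s + k₀ * (1 / s) * a) * √K =
      √K * (q * q * M + k₀ * a) * (1 / s) := by field_simp
  rw [e1]
  refine (norm_add_le _ _).trans ((add_le_add (norm_mul_le_of_le g1 hΛt.le) g4).trans ?_)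
  rw [e5, e6, hκ₁]
  exact add_mul_le_of_nonneg (Real.sqrt_nonneg _) hq0 hM (by positivity) (by positivity) hs1.le
    hn1.le

lemma norm_normNoise_le (hN : 0 < N) (hm : IsModel f P) (hb : BasicAssumptions μ γ C f P)
    (he : HasExpMoments μ c A f P) (hγ : 2 < γ) (hc : 0 < c) (hk : 1 ≤ k)
    (h₃ : ‖crossMoment P.xi f T k ω - meanCrossMoment μ P.xi f T k‖ ≤
      √N * √((K : ℝ) + 1) * M / √T)
    (h₄ : ‖crossMoment P.xi P.xi T k ω - meanCrossMoment μ P.xi P.xi T k‖ ≤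
      √N * √N * M / √T) :
    ‖normNoise P f T k ω‖ ≤ (√((K : ℝ) + 1) * √K + 1) * M * (1 / √T) := by
  have hN' : (0 : ℝ) < N := by exact_mod_cast hN
  have hsN : 0 < √(N : ℝ) := Real.sqrt_pos.mpr hN'
  rw [meanCrossMoment_xi_factor hb he hm hγ hc, sub_zero] at h₃
  rw [meanCrossMoment_xi_xi hb he hm hγ hc T hk, sub_zero] at h₄
  have hΛ' : ‖P.Lamᵀ‖ = √(N : ℝ) * √K := by
    have : P.Lam = √(N : ℝ) • normLam P := by
      rw [normLam, smul_smul, mul_inv_cancel₀ hsN.ne', one_smul]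
    rw [frobenius_norm_transpose, this, norm_smul,
      norm_eq_sqrt_of_transpose_mul_self hb.normLam_orth, Real.norm_of_nonneg hsN.le]
  have hnn : √(N : ℝ) * √(N : ℝ) = N := Real.mul_self_sqrt hN'.le
  rw [normNoise, norm_smul, Real.norm_of_nonneg (by positivity), inv_mul_le_iff₀ hN']
  refine (norm_add_le _ _).trans ((add_le_add (norm_mul_le_of_le h₃ hΛ'.le) h₄).trans
    (le_of_eq ?_))
  calc √(N : ℝ) * √((K : ℝ) + 1) * M / √T * (√(N : ℝ) * √K) + √(N : ℝ) * √(N : ℝ) * M / √T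
      = (√(N : ℝ) * √(N : ℝ)) * ((√((K : ℝ) + 1) * √K + 1) * M * (1 / √T)) := by ring
    _ = _ := by rw [hnn]

end Closeness

/-- With high probability, uniformly in the dimension, the sample autocovariances are close to
matrices of rank `K`. The noise part is of the order `1/√T`, without a contribution `1/√N`. -/
lemma exists_measure_not_close_le (K : ℕ) (μ : Measure Ω) [IsProbabilityMeasure μ]
    {γ C c A : ℝ} (hγ : 2 < γ) (hc : 0 < c) (hA : 1 ≤ A) (f : ℤ → Ω → Fin K → ℝ) (k₀ : ℕ) :
    ∃ κ V : ℝ, 0 ≤ κ ∧ 0 ≤ V ∧ ∀ (N : ℕ) (P : Panel Ω K N), 0 < N →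
      IsModel f P → BasicAssumptions μ γ C f P → HasExpMoments μ c A f P →
      ∀ (T : ℕ) (M : ℝ), 0 < T → 0 < M →
        μ {ω | ¬ ∀ k ∈ Finset.Icc 1 k₀,
          ‖normG1 P f T k ω - autocov μ f k * (normLam P)ᵀ‖ ≤ κ * (M + 1) * (1 / √N + 1 / √T) ∧
          ‖normNoise P f T k ω‖ ≤ κ * (M + 1) * (1 / √T)} ≤ ENNReal.ofReal (V / M ^ 2) := by
  obtain ⟨A', hA'⟩ : ∃ A' : ℝ, A' = (2 * γ / c) ^ (2 * γ) * A := ⟨_, rfl⟩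
  have hA'0 : 0 ≤ A' := by rw [hA']; positivity
  obtain ⟨a, ha⟩ : ∃ a : ℝ, a = ∑ k ∈ Finset.Icc 1 k₀, ‖autocov μ f k‖ := ⟨_, rfl⟩
  have ha0 : 0 ≤ a := ha ▸ Finset.sum_nonneg fun _ _ => norm_nonneg _
  obtain ⟨κ₁, hκ₁⟩ : ∃ κ₁ : ℝ, κ₁ = √K * (√((K : ℝ) + 1) * √((K : ℝ) + 1) + k₀ * a) +
    √((K : ℝ) + 1) + √K * (1 + A') := ⟨_, rfl⟩
  obtain ⟨κ₂, hκ₂⟩ : ∃ κ₂ : ℝ, κ₂ = √((K : ℝ) + 1) * √K + 1 := ⟨_, rfl⟩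
  have hκ₁0 : 0 ≤ κ₁ := by rw [hκ₁]; positivity
  have hκ₂0 : 0 ≤ κ₂ := by rw [hκ₂]; positivity
  refine ⟨κ₁ + κ₂, ∑ k ∈ Finset.Icc 1 k₀, 4 * |varianceConst (2 * A') C k|, by positivity,
    Finset.sum_nonneg fun _ _ => by positivity, fun N P hN hm hb he T M hT hM => ?_⟩
  have hT' : (0 : ℝ) < T := by exact_mod_cast hT
  have hN' : (0 : ℝ) < N := by exact_mod_cast hN
  have hZ : ∀ t, Measurable fun ω => (P.y t ω, f t ω) := fun t =>
    (hm.measurable_y t).prodMk (hm.measurable_f t)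
  have hfc := f_comap_measurable (f := f) (P := P)
  have hxc := hm.xi_comap_measurable hb.S_isUnit
  have hfA : ∀ t j, MomentLE μ (2 * γ) A' fun ω => f t ω j := fun t j => hA' ▸
    (he.factor t j).momentLE ((measurable_pi_apply j).comp (hm.measurable_f t)) hc (by linarith)
  have hxA : ∀ t j, MomentLE μ (2 * γ) A' fun ω => P.xi t ω j := fun t j => hA' ▸
    (he.xi t j).momentLE ((measurable_pi_apply j).comp (measurable_xi hm t)) hc (by linarith)
  have hK1 : (K : ℝ) ≤ K + 1 := by linarith
  have hK0 : (0 : ℝ) < K + 1 := by positivity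
  let W₁ : ℕ → Set Ω := fun k => {ω | √((K : ℝ) + 1) * √((K : ℝ) + 1) * M / √T <
    ‖crossMoment f f T k ω - meanCrossMoment μ f f T k‖}
  let W₂ : ℕ → Set Ω := fun k => {ω | √((K : ℝ) + 1) * √N * M / √T <
    ‖crossMoment f P.xi T k ω - meanCrossMoment μ f P.xi T k‖}
  let W₃ : ℕ → Set Ω := fun k => {ω | √N * √((K : ℝ) + 1) * M / √T <
    ‖crossMoment P.xi f T k ω - meanCrossMoment μ P.xi f T k‖}
  let W₄ : ℕ → Set Ω := fun k => {ω | √N * √N * M / √T <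
    ‖crossMoment P.xi P.xi T k ω - meanCrossMoment μ P.xi P.xi T k‖}
  have hW : ∀ k, μ (W₁ k ∪ W₂ k ∪ W₃ k ∪ W₄ k) ≤
      ENNReal.ofReal (4 * |varianceConst (2 * A') C k| / M ^ 2) := fun k => by
    have b₁ : μ (W₁ k) ≤ ENNReal.ofReal (|varianceConst (2 * A') C k| / M ^ 2) :=
      measure_norm_crossMoment_sub_scaled_le hγ hZ hb.mixing_summable hb.mixing_le hfc hfc
        hfA hfA hT hM hK0 hK0 hK1 hK1
    have b₂ : μ (W₂ k) ≤ ENNReal.ofReal (|varianceConst (2 * A') C k| / M ^ 2) :=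
      measure_norm_crossMoment_sub_scaled_le hγ hZ hb.mixing_summable hb.mixing_le hfc hxc
        hfA hxA hT hM hK0 hN' hK1 le_rfl
    have b₃ : μ (W₃ k) ≤ ENNReal.ofReal (|varianceConst (2 * A') C k| / M ^ 2) :=
      measure_norm_crossMoment_sub_scaled_le hγ hZ hb.mixing_summable hb.mixing_le hxc hfc
        hxA hfA hT hM hN' hK0 le_rfl hK1
    have b₄ : μ (W₄ k) ≤ ENNReal.ofReal (|varianceConst (2 * A') C k| / M ^ 2) :=
      measure_norm_crossMoment_sub_scaled_le hγ hZ hb.mixing_summable hb.mixing_le hxc hxc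
        hxA hxA hT hM hN' hN' le_rfl le_rfl
    have h0 : 0 ≤ |varianceConst (2 * A') C k| / M ^ 2 := by positivity
    calc μ (W₁ k ∪ W₂ k ∪ W₃ k ∪ W₄ k) ≤ μ (W₁ k) + μ (W₂ k) + μ (W₃ k) + μ (W₄ k) :=
          (measure_union_le _ _).trans (add_le_add_left ((measure_union_le _ _).trans
            (add_le_add_left (measure_union_le _ _) _)) _)
      _ ≤ _ := add_le_add (add_le_add (add_le_add b₁ b₂) b₃) b₄
      _ = _ := by
          rw [← ENNReal.ofReal_add h0 h0, ← ENNReal.ofReal_add (by positivity) h0,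
            ← ENNReal.ofReal_add (by positivity) h0]
          congr 1; ring
  have hsub : {ω | ¬ ∀ k ∈ Finset.Icc 1 k₀,
      ‖normG1 P f T k ω - autocov μ f k * (normLam P)ᵀ‖ ≤
        (κ₁ + κ₂) * (M + 1) * (1 / √N + 1 / √T) ∧
      ‖normNoise P f T k ω‖ ≤ (κ₁ + κ₂) * (M + 1) * (1 / √T)} ⊆
      ⋃ k ∈ Finset.Icc 1 k₀, (W₁ k ∪ W₂ k ∪ W₃ k ∪ W₄ k) := by
    intro ω hω
    by_contra hcon
    apply hω
    intro k hk
    have hkI := Finset.mem_Icc.mp hk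
    simp only [Set.mem_iUnion, not_exists] at hcon
    have hk' := hcon k hk
    simp only [Set.mem_union, not_or, W₁, W₂, W₃, W₄, Set.mem_ofPred_eq, not_lt] at hk'
    obtain ⟨⟨⟨h₁, h₂⟩, h₃⟩, h₄⟩ := hk'
    have hak : ‖autocov μ f k‖ ≤ a :=
      ha ▸ Finset.single_le_sum (f := fun k => ‖autocov μ f k‖) (fun _ _ => norm_nonneg _) hk
    constructor
    · refine (norm_normG1_sub_le hN hm hb he hγ hc (by linarith) hT hM.le hkI.2 hak hA' hκ₁
        h₁ h₂).trans ?_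
      have h5 : (0 : ℝ) ≤ 1 / √N + 1 / √T := by positivity
      exact mul_le_mul_of_nonneg_right
        (mul_le_mul_of_nonneg_right (by linarith) (by linarith)) h5
    · refine (norm_normNoise_le hN hm hb he hγ hc hkI.1 h₃ h₄).trans ?_
      rw [← hκ₂]
      have h5 : (0 : ℝ) ≤ 1 / √T := by positivity
      exact mul_le_mul_of_nonneg_right
        (mul_le_mul (by linarith) (by linarith) hM.le (by linarith)) h5
  refine (measure_mono hsub).trans ((measure_biUnion_finset_le _ _).trans ?_)
  refine (Finset.sum_le_sum fun k _ => hW k).trans (le_of_eq ?_)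
  rw [← ENNReal.ofReal_sum_of_nonneg fun k _ => by positivity, Finset.sum_div]

end Decomposition

/-! ### Deterministic bounds for the estimators -/

section Estimates

open scoped Matrix.Norms.Frobenius

lemma norm_toLp_mulVec_le {m n : ℕ} (A : Matrix (Fin m) (Fin n) ℝ) (x : Fin n → ℝ) :
    ‖WithLp.toLp 2 (A *ᵥ x)‖ ≤ ‖A‖ * ‖WithLp.toLp 2 x‖ := by
  rw [← frobenius_norm_replicateCol (ι := Unit), ← frobenius_norm_replicateCol (ι := Unit) x,
    replicateCol_mulVec]
  exact frobenius_norm_mul _ _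

variable {Ω : Type*} [MeasurableSpace Ω] {μ : Measure Ω} {K N : ℕ}
  {f : ℤ → Ω → Fin K → ℝ} {P : Panel Ω K N} {k₀ T : ℕ} {ω : Ω} {L : Matrix (Fin N) (Fin K) ℝ}

/-- The estimated loadings divided by `√N`. -/
def normLoading (L : Matrix (Fin N) (Fin K) ℝ) : Matrix (Fin N) (Fin K) ℝ := (√(N : ℝ))⁻¹ • L

/-- The estimated eigenvalues divided by `N²`. -/
def normEigenvalue (P : Panel Ω K N) (k₀ T : ℕ) (ω : Ω) (j : Fin K) : ℝ :=
  ((N : ℝ) ^ 2)⁻¹ * P.topEigenvalue k₀ T ω j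

omit [MeasurableSpace Ω] in
lemma diagonal_topEigenvalue (hN : 0 < N) :
    diagonal (P.topEigenvalue k₀ T ω) = ((N : ℝ) ^ 2) • diagonal (normEigenvalue P k₀ T ω) := by
  have hN' : (N : ℝ) ≠ 0 := by positivity
  rw [← diagonal_smul]
  congr 1
  funext j
  rw [Pi.smul_apply, normEigenvalue, smul_eq_mul, mul_inv_cancel_left₀ (pow_ne_zero 2 hN')]

omit [MeasurableSpace Ω] in
lemma antitone_normEigenvalue (hKN : K ≤ N) : Antitone (normEigenvalue P k₀ T ω) := by
  intro i j hij
  have hi : (i : ℕ) < N := i.2.trans_le hKN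
  have hj : (j : ℕ) < N := j.2.trans_le hKN
  simp only [normEigenvalue, Panel.topEigenvalue, dif_pos hi, dif_pos hj]
  gcongr
  exact (P.isHermitian_Mhat k₀ T ω).eigenvalues₀_antitone hij

omit [MeasurableSpace Ω] in
lemma normLoading_orth (hN : 0 < N) (hL : P.IsLoadingEstimate k₀ T ω L) :
    (normLoading L)ᵀ * normLoading L = 1 := by
  have hN' : (N : ℝ) ≠ 0 := by positivity
  rw [normLoading, transpose_smul, smul_mul, Matrix.mul_smul, smul_smul, inv_sqrt_mul_inv_sqrt,
    hL.1, smul_smul, inv_mul_cancel₀ hN', one_smul]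

lemma normLoading_eig (hN : 0 < N) (hm : IsModel f P) (hS : IsUnit P.S)
    (hL : P.IsLoadingEstimate k₀ T ω L) :
    gramSum (Finset.Icc 1 k₀) (fun k => normLam P * normG1 P f T k ω + normNoise P f T k ω) *
      normLoading L = normLoading L * diagonal (normEigenvalue P k₀ T ω) := by
  have hN' : ((N : ℝ) ^ 2) ≠ 0 := by positivity
  have h := hL.2
  rw [Mhat_eq hm hS hN, diagonal_topEigenvalue hN, smul_mul, Matrix.mul_smul] at h
  rw [normLoading, Matrix.mul_smul, smul_mul, smul_right_injective _ hN' h]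

omit [MeasurableSpace Ω] in
lemma KNT_eq : P.KNT L = (normLoading L)ᵀ * normLam P := by
  rw [normLoading, normLam, transpose_smul, smul_mul, Matrix.mul_smul, smul_smul,
    inv_sqrt_mul_inv_sqrt, Panel.KNT]

omit [MeasurableSpace Ω] in
lemma HNT_eq (hN : 0 < N) {c : ℝ} (hc : 0 < c) (hv : ∀ j, c ≤ normEigenvalue P k₀ T ω j) :
    P.HNT f k₀ T ω L = (gramSum (Finset.Icc 1 k₀) (fun k => normG1 P f T k ω) * (normLam P)ᵀ *
      normLoading L * (diagonal (normEigenvalue P k₀ T ω))⁻¹)ᵀ := by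
  have hN' : (N : ℝ) ≠ 0 := by positivity
  have hs : √(N : ℝ) ≠ 0 := by positivity
  have hinv : (diagonal (P.topEigenvalue k₀ T ω))⁻¹ =
      ((N : ℝ) ^ 2)⁻¹ • (diagonal (normEigenvalue P k₀ T ω))⁻¹ := by
    refine inv_eq_right_inv ?_
    rw [diagonal_topEigenvalue hN, smul_mul, Matrix.mul_smul, smul_smul,
      IsFactorApprox.diagonal_mul_inv hc hv, mul_inv_cancel₀ (pow_ne_zero 2 hN'), one_smul]
  have hG : gramSum (Finset.Icc 1 k₀) (fun k => normG1 P f T k ω) =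
      (N : ℝ)⁻¹ • ∑ k ∈ Finset.Icc 1 k₀, P.G1 f T k ω * (P.G1 f T k ω)ᵀ := by
    rw [gramSum, Finset.smul_sum]
    refine Finset.sum_congr rfl fun k _ => ?_
    rw [normG1, transpose_smul, smul_mul, Matrix.mul_smul, smul_smul, inv_sqrt_mul_inv_sqrt]
  rw [Panel.HNT, hinv, hG, normLam, normLoading]
  simp only [transpose_smul, smul_mul, Matrix.mul_smul, smul_smul]
  congr 2
  rw [mul_left_comm, ← mul_assoc, inv_sqrt_mul_inv_sqrt, sq, mul_inv]

lemma sqrt_smul_fhat_sub (hN : 0 < N) (hm : IsModel f P) (hS : IsUnit P.S) (t : ℤ) :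
    √(N : ℝ) • (P.fhat L t ω - P.KNT L *ᵥ f t ω) - P.KNT L *ᵥ P.score t ω =
      (normLoading L - normLam P * ((normLam P)ᵀ * normLoading L))ᵀ *ᵥ P.xi t ω := by
  have hs : √(N : ℝ) ≠ 0 := by positivity
  have e1 : P.fhat L t ω - P.KNT L *ᵥ f t ω = (N : ℝ)⁻¹ • (Lᵀ *ᵥ P.xi t ω) := by
    rw [Panel.fhat, hm.y_eq hS, mulVec_add, mulVec_mulVec, smul_add, Panel.KNT, smul_mulVec]
    abel
  have e2 : √(N : ℝ) • ((N : ℝ)⁻¹ • (Lᵀ *ᵥ P.xi t ω)) = (normLoading L)ᵀ *ᵥ P.xi t ω := by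
    rw [← inv_sqrt_mul_inv_sqrt, smul_smul, mul_inv_cancel_left₀ hs, normLoading,
      transpose_smul, smul_mulVec]
  rw [e1, e2, score_eq, KNT_eq, transpose_sub, sub_mulVec, mulVec_mulVec]
  simp only [transpose_mul, transpose_transpose]

/-- Bounds for the estimators: `z` bounds the errors that contain the sampling error of the factor
autocovariances, `e` the errors that only come from the noise. -/
structure IsGoodEstimate (μ : Measure Ω) (P : Panel Ω K N) (f : ℤ → Ω → Fin K → ℝ) (k₀ T : ℕ)
    (ω : Ω) (L : Matrix (Fin N) (Fin K) ℝ) (z e : ℝ) : Prop where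
  norm_le : ‖P.KNT L‖ ≤ K
  orth : ‖P.KNT L * (P.KNT L)ᵀ - 1‖ ≤ e
  eig : ∃ v : Fin K → ℝ, Antitone v ∧
    ‖diagonal v * P.KNT L - P.KNT L * factorM μ f k₀‖ ≤ z
  rot : ‖P.HNT f k₀ T ω L - P.KNT L‖ ≤ z
  factor : ∀ t, ‖WithLp.toLp 2 (√(N : ℝ) • (P.fhat L t ω - P.KNT L *ᵥ f t ω) -
    P.KNT L *ᵥ P.score t ω)‖ ≤ e * ‖WithLp.toLp 2 (P.xi t ω)‖

lemma IsGoodEstimate.mono {z e z' e' : ℝ} (h : IsGoodEstimate μ P f k₀ T ω L z e)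
    (hz : z ≤ z') (he : e ≤ e') : IsGoodEstimate μ P f k₀ T ω L z' e' where
  norm_le := h.norm_le
  orth := h.orth.trans he
  eig := by
    obtain ⟨v, hv, hvz⟩ := h.eig
    exact ⟨v, hv, hvz.trans hz⟩
  rot := h.rot.trans hz
  factor t := (h.factor t).trans (by gcongr)

/-- Small perturbations of the sample autocovariances lead to good estimates. -/
lemma exists_isGoodEstimate (μ : Measure Ω) (f : ℤ → Ω → Fin K → ℝ) (k₀ : ℕ)
    (hR : (factorM μ f k₀).PosDef) :
    ∃ z₀ κ : ℝ, 0 < z₀ ∧ 0 ≤ κ ∧ ∀ (N : ℕ) (P : Panel Ω K N), 0 < N → K ≤ N → IsModel f P →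
      ∀ γ C : ℝ, BasicAssumptions μ γ C f P →
      ∀ (T : ℕ) (ω : Ω) (L : Matrix (Fin N) (Fin K) ℝ), P.IsLoadingEstimate k₀ T ω L →
      ∀ z e : ℝ, 0 ≤ e → e ≤ z → z ≤ z₀ →
        (∀ k ∈ Finset.Icc 1 k₀, ‖normG1 P f T k ω - autocov μ f k * (normLam P)ᵀ‖ ≤ z ∧
          ‖normNoise P f T k ω‖ ≤ e) →
        IsGoodEstimate μ P f k₀ T ω L (κ * z) (κ * e) := by
  obtain ⟨c, hc, hcle⟩ := exists_pos_mul_le_of_posDef hR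
  set I := Finset.Icc 1 k₀ with hI
  set a : ℝ := ∑ k ∈ I, ‖autocov μ f k‖ with ha
  have ha0 : 0 ≤ a := Finset.sum_nonneg fun _ _ => norm_nonneg _
  have hob : 0 ≤ obsBound K a := by rw [obsBound]; positivity
  have hg0 : 0 ≤ gramConst K I a := by rw [gramConst]; positivity
  set b : ℝ := √K * gramConst K I a * √K with hb
  have hb0 : 0 ≤ b := by positivity
  set r : ℝ := I.card * ((1 + K) * obsBound K a * √K * (√K / (c / 2))) with hr
  have hr0 : 0 ≤ r := by positivity
  set s : ℝ := (I.card * (a * √K + (a * √K + 1)) * K + √K * gramConst K I a * √K) *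
    (√K / (c / 2)) with hs
  have hs0 : 0 ≤ s := by positivity
  refine ⟨min 1 (c / 2 / (b + 1)), b + √K * r + r + s, by positivity, by positivity,
    fun N P hN hKN hm γ C hA T ω L hL z e he hez hz hFE => ?_⟩
  have hz0 : 0 ≤ z := he.trans hez
  have h : IsFactorApprox I (autocov μ f) a z e (normLam P) (fun k => normG1 P f T k ω)
      (fun k => normNoise P f T k ω) :=
    { orth := hA.normLam_orth
      norm_A := fun k hk => Finset.single_le_sum (f := fun k => ‖autocov μ f k‖)
        (fun _ _ => norm_nonneg _) hk
      norm_F := fun k hk => (hFE k hk).1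
      norm_E := fun k hk => (hFE k hk).2
      e_le := hez
      z_le := hz.trans (min_le_left _ _) }
  have hLo := normLoading_orth hN hL
  have heig := normLoading_eig hN hm hA.S_isUnit hL
  have hbz : b * z ≤ c / 2 := by
    have h1 : z ≤ c / 2 / (b + 1) := hz.trans (min_le_right _ _)
    rw [le_div_iff₀ (by positivity)] at h1
    nlinarith
  have hv : ∀ j, c / 2 ≤ normEigenvalue P k₀ T ω j := fun j => by
    have hj : (j : ℕ) < N := j.2.trans_le hKN
    rw [normEigenvalue, Panel.topEigenvalue, dif_pos hj, le_inv_mul_iff₀ (by positivity)]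
    refine le_eigenvalues₀_of_forall_le _ hA.normLam_orth (fun x => ?_) _ j.2
    rw [Mhat_eq hm hA.S_isUnit hN, smul_mulVec, dotProduct_smul, smul_eq_mul, mul_assoc]
    refine mul_le_mul_of_nonneg_left ?_ (by positivity)
    refine le_trans ?_ (h.mul_dotProduct_le hcle x)
    refine mul_le_mul_of_nonneg_right ?_ (Finset.sum_nonneg fun i _ => mul_self_nonneg _)
    have : √K * (gramConst K I a * z) * √K = b * z := by rw [hb]; ring
    linarith
  have hc2 : 0 < c / 2 := half_pos hc
  have hK : P.KNT L = (normLoading L)ᵀ * normLam P := KNT_eq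
  constructor
  · rw [hK]
    refine (norm_mul_le_of_le ?_ h.norm_load.le).trans
      (le_of_eq (Real.mul_self_sqrt (Nat.cast_nonneg _)))
    rw [frobenius_norm_transpose, norm_eq_sqrt_of_transpose_mul_self hLo]
  · rw [hK]
    refine (h.norm_mul_transpose_sub_one_le hLo heig hc2 hv).trans ?_
    rw [← hr, ← mul_assoc]
    gcongr
    linarith
  · refine ⟨normEigenvalue P k₀ T ω, antitone_normEigenvalue hKN, ?_⟩
    rw [hK]
    refine (h.norm_diagonal_mul_sub_le hLo heig).trans ?_
    have : √K * (gramConst K I a * z) * √K = b * z := by rw [hb]; ring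
    rw [this]
    gcongr
    have : 0 ≤ √K * r := by positivity
    linarith
  · rw [hK, HNT_eq hN hc2 hv]
    refine (h.norm_rotation_sub_le hLo heig hc2 hv).trans ?_
    rw [← hs]
    gcongr
    have : 0 ≤ √K * r := by positivity
    linarith
  · intro t
    rw [sqrt_smul_fhat_sub hN hm hA.S_isUnit]
    refine (norm_toLp_mulVec_le _ _).trans ?_
    gcongr
    rw [frobenius_norm_transpose]
    refine (h.norm_sub_projection_le hLo heig hc2 hv).trans ?_
    rw [← hr]
    gcongr
    have : 0 ≤ √K * r := by positivity
    linarith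

end Estimates

/-! ### Gaussian limits -/

section Gaussian

variable {K : ℕ}

lemma map_multivariateGaussian_mulVec {Γ : Matrix (Fin K) (Fin K) ℝ} (hΓ : Γ.PosSemidef)
    (H : Matrix (Fin K) (Fin K) ℝ) :
    (multivariateGaussian (0 : EuclideanSpace ℝ (Fin K)) Γ).map
        (fun x => WithLp.toLp 2 (H *ᵥ WithLp.ofLp x)) =
      multivariateGaussian 0 (H * Γ * Hᵀ) := by
  have hHΓ : (H * Γ * Hᵀ).PosSemidef := by
    have := hΓ.mul_mul_conjTranspose_same H
    rwa [conjTranspose_eq_transpose_of_trivial] at this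
  have hc : Continuous fun x : EuclideanSpace ℝ (Fin K) => WithLp.toLp 2 (H *ᵥ WithLp.ofLp x) := by
    fun_prop
  have : IsProbabilityMeasure ((multivariateGaussian (0 : EuclideanSpace ℝ (Fin K)) Γ).map
      (fun x => WithLp.toLp 2 (H *ᵥ WithLp.ofLp x))) :=
    Measure.isProbabilityMeasure_map hc.measurable.aemeasurable
  refine Measure.ext_of_charFun (funext fun t => ?_)
  rw [charFun_multivariateGaussian hHΓ, charFun_apply, integral_map hc.measurable.aemeasurable
    (by fun_prop)]
  have e1 : ∀ x : EuclideanSpace ℝ (Fin K), inner ℝ (WithLp.toLp 2 (H *ᵥ WithLp.ofLp x)) t =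
      inner ℝ x (WithLp.toLp 2 (Hᵀ *ᵥ WithLp.ofLp t)) := fun x => by
    have h1 := inner_toLp_mulVec (H *ᵥ WithLp.ofLp x) (WithLp.ofLp t)
    have h2 := inner_toLp_mulVec (WithLp.ofLp x) (Hᵀ *ᵥ WithLp.ofLp t)
    simp only [WithLp.toLp_ofLp] at h1 h2
    rw [h1, h2, mulVec_transpose, ← dotProduct_comm (WithLp.ofLp t), dotProduct_mulVec,
      dotProduct_comm]
  simp_rw [e1]
  rw [← charFun_apply, charFun_multivariateGaussian hΓ]
  congr 2
  · simp
  · congr 2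
    simp only [mulVec_transpose, ← mulVec_mulVec, ← dotProduct_mulVec]

variable {Ω : Type*} [MeasurableSpace Ω] {μ : Measure Ω} {N : ℕ}
  {f : ℤ → Ω → Fin K → ℝ} {P : Panel Ω K N}

lemma dotProduct_vecMulVec_mulVec (a b x : Fin K → ℝ) :
    x ⬝ᵥ (vecMulVec a b *ᵥ x) = (a ⬝ᵥ x) * (b ⬝ᵥ x) := by
  rw [vecMulVec_mulVec, op_smul_eq_smul, dotProduct_smul, smul_eq_mul, dotProduct_comm x, mul_comm]

lemma posSemidef_scoreCov {t : ℤ} (he : ∀ i, MemLp (fun ω => P.eps t ω i) 2 μ) :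
    (scoreCov μ P t).PosSemidef := by
  have hsym : (scoreCov μ P t)ᵀ = scoreCov μ P t := by
    rw [scoreCov, transpose_smul, transpose_sum, Finset.sum_comm]
    simp_rw [transpose_sum, transpose_smul, transpose_vecMulVec]
    congr 1
    refine Finset.sum_congr rfl fun i _ => Finset.sum_congr rfl fun j _ => ?_
    simp_rw [mul_comm (P.eps t _ j)]
  refine PosSemidef.of_dotProduct_mulVec_nonneg
    (by rw [IsHermitian, conjTranspose_eq_transpose_of_trivial, hsym]) fun x => ?_
  have e1 : star x ⬝ᵥ (scoreCov μ P t *ᵥ x) =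
      (N : ℝ)⁻¹ * ∫ ω, (∑ i, P.eps t ω i * (P.p i ⬝ᵥ x)) ^ 2 ∂μ := by
    have e2 : ∀ ω, (∑ i, P.eps t ω i * (P.p i ⬝ᵥ x)) ^ 2 =
        ∑ i, ∑ j, (P.eps t ω i * P.eps t ω j) * ((P.p i ⬝ᵥ x) * (P.p j ⬝ᵥ x)) := fun ω => by
      rw [sq, Finset.sum_mul_sum]
      exact Finset.sum_congr rfl fun i _ => Finset.sum_congr rfl fun j _ => by ring
    have hint : ∀ i j, Integrable (fun ω => (P.eps t ω i * P.eps t ω j) *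
        ((P.p i ⬝ᵥ x) * (P.p j ⬝ᵥ x))) μ := fun i j =>
      Integrable.mul_const (f := fun ω => P.eps t ω i * P.eps t ω j)
        ((he i).integrable_mul (he j)) _
    simp_rw [e2]
    rw [integral_finsetSum _ fun i _ => integrable_finsetSum _ fun j _ => hint i j]
    rw [star_trivial, scoreCov, smul_mulVec, dotProduct_smul, smul_eq_mul, sum_mulVec,
      dotProduct_sum]
    congr 1
    refine Finset.sum_congr rfl fun i _ => ?_
    rw [integral_finsetSum _ fun j _ => hint i j, sum_mulVec, dotProduct_sum]
    refine Finset.sum_congr rfl fun j _ => ?_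
    rw [integral_mul_const, smul_mulVec, dotProduct_smul, smul_eq_mul, dotProduct_vecMulVec_mulVec]
  rw [e1]
  exact mul_nonneg (by positivity) (integral_nonneg fun ω => sq_nonneg _)

lemma posSemidef_of_tendsto {ι : Type*} {l : Filter ι} [l.NeBot]
    {Γ : Matrix (Fin K) (Fin K) ℝ} {G : ι → Matrix (Fin K) (Fin K) ℝ}
    (hG : Tendsto G l (𝓝 Γ)) (h : ∀ᶠ i in l, (G i).PosSemidef) : Γ.PosSemidef := by
  refine PosSemidef.of_dotProduct_mulVec_nonneg ?_ fun x => ?_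
  · have h1 : Tendsto (fun i => (G i)ᴴ) l (𝓝 Γᴴ) :=
      (Continuous.matrix_conjTranspose continuous_id).continuousAt.tendsto.comp hG
    exact tendsto_nhds_unique (h1.congr' (h.mono fun i hi => hi.1)) hG
  · have hc : Continuous fun Q : Matrix (Fin K) (Fin K) ℝ => star x ⬝ᵥ (Q *ᵥ x) :=
      Continuous.dotProduct continuous_const (Continuous.matrix_mulVec continuous_id
        continuous_const)
    exact ge_of_tendsto ((hc.tendsto _).comp hG) (h.mono fun i hi => hi.dotProduct_mulVec_nonneg x)

end Gaussian

/-! ### High-probability bounds -/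

section HighProbability

open scoped Matrix.Norms.Frobenius

/-- The root mean square `‖x‖ / √n` of a vector. -/
def rms {n : ℕ} (x : Fin n → ℝ) : ℝ := √((n : ℝ)⁻¹ * ∑ i, x i ^ 2)

lemma rms_nonneg {n : ℕ} (x : Fin n → ℝ) : 0 ≤ rms x := Real.sqrt_nonneg _

lemma norm_toLp_eq_sqrt_mul {n : ℕ} (x : Fin n → ℝ) :
    ‖WithLp.toLp 2 x‖ = √(n : ℝ) * rms x := by
  rcases Nat.eq_zero_or_pos n with rfl | hn
  · simp [EuclideanSpace.norm_eq]
  · have hn' : (0 : ℝ) < n := by exact_mod_cast hn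
    rw [rms, ← Real.sqrt_mul hn'.le, mul_inv_cancel_left₀ hn'.ne', EuclideanSpace.norm_eq]
    simp

variable {Ω : Type*} [MeasurableSpace Ω] {μ : Measure Ω} [IsProbabilityMeasure μ]

lemma expMomentLE_rms {n : ℕ} {c A : ℝ} (hc : 0 < c) (hA : 1 ≤ A) {X : Ω → Fin n → ℝ}
    (hX : Measurable X) (h : ∀ i, ExpMomentLE μ c A fun ω => X ω i) :
    ExpMomentLE μ c (2 * A) fun ω => rms (X ω) := by
  rcases Nat.eq_zero_or_pos n with rfl | hn
  · refine ⟨by simp [rms], ?_⟩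
    simp only [rms, Finset.univ_eq_empty, Finset.sum_empty, mul_zero, Real.sqrt_zero, abs_zero,
      Real.exp_zero, integral_const, probReal_univ, smul_eq_mul]
    linarith
  · exact expMomentLE_sqrt_mean_sq hn hc hX h

omit [IsProbabilityMeasure μ] in
lemma measure_not_and_le {p q : Ω → Prop} {a b : ℝ} (ha : 0 ≤ a) (hb : 0 ≤ b)
    (hp : μ {ω | ¬ p ω} ≤ ENNReal.ofReal a) (hq : μ {ω | ¬ q ω} ≤ ENNReal.ofReal b) :
    μ {ω | ¬ (p ω ∧ q ω)} ≤ ENNReal.ofReal (a + b) := by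
  have e : {ω | ¬ (p ω ∧ q ω)} = {ω | ¬ p ω} ∪ {ω | ¬ q ω} := by
    ext ω; simp only [Set.mem_ofPred_eq, Set.mem_union, not_and_or]
  rw [e, ENNReal.ofReal_add ha hb]
  exact (measure_union_le _ _).trans (add_le_add hp hq)

omit [IsProbabilityMeasure μ] in
lemma measure_not_le_of_imp {p q : Ω → Prop} {a : ℝ≥0∞} (h : ∀ ω, p ω → q ω)
    (hp : μ {ω | ¬ p ω} ≤ a) : μ {ω | ¬ q ω} ≤ a :=
  (measure_mono fun ω (hω : ¬ q ω) hpω => hω (h ω hpω)).trans hp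

lemma tendsto_zero_of_forall_le_ofReal {ι : Type*} {l : Filter ι} {u : ι → ℝ≥0∞}
    (h : ∀ δ : ℝ, 0 < δ → ∀ᶠ i in l, u i ≤ ENNReal.ofReal δ) : Tendsto u l (𝓝 0) := by
  rw [ENNReal.tendsto_nhds_zero]
  intro ε hε
  rcases eq_or_ne ε ∞ with rfl | hε'
  · exact Eventually.of_forall fun _ => le_top
  · filter_upwards [h ε.toReal (ENNReal.toReal_pos hε.ne' hε')] with i hi
    rwa [ENNReal.ofReal_toReal hε'] at hi

lemma tendsto_measure_one_of_forall_not_le {ι : Type*} {l : Filter ι} {p : ι → Ω → Prop}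
    (h : ∀ δ : ℝ, 0 < δ → ∀ᶠ i in l, μ {ω | ¬ p i ω} ≤ ENNReal.ofReal δ) :
    Tendsto (fun i => μ {ω | p i ω}) l (𝓝 1) := by
  have h0 := tendsto_zero_of_forall_le_ofReal h
  have h1 : Tendsto (fun i => 1 - μ {ω | ¬ p i ω}) l (𝓝 1) := by
    have := ENNReal.Tendsto.sub (tendsto_const_nhds (x := (1 : ℝ≥0∞))) h0
      (Or.inl ENNReal.one_ne_top)
    rwa [tsub_zero] at this
  refine tendsto_of_tendsto_of_tendsto_of_le_of_le h1 tendsto_const_nhds (fun i => ?_)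
    fun i => prob_le_one
  -- subadditivity suffices, no measurability is needed
  rw [tsub_le_iff_right]
  calc (1 : ℝ≥0∞) = μ ({ω | p i ω} ∪ {ω | ¬ p i ω}) := by
        rw [← measure_univ (μ := μ)]
        congr 1
        ext ω
        simp [em]
    _ ≤ _ := measure_union_le _ _

omit [IsProbabilityMeasure μ] in
lemma tendstoInMeasure_of_forall_not_le {ι E : Type*} [SeminormedAddCommGroup E] {l : Filter ι}
    {X : ι → Ω → E} {Y : Ω → E}
    (h : ∀ ε δ : ℝ, 0 < ε → 0 < δ →
      ∀ᶠ i in l, μ {ω | ¬ ‖X i ω - Y ω‖ ≤ ε} ≤ ENNReal.ofReal δ) :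
    TendstoInMeasure μ X l Y := by
  rw [tendstoInMeasure_iff_norm]
  intro ε hε
  refine tendsto_zero_of_forall_le_ofReal fun δ hδ => ?_
  filter_upwards [h (ε / 2) δ (half_pos hε) hδ] with i hi
  refine (measure_mono fun ω hω => ?_).trans hi
  have : ε ≤ ‖X i ω - Y ω‖ := hω
  simp only [Set.mem_ofPred_eq, not_le]
  linarith

lemma exists_tail_le {c A δ : ℝ} (hc : 0 < c) (hδ : 0 < δ) :
    ∃ x : ℝ, 0 < x ∧ A * Real.exp (-(c * x)) ≤ δ := by
  have h1 : Tendsto (fun x : ℝ => A * Real.exp (-(c * x))) atTop (𝓝 (A * 0)) :=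
    (Real.tendsto_exp_neg_atTop_nhds_zero.comp (tendsto_id.const_mul_atTop hc)).const_mul A
  rw [mul_zero] at h1
  obtain ⟨x, hx, hx'⟩ := ((h1.eventually_le_const hδ).and (eventually_gt_atTop 0)).exists
  exact ⟨x, hx', hx⟩

end HighProbability

/-! ### Asymptotics of the estimators -/

section Asymptotics

open scoped Matrix.Norms.Frobenius

lemma abs_apply_le_frobenius_norm {m n : ℕ} (A : Matrix (Fin m) (Fin n) ℝ) (i : Fin m)
    (j : Fin n) : |A i j| ≤ ‖A‖ := by
  refine abs_le_of_sq_le_sq ?_ (norm_nonneg _)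
  rw [frobenius_norm_sq]
  exact (Finset.single_le_sum (f := fun j => A i j ^ 2) (fun _ _ => sq_nonneg _)
    (Finset.mem_univ j)).trans (Finset.single_le_sum (f := fun i => ∑ j, A i j ^ 2)
      (fun _ _ => Finset.sum_nonneg fun _ _ => sq_nonneg _) (Finset.mem_univ i))

variable {Ω : Type*} [MeasurableSpace Ω] {μ : Measure Ω} {K N : ℕ}
  {f : ℤ → Ω → Fin K → ℝ} {k₀ T : ℕ}

section Deterministic

variable {P : Panel Ω K N} {ω : Ω} {L : Matrix (Fin N) (Fin K) ℝ}

lemma IsGoodEstimate.norm_fhat_sub_le {z e x : ℝ} (h : IsGoodEstimate μ P f k₀ T ω L z e)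
    (hN : 0 < N) (he : 0 ≤ e) {t : ℤ} (hs : rms (P.score t ω) ≤ x) (hx : rms (P.xi t ω) ≤ x) :
    ‖WithLp.toLp 2 (P.fhat L t ω - P.KNT L *ᵥ f t ω)‖ ≤ (K * √K * (1 / √N) + e) * x := by
  have hN' : 0 < √(N : ℝ) := by positivity
  have hs' : ‖WithLp.toLp 2 (P.score t ω)‖ ≤ √K * x := by
    rw [norm_toLp_eq_sqrt_mul]
    exact mul_le_mul_of_nonneg_left hs (Real.sqrt_nonneg _)
  have hx' : ‖WithLp.toLp 2 (P.xi t ω)‖ ≤ √N * x := by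
    rw [norm_toLp_eq_sqrt_mul]
    exact mul_le_mul_of_nonneg_left hx (Real.sqrt_nonneg _)
  have h1 : ‖WithLp.toLp 2 (√(N : ℝ) • (P.fhat L t ω - P.KNT L *ᵥ f t ω))‖ ≤
      e * (√N * x) + K * (√K * x) := by
    have h2 := (h.factor t).trans (mul_le_mul_of_nonneg_left hx' he)
    have h3 := (norm_toLp_mulVec_le (P.KNT L) (P.score t ω)).trans
      (mul_le_mul h.norm_le hs' (norm_nonneg _) (Nat.cast_nonneg _))
    rw [WithLp.toLp_sub] at h2
    have h4 := norm_le_norm_sub_add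
      (WithLp.toLp 2 (√(N : ℝ) • (P.fhat L t ω - P.KNT L *ᵥ f t ω)))
      (WithLp.toLp 2 (P.KNT L *ᵥ P.score t ω))
    linarith
  rw [WithLp.toLp_smul, norm_smul, Real.norm_of_nonneg hN'.le, mul_comm, ← le_div_iff₀ hN'] at h1
  refine h1.trans (le_of_eq ?_)
  field_simp
  ring

/-- Once the signs of the columns of the loading estimate are aligned with `H`, good estimates
make both rotation matrices close to `H`. -/
lemma exists_norm_rotation_sub_le {ε : ℝ} (hε : 0 < ε) {H : Matrix (Fin K) (Fin K) ℝ}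
    {d : Fin K → ℝ}
    (hH : H * Hᵀ = 1) (hd : StrictAnti d) (hHd : H * factorM μ f k₀ * Hᵀ = diagonal d) :
    ∃ ζ > 0, ∀ (N T : ℕ) (P : Panel Ω K N) (ω : Ω) (L : Matrix (Fin N) (Fin K) ℝ),
      IsGoodEstimate μ P f k₀ T ω L ζ ζ → (∀ j, 0 ≤ (P.KNT L * Hᵀ) j j) →
      ‖P.KNT L - H‖ ≤ ε ∧ ‖P.HNT f k₀ T ω L - H‖ ≤ ε := by
  have hH' : Hᵀ * H = 1 := mul_eq_one_comm.mp hH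
  have hHn : ‖H‖ = √K := by
    rw [← frobenius_norm_transpose, norm_eq_sqrt_of_transpose_mul_self]
    rwa [transpose_transpose]
  obtain ⟨η, hη, hη'⟩ : ∃ η > 0, K * η * √K ≤ ε / 2 := by
    refine ⟨ε / 2 / (K * √K + 1), by positivity, ?_⟩
    rw [mul_div_assoc', div_mul_eq_mul_div, div_le_iff₀ (by positivity)]
    nlinarith
  obtain ⟨δ, hδ, hδQ⟩ := exists_delta_abs_sub_one_le hd hη
  refine ⟨min (δ / (√K + 1)) (ε / 2), by positivity, fun N T P ω L hg hsign => ?_⟩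
  have hz1 : min (δ / (√K + 1)) (ε / 2) * √K ≤ δ := by
    have h1 : min (δ / (√K + 1)) (ε / 2) ≤ δ / (√K + 1) := min_le_left _ _
    rw [le_div_iff₀ (by positivity)] at h1
    have : 0 < min (δ / (√K + 1)) (ε / 2) := by positivity
    nlinarith
  have hz2 : min (δ / (√K + 1)) (ε / 2) ≤ δ := by
    refine (min_le_left _ _).trans (div_le_self hδ.le ?_)
    linarith [Real.sqrt_nonneg (K : ℝ)]
  obtain ⟨v, hv, hvz⟩ := hg.eig
  obtain ⟨Q, hQ⟩ : ∃ Q, Q = P.KNT L * Hᵀ := ⟨_, rfl⟩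
  have hQQ : Q * Qᵀ = P.KNT L * (P.KNT L)ᵀ := by
    rw [hQ, transpose_mul, transpose_transpose, Matrix.mul_assoc, ← Matrix.mul_assoc Hᵀ, hH',
      Matrix.one_mul]
  have hcomm : diagonal v * Q - Q * diagonal d =
      (diagonal v * P.KNT L - P.KNT L * factorM μ f k₀) * Hᵀ := by
    have : Hᵀ * diagonal d = factorM μ f k₀ * Hᵀ := by
      rw [← hHd, ← Matrix.mul_assoc, ← Matrix.mul_assoc, hH', Matrix.one_mul]
    rw [hQ, Matrix.mul_assoc (P.KNT L) Hᵀ, this, Matrix.sub_mul]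
    simp only [Matrix.mul_assoc]
  have hQ1 : ∀ i j, |(Q - 1) i j| ≤ η := by
    refine hδQ Q v hv (fun i j => ?_) (fun i j => ?_) fun j => hQ ▸ hsign j
    · rw [hQQ]
      exact ((abs_apply_le_frobenius_norm _ i j).trans hg.orth).trans hz2
    · have e1 : (v i - d j) * Q i j = (diagonal v * Q - Q * diagonal d) i j := by
        rw [Matrix.sub_apply, diagonal_mul, mul_diagonal]
        ring
      rw [e1, hcomm]
      refine (abs_apply_le_frobenius_norm _ i j).trans ((norm_mul_le_of_le hvz ?_).trans hz1)
      rw [frobenius_norm_transpose, hHn]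
  have hQn : ‖Q - 1‖ ≤ K * η := by
    refine (Real.le_sqrt (norm_nonneg _) (by positivity) |>.mpr ?_).trans_eq
      (Real.sqrt_sq (by positivity : 0 ≤ K * η))
    rw [frobenius_norm_sq]
    calc ∑ i, ∑ j, (Q - 1) i j ^ 2 ≤ ∑ _i : Fin K, ∑ _j : Fin K, η ^ 2 := by
          refine Finset.sum_le_sum fun i _ => Finset.sum_le_sum fun j _ => ?_
          exact sq_le_sq' (abs_le.mp (hQ1 i j)).1 (abs_le.mp (hQ1 i j)).2
      _ = (K * η) ^ 2 := by simp; ring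
  have hK : ‖P.KNT L - H‖ ≤ ε / 2 := by
    have e2 : P.KNT L - H = (Q - 1) * H := by
      rw [hQ, Matrix.sub_mul, Matrix.mul_assoc, hH', Matrix.mul_one, Matrix.one_mul]
    rw [e2]
    exact (norm_mul_le_of_le hQn hHn.le).trans hη'
  refine ⟨hK.trans (by linarith), ?_⟩
  have h1 := norm_sub_le_norm_sub_add_norm_sub (P.HNT f k₀ T ω L) (P.KNT L) H
  have h2 := hg.rot.trans (min_le_right _ _)
  linarith

end Deterministic

/-- The standing hypotheses, with the tail conditions turned into exponential moments. -/
structure IsAsymptoticModel (μ : Measure Ω) (k₀ : ℕ) (γ C c A : ℝ) (f : ℤ → Ω → Fin K → ℝ)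
    (P : ∀ N, Panel Ω K N) (L : ∀ N : ℕ, ℕ → Ω → Matrix (Fin N) (Fin K) ℝ) : Prop where
  two_lt : 2 < γ
  c_pos : 0 < c
  one_le : 1 ≤ A
  model : ∀ N, IsModel f (P N)
  basic : ∀ᶠ N in atTop, BasicAssumptions μ γ C f (P N)
  moments : ∀ᶠ N in atTop, HasExpMoments μ c A f (P N)
  posDef : (factorM μ f k₀).PosDef
  estimate : ∀ N T ω, K ≤ N → (P N).IsLoadingEstimate k₀ T ω (L N T ω)

lemma tendsto_one_div_sqrt {l : Filter (ℕ × ℕ)} {φ : ℕ × ℕ → ℕ} (h : Tendsto φ l atTop) :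
    Tendsto (fun q => 1 / √(φ q : ℝ)) l (𝓝 0) := by
  simp_rw [one_div]
  exact (Real.tendsto_sqrt_atTop.comp
    (tendsto_natCast_atTop_atTop.comp h)).inv_tendsto_atTop

namespace IsAsymptoticModel

variable [IsProbabilityMeasure μ] {γ C c A : ℝ} {P : ∀ N, Panel Ω K N}
  {L : ∀ N : ℕ, ℕ → Ω → Matrix (Fin N) (Fin K) ℝ} {l : Filter (ℕ × ℕ)}

lemma exists_measure_not_isGoodEstimate_le (h : IsAsymptoticModel μ k₀ γ C c A f P L) {δ : ℝ}
    (hδ : 0 < δ) (h₁ : Tendsto Prod.fst l atTop) (h₂ : Tendsto Prod.snd l atTop) :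
    ∃ M > 0, ∀ᶠ q in l, μ {ω | ¬ IsGoodEstimate μ (P q.1) f k₀ q.2 ω (L q.1 q.2 ω)
      (M * (1 / √q.1 + 1 / √q.2)) (M * (1 / √q.2))} ≤ ENNReal.ofReal δ := by
  obtain ⟨κ, V, hκ, hV, hclose⟩ :=
    exists_measure_not_close_le K μ h.two_lt h.c_pos h.one_le f k₀ (C := C)
  obtain ⟨z₀, κ', hz₀, hκ', hgood⟩ := exists_isGoodEstimate μ f k₀ h.posDef
  obtain ⟨m, hm⟩ : ∃ m, m = V / δ + 1 := ⟨_, rfl⟩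
  have hm1 : 1 ≤ m := by rw [hm]; linarith [div_nonneg hV hδ.le]
  have hVm : V / m ^ 2 ≤ δ := by
    have h1 : V = (m - 1) * δ := by rw [hm]; field_simp; ring
    rw [div_le_iff₀ (by positivity), h1]
    nlinarith [mul_pos hδ (by linarith : 0 < m)]
  refine ⟨κ' * (κ * (m + 1)) + 1, by positivity, ?_⟩
  have hrate : Tendsto (fun q : ℕ × ℕ => κ * (m + 1) * (1 / √(q.1 : ℝ) + 1 / √(q.2 : ℝ))) l
      (𝓝 0) := by
    simpa using ((tendsto_one_div_sqrt h₁).add (tendsto_one_div_sqrt h₂)).const_mul (κ * (m + 1))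
  filter_upwards [h₁.eventually h.basic, h₁.eventually h.moments, h₁.eventually_ge_atTop K,
    h₁.eventually_gt_atTop 0, h₂.eventually_gt_atTop 0, hrate.eventually_le_const hz₀]
    with q hb hmo hK hN hT hz
  refine measure_not_le_of_imp (fun ω hω => ?_) ((hclose q.1 (P q.1) hN (h.model _) hb hmo q.2 m hT
    (by linarith)).trans (ENNReal.ofReal_le_ofReal hVm))
  have hle : κ * (m + 1) * (1 / √(q.2 : ℝ)) ≤ κ * (m + 1) * (1 / √(q.1 : ℝ) + 1 / √(q.2 : ℝ)) := by
    gcongr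
    exact le_add_of_nonneg_left (by positivity)
  refine (hgood q.1 (P q.1) hN hK (h.model _) γ C hb q.2 ω _ (h.estimate _ _ _ hK) _ _
    (by positivity) hle hz hω).mono ?_ ?_
  all_goals
    rw [add_mul _ (1 : ℝ), ← mul_assoc κ']
    exact le_add_of_nonneg_right (by positivity)

lemma eventually_isGoodEstimate (h : IsAsymptoticModel μ k₀ γ C c A f P L) {ζ δ : ℝ} (hζ : 0 < ζ)
    (hδ : 0 < δ) (h₁ : Tendsto Prod.fst l atTop) (h₂ : Tendsto Prod.snd l atTop) :
    ∀ᶠ q in l, μ {ω | ¬ IsGoodEstimate μ (P q.1) f k₀ q.2 ω (L q.1 q.2 ω) ζ ζ} ≤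
      ENNReal.ofReal δ := by
  obtain ⟨M, hM, hg⟩ := h.exists_measure_not_isGoodEstimate_le hδ h₁ h₂
  have hrate : Tendsto (fun q : ℕ × ℕ => M * (1 / √(q.1 : ℝ) + 1 / √(q.2 : ℝ))) l (𝓝 0) := by
    simpa using ((tendsto_one_div_sqrt h₁).add (tendsto_one_div_sqrt h₂)).const_mul M
  filter_upwards [hg, hrate.eventually_le_const hζ] with q hq hr
  refine measure_not_le_of_imp (fun ω hω => hω.mono hr (le_trans ?_ hr)) hq
  gcongr
  exact le_add_of_nonneg_left (by positivity)

lemma tendsto_isUnit (h : IsAsymptoticModel μ k₀ γ C c A f P L)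
    (h₁ : Tendsto Prod.fst l atTop) (h₂ : Tendsto Prod.snd l atTop) :
    Tendsto (fun q : ℕ × ℕ => μ {ω | IsUnit ((P q.1).KNT (L q.1 q.2 ω))}) l (𝓝 1) := by
  refine tendsto_measure_one_of_forall_not_le fun δ hδ => ?_
  filter_upwards [h.eventually_isGoodEstimate (ζ := 1 / 2) (by norm_num) hδ h₁ h₂] with q hq
  refine measure_not_le_of_imp (fun ω hω => ?_) hq
  exact isUnit_of_norm_mul_transpose_sub_one_lt (hω.orth.trans_lt (by norm_num))

/-- The uniform rate: the maximum over `t ≤ T` of the root mean squares of the score and of `ξ_t`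
is of order `log T` by the union bound. -/
lemma isBigOInProb_fhat (h : IsAsymptoticModel μ k₀ γ C c A f P L)
    (h₁ : Tendsto Prod.fst l atTop) (h₂ : Tendsto Prod.snd l atTop) :
    IsBigOInProb μ
      (fun (q : ℕ × ℕ) ω => (((Finset.Icc (1 : ℤ) (q.2 : ℤ)).sup fun t =>
        ‖WithLp.toLp 2 ((P q.1).fhat (L q.1 q.2 ω) t ω -
          (P q.1).KNT (L q.1 q.2 ω) *ᵥ f t ω)‖₊ : ℝ≥0) : ℝ)) l
      (fun q => (1 / √(q.1 : ℝ) + 1 / √(q.2 : ℝ)) * Real.log (q.2 : ℝ)) := by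
  intro δ hδ
  have hc := h.c_pos
  obtain ⟨M, hM, hg⟩ := h.exists_measure_not_isGoodEstimate_le (half_pos hδ) h₁ h₂
  refine ⟨(K * √K + M) * (2 / c), ?_⟩
  have hA : Tendsto (fun q : ℕ × ℕ => 2 * A * (q.2 : ℝ)⁻¹) l (𝓝 0) := by
    simpa using ((tendsto_inv_atTop_zero.comp
      (tendsto_natCast_atTop_atTop.comp h₂)).const_mul (2 * A))
  filter_upwards [hg, h₁.eventually h.basic, h₁.eventually h.moments, h₁.eventually_gt_atTop 0,
    h₂.eventually_gt_atTop 0, hA.eventually_le_const (by positivity : 0 < δ / 4)]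
    with q hq hb hmo hN hT hAq
  have hT' : (0 : ℝ) < q.2 := by exact_mod_cast hT
  obtain ⟨x, hx⟩ : ∃ x, x = 2 / c * Real.log q.2 := ⟨_, rfl⟩
  have hx0 : 0 ≤ x := by
    rw [hx]
    exact mul_nonneg (by positivity) (Real.log_natCast_nonneg _)
  have hexp : (q.2 : ℝ) * (2 * A * Real.exp (-(c * x))) ≤ δ / 4 := by
    have e1 : -(c * x) = -(Real.log q.2) + -(Real.log q.2) := by rw [hx]; field_simp; ring
    rw [e1, Real.exp_add, Real.exp_neg, Real.exp_log hT']
    refine le_trans (le_of_eq ?_) hAq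
    field_simp
  have hs := (ExpMomentLE.measure_exists_le q.2 (fun t => expMomentLE_rms hc h.one_le
    (measurable_score (h.model q.1) t) (hmo.score hb t)) hc x).trans
      (ENNReal.ofReal_le_ofReal hexp)
  have hxi := (ExpMomentLE.measure_exists_le q.2 (fun t => expMomentLE_rms hc h.one_le
    (measurable_xi (h.model q.1) t) (hmo.xi t)) hc x).trans (ENNReal.ofReal_le_ofReal hexp)
  have hs' : μ {ω | ¬ ∀ t ∈ Finset.Icc (1 : ℤ) q.2, rms ((P q.1).score t ω) ≤ x} ≤
      ENNReal.ofReal (δ / 4) := by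
    refine (measure_mono fun ω hω => ?_).trans hs
    simpa [abs_of_nonneg (rms_nonneg _), and_assoc] using hω
  have hxi' : μ {ω | ¬ ∀ t ∈ Finset.Icc (1 : ℤ) q.2, rms ((P q.1).xi t ω) ≤ x} ≤
      ENNReal.ofReal (δ / 4) := by
    refine (measure_mono fun ω hω => ?_).trans hxi
    simpa [abs_of_nonneg (rms_nonneg _), and_assoc] using hω
  have hall := measure_not_and_le (by positivity) (by positivity) hq
    (measure_not_and_le (by positivity) (by positivity) hs' hxi')
  rw [show δ / 2 + (δ / 4 + δ / 4) = δ by ring] at hall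
  refine le_trans (measure_mono fun ω hω => ?_) hall
  rw [Set.mem_ofPred_eq]
  rintro ⟨hgo, hss, hxx⟩
  rw [Set.mem_ofPred_eq] at hω
  refine absurd hω (not_lt.mpr ?_)
  rw [abs_of_nonneg (NNReal.coe_nonneg _)]
  have hr0 : 0 ≤ (K * √K + M) * (2 / c) *
      ((1 / √(q.1 : ℝ) + 1 / √(q.2 : ℝ)) * Real.log (q.2 : ℝ)) :=
    mul_nonneg (by positivity) (mul_nonneg (by positivity) (Real.log_natCast_nonneg _))
  rw [← Real.coe_toNNReal _ hr0, NNReal.coe_le_coe]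
  refine Finset.sup_le fun t ht => ?_
  rw [← NNReal.coe_le_coe, Real.coe_toNNReal _ hr0, coe_nnnorm]
  refine (hgo.norm_fhat_sub_le hN (by positivity) (hss t ht) (hxx t ht)).trans ?_
  have e2 : (K * √K + M) * (2 / c) * ((1 / √(q.1 : ℝ) + 1 / √(q.2 : ℝ)) * Real.log (q.2 : ℝ)) =
      ((K * √K + M) * (1 / √(q.1 : ℝ) + 1 / √(q.2 : ℝ))) * x := by rw [hx]; ring
  rw [e2]
  refine mul_le_mul_of_nonneg_right ?_ hx0
  have h3 : 0 ≤ (K : ℝ) * √K * (1 / √(q.2 : ℝ)) := by positivity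
  have h4 : 0 ≤ M * (1 / √(q.1 : ℝ)) := by positivity
  linarith [add_mul (K * √K) M (1 / √(q.1 : ℝ) + 1 / √(q.2 : ℝ)),
    mul_add (K * √K) (1 / √(q.1 : ℝ)) (1 / √(q.2 : ℝ)),
    mul_add M (1 / √(q.1 : ℝ)) (1 / √(q.2 : ℝ))]

section Aligned

variable {H : Matrix (Fin K) (Fin K) ℝ} {d : Fin K → ℝ}

lemma eventually_norm_rotation_sub_le (h : IsAsymptoticModel μ k₀ γ C c A f P L)
    (hH : H * Hᵀ = 1) (hd : StrictAnti d) (hHd : H * factorM μ f k₀ * Hᵀ = diagonal d)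
    (hsign : ∀ N T ω j, K ≤ N → 0 ≤ ((P N).KNT (L N T ω) * Hᵀ) j j)
    (h₁ : Tendsto Prod.fst l atTop) (h₂ : Tendsto Prod.snd l atTop) {ε δ : ℝ} (hε : 0 < ε)
    (hδ : 0 < δ) :
    ∀ᶠ q in l, μ {ω | ¬ (‖(P q.1).KNT (L q.1 q.2 ω) - H‖ ≤ ε ∧
      ‖(P q.1).HNT f k₀ q.2 ω (L q.1 q.2 ω) - H‖ ≤ ε)} ≤ ENNReal.ofReal δ := by
  obtain ⟨ζ, hζ, hg⟩ := exists_norm_rotation_sub_le (Ω := Ω) hε hH hd hHd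
  filter_upwards [h.eventually_isGoodEstimate hζ hδ h₁ h₂, h₁.eventually_ge_atTop K] with q hq hK
  exact measure_not_le_of_imp (fun ω hω => hg _ _ _ ω _ hω fun j => hsign _ _ _ j hK) hq

/-- The linear representation of the factor estimation error. The part of `ξ_t` off the loading
space contributes `O(√(N / T))` after the scaling by `√N`. -/
lemma tendstoInMeasure_fhat_sub (h : IsAsymptoticModel μ k₀ γ C c A f P L)
    (hH : H * Hᵀ = 1) (hd : StrictAnti d) (hHd : H * factorM μ f k₀ * Hᵀ = diagonal d)
    (hsign : ∀ N T ω j, K ≤ N → 0 ≤ ((P N).KNT (L N T ω) * Hᵀ) j j)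
    (h₁ : Tendsto Prod.fst l atTop) (h₂ : Tendsto Prod.snd l atTop)
    (h₃ : Tendsto (fun q : ℕ × ℕ => (q.1 : ℝ) / q.2) l (𝓝 0)) (t : ℤ) :
    TendstoInMeasure μ
      (fun (q : ℕ × ℕ) ω => WithLp.toLp 2 (√(q.1 : ℝ) •
        ((P q.1).fhat (L q.1 q.2 ω) t ω - (P q.1).KNT (L q.1 q.2 ω) *ᵥ f t ω) -
          H *ᵥ (P q.1).score t ω))
      l (fun _ => (0 : EuclideanSpace ℝ (Fin K))) := by
  refine tendstoInMeasure_of_forall_not_le fun ε δ hε hδ => ?_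
  have hδ4 : 0 < δ / 4 := by positivity
  obtain ⟨x, hx, hxδ⟩ := exists_tail_le (A := 2 * A) h.c_pos hδ4
  obtain ⟨M, hM, hg⟩ := h.exists_measure_not_isGoodEstimate_le hδ4 h₁ h₂
  obtain ⟨η, hη, hη'⟩ : ∃ η > 0, η * (√K * x) ≤ ε / 2 := by
    refine ⟨ε / 2 / (√K * x + 1), by positivity, ?_⟩
    rw [div_mul_eq_mul_div, div_le_iff₀ (by positivity)]
    nlinarith
  have hrate : Tendsto (fun q : ℕ × ℕ => M * x * √((q.1 : ℝ) / q.2)) l (𝓝 0) := by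
    simpa using h₃.sqrt.const_mul (M * x)
  filter_upwards [hg, h.eventually_norm_rotation_sub_le hH hd hHd hsign h₁ h₂ hη hδ4,
    h₁.eventually h.basic, h₁.eventually h.moments,
    hrate.eventually_le_const (half_pos hε)] with q hq hrot hb hmo hr
  have hs : μ {ω | ¬ rms ((P q.1).score t ω) ≤ x} ≤ ENNReal.ofReal (δ / 4) := by
    simpa [abs_of_nonneg (rms_nonneg _)] using ((expMomentLE_rms h.c_pos h.one_le
      (measurable_score (h.model q.1) t) (hmo.score hb t)).measure_le h.c_pos x).trans
        (ENNReal.ofReal_le_ofReal hxδ)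
  have hxi : μ {ω | ¬ rms ((P q.1).xi t ω) ≤ x} ≤ ENNReal.ofReal (δ / 4) := by
    simpa [abs_of_nonneg (rms_nonneg _)] using ((expMomentLE_rms h.c_pos h.one_le
      (measurable_xi (h.model q.1) t) (hmo.xi t)).measure_le h.c_pos x).trans
        (ENNReal.ofReal_le_ofReal hxδ)
  have hall := measure_not_and_le (by positivity) (by positivity)
    (measure_not_and_le hδ4.le hδ4.le hq hrot) (measure_not_and_le hδ4.le hδ4.le hs hxi)
  rw [show δ / 4 + δ / 4 + (δ / 4 + δ / 4) = δ by ring] at hall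
  refine measure_not_le_of_imp (fun ω hω => ?_) hall
  obtain ⟨⟨hgo, hK, -⟩, hss, hxx⟩ := hω
  rw [sub_zero]
  have e1 : √(q.1 : ℝ) • ((P q.1).fhat (L q.1 q.2 ω) t ω -
        (P q.1).KNT (L q.1 q.2 ω) *ᵥ f t ω) - H *ᵥ (P q.1).score t ω =
      (√(q.1 : ℝ) • ((P q.1).fhat (L q.1 q.2 ω) t ω - (P q.1).KNT (L q.1 q.2 ω) *ᵥ f t ω) -
        (P q.1).KNT (L q.1 q.2 ω) *ᵥ (P q.1).score t ω) +
      ((P q.1).KNT (L q.1 q.2 ω) - H) *ᵥ (P q.1).score t ω := by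
    rw [sub_mulVec]
    abel
  rw [e1, WithLp.toLp_add]
  have h4 : M * (1 / √(q.2 : ℝ)) * ‖WithLp.toLp 2 ((P q.1).xi t ω)‖ ≤ ε / 2 := by
    refine le_trans ?_ hr
    rw [norm_toLp_eq_sqrt_mul, Real.sqrt_div (Nat.cast_nonneg _)]
    calc M * (1 / √(q.2 : ℝ)) * (√(q.1 : ℝ) * rms ((P q.1).xi t ω))
        ≤ M * (1 / √(q.2 : ℝ)) * (√(q.1 : ℝ) * x) := by gcongr
      _ = M * x * (√(q.1 : ℝ) / √(q.2 : ℝ)) := by ring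
  have h5 : ‖(P q.1).KNT (L q.1 q.2 ω) - H‖ * ‖WithLp.toLp 2 ((P q.1).score t ω)‖ ≤ ε / 2 := by
    refine le_trans ?_ hη'
    rw [norm_toLp_eq_sqrt_mul]
    exact mul_le_mul hK (mul_le_mul_of_nonneg_left hss (Real.sqrt_nonneg _))
      (mul_nonneg (Real.sqrt_nonneg _) (rms_nonneg _)) hη.le
  have h6 := (hgo.factor t).trans h4
  have h7 := (norm_toLp_mulVec_le _ _).trans h5
  exact (norm_add_le_of_le h6 h7).trans (by linarith)

end Aligned

end IsAsymptoticModel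

/-- Slutsky's lemma along a filter that need not be countably generated: the regime `N = o(T)` is
contained in a countably generated one. -/
lemma tendstoInDistribution_fhat [IsProbabilityMeasure μ] {γ C c A : ℝ} {P : ∀ N, Panel Ω K N}
    {L : ∀ N : ℕ, ℕ → Ω → Matrix (Fin N) (Fin K) ℝ} {l : Filter (ℕ × ℕ)}
    {H : Matrix (Fin K) (Fin K) ℝ} {d : Fin K → ℝ}
    (h : IsAsymptoticModel μ k₀ γ C c A f P L)
    (hL : ∀ N T i j, Measurable fun ω => L N T ω i j)
    (hH : H * Hᵀ = 1) (hd : StrictAnti d) (hHd : H * factorM μ f k₀ * Hᵀ = diagonal d)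
    (hsign : ∀ N T ω j, K ≤ N → 0 ≤ ((P N).KNT (L N T ω) * Hᵀ) j j)
    (h₁ : Tendsto Prod.fst l atTop) (h₂ : Tendsto Prod.snd l atTop)
    (h₃ : Tendsto (fun q : ℕ × ℕ => (q.1 : ℝ) / q.2) l (𝓝 0)) {t : ℤ}
    {Γ : Matrix (Fin K) (Fin K) ℝ} (hclt : CrossSectionalCLT μ P t Γ) :
    TendstoInDistribution
      (fun (q : ℕ × ℕ) ω => WithLp.toLp 2 (√(q.1 : ℝ) •
        ((P q.1).fhat (L q.1 q.2 ω) t ω - (P q.1).KNT (L q.1 q.2 ω) *ᵥ f t ω)))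
      l id (fun _ => μ)
      (multivariateGaussian (0 : EuclideanSpace ℝ (Fin K)) (H * Γ * Hᵀ)) := by
  obtain ⟨l₀, hl₀⟩ : ∃ l₀ : Filter (ℕ × ℕ), l₀ =
      (atTop ×ˢ atTop) ⊓ comap (fun q : ℕ × ℕ => (q.1 : ℝ) / q.2) (𝓝 0) := ⟨_, rfl⟩
  have hcg : l₀.IsCountablyGenerated := by rw [hl₀]; infer_instance
  have hle : l ≤ l₀ := by
    rw [hl₀]
    exact le_inf (h₁.prodMk h₂) (tendsto_iff_comap.mp h₃)
  have g₁ : Tendsto Prod.fst l₀ atTop := by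
    rw [hl₀]; exact tendsto_fst.mono_left inf_le_left
  have g₂ : Tendsto Prod.snd l₀ atTop := by
    rw [hl₀]; exact tendsto_snd.mono_left inf_le_left
  have g₃ : Tendsto (fun q : ℕ × ℕ => (q.1 : ℝ) / q.2) l₀ (𝓝 0) := by
    rw [hl₀]; exact tendsto_comap.mono_left inf_le_right
  have hΓ : Γ.PosSemidef := posSemidef_of_tendsto hclt.1 (h.basic.mono fun N hb =>
    posSemidef_scoreCov fun i => hb.eps_memLp (h.model N) h.two_lt t i)
  have hcont : Continuous fun x : EuclideanSpace ℝ (Fin K) => WithLp.toLp 2 (H *ᵥ WithLp.ofLp x) :=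
    by fun_prop
  have hX := hclt.2.continuous_comp hcont
  have hXZ : TendstoInDistribution
      (fun (q : ℕ × ℕ) ω => WithLp.toLp 2 (H *ᵥ (P q.1).score t ω)) l₀ id (fun _ => μ)
      (multivariateGaussian (0 : EuclideanSpace ℝ (Fin K)) (H * Γ * Hᵀ)) := by
    refine ⟨fun q => hX.forall_aemeasurable q.1, aemeasurable_id, ?_⟩
    have hlim : (multivariateGaussian (0 : EuclideanSpace ℝ (Fin K)) (H * Γ * Hᵀ)).map id =
        (multivariateGaussian (0 : EuclideanSpace ℝ (Fin K)) Γ).map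
          ((fun x => WithLp.toLp 2 (H *ᵥ WithLp.ofLp x)) ∘ id) := by
      rw [Function.comp_id, Measure.map_id, map_multivariateGaussian_mulVec hΓ]
    have h4 := hX.tendsto.comp g₁
    simp only [← hlim] at h4
    exact h4
  have hY : ∀ q : ℕ × ℕ, AEMeasurable (fun ω => WithLp.toLp 2 (√(q.1 : ℝ) •
      ((P q.1).fhat (L q.1 q.2 ω) t ω - (P q.1).KNT (L q.1 q.2 ω) *ᵥ f t ω))) μ := fun q => by
    have hLm := hL q.1 q.2
    have hf := fun j => measurable_pi_iff.mp ((h.model q.1).measurable_f t) j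
    have hy := fun j => measurable_pi_iff.mp ((h.model q.1).measurable_y t) j
    refine Measurable.aemeasurable ((WithLp.measurable_toLp 2 _).comp (measurable_pi_iff.mpr
      fun i => ?_))
    simp only [Pi.smul_apply, Pi.sub_apply, Panel.fhat, Panel.KNT, mulVec, dotProduct,
      Matrix.smul_apply, Matrix.mul_apply, transpose_apply, smul_eq_mul]
    fun_prop
  have hmain := tendstoInDistribution_of_tendstoInMeasure_sub _ _ hXZ
    (h.tendstoInMeasure_fhat_sub hH hd hHd hsign g₁ g₂ g₃ t) hY
  exact ⟨hmain.forall_aemeasurable, hmain.aemeasurable_limit, hmain.tendsto.mono_left hle⟩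

end Asymptotics

end SpatialFactor

end

theorem theorem5
    {Ω : Type*} [MeasurableSpace Ω] (μ : Measure Ω) [IsProbabilityMeasure μ]
    (K k₀ : ℕ) (γ C c₁ c₂ : ℝ) (hγ : 2 < γ) (hc₂ : 0 < c₂)
    -- the factor process, and one panel for every cross-sectional dimension `N`
    (f : ℤ → Ω → Fin K → ℝ) (P : ∀ N, SpatialFactor.Panel Ω K N)
    (hmodel : ∀ N, SpatialFactor.IsModel f (P N))
    (hbasic : ∀ᶠ N in atTop, SpatialFactor.BasicAssumptions μ γ C f (P N))
    -- sub-exponential tails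
    (hsub_f : SpatialFactor.SubExponential μ c₁ c₂ f)
    (hsub_eps : ∀ᶠ N in atTop, SpatialFactor.SubExponential μ c₁ c₂ (P N).eps)
    -- the factors are dynamically dependent
    (hstrong : (SpatialFactor.factorM μ f k₀).PosDef)
    -- the loading estimator
    (L : ∀ N : ℕ, ℕ → Ω → Matrix (Fin N) (Fin K) ℝ)
    (hL_meas : ∀ N T i j, Measurable fun ω => L N T ω i j)
    (hL : ∀ N T ω, K ≤ N → (P N).IsLoadingEstimate k₀ T ω (L N T ω)) :
    -- (i)
    (Tendsto (fun q : ℕ × ℕ => μ {ω | IsUnit ((P q.1).KNT (L q.1 q.2 ω))})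
        (atTop ×ˢ atTop) (𝓝 1) ∧
      SpatialFactor.IsBigOInProb μ
        (fun (q : ℕ × ℕ) ω => (((Finset.Icc (1 : ℤ) (q.2 : ℤ)).sup fun t =>
          ‖WithLp.toLp 2 ((P q.1).fhat (L q.1 q.2 ω) t ω -
            (P q.1).KNT (L q.1 q.2 ω) *ᵥ f t ω)‖₊ : ℝ≥0) : ℝ))
        (atTop ×ˢ atTop)
        (fun q => (1 / √(q.1 : ℝ) + 1 / √(q.2 : ℝ)) * Real.log (q.2 : ℝ))) ∧
    -- (ii)
    (∀ (H : Matrix (Fin K) (Fin K) ℝ) (d : Fin K → ℝ),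
      -- the rows of `H` are orthonormal eigenvectors for simple eigenvalues in decreasing order
      H * Hᵀ = 1 → StrictAnti d →
      H * SpatialFactor.factorM μ f k₀ * Hᵀ = Matrix.diagonal d →
      -- the signs of the estimated eigenvectors are aligned with `H`
      (∀ N T ω j, K ≤ N → 0 ≤ ((P N).KNT (L N T ω) * Hᵀ) j j) →
      -- any asymptotic regime with `N, T → ∞` and `N = o(T)`
      ∀ l : Filter (ℕ × ℕ), Tendsto Prod.fst l atTop → Tendsto Prod.snd l atTop →
      (fun q : ℕ × ℕ => (q.1 : ℝ)) =o[l] (fun q : ℕ × ℕ => (q.2 : ℝ)) →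
      (∀ i j, TendstoInMeasure μ (fun (q : ℕ × ℕ) ω => (P q.1).KNT (L q.1 q.2 ω) i j) l
        (fun _ => H i j)) ∧
      (∀ i j, TendstoInMeasure μ
        (fun (q : ℕ × ℕ) ω => (P q.1).HNT f k₀ q.2 ω (L q.1 q.2 ω) i j) l (fun _ => H i j)) ∧
      ∀ (t : ℤ) (Γ : Matrix (Fin K) (Fin K) ℝ), 1 ≤ t →
        SpatialFactor.CrossSectionalCLT μ P t Γ →
        TendstoInMeasure μ
          (fun (q : ℕ × ℕ) ω => WithLp.toLp 2 (√(q.1 : ℝ) •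
              ((P q.1).fhat (L q.1 q.2 ω) t ω - (P q.1).KNT (L q.1 q.2 ω) *ᵥ f t ω) -
            H *ᵥ (P q.1).score t ω))
          l (fun _ => (0 : EuclideanSpace ℝ (Fin K))) ∧
        TendstoInDistribution
          (fun (q : ℕ × ℕ) ω => WithLp.toLp 2 (√(q.1 : ℝ) •
              ((P q.1).fhat (L q.1 q.2 ω) t ω - (P q.1).KNT (L q.1 q.2 ω) *ᵥ f t ω)))
          l id (fun _ => μ)
          (multivariateGaussian (0 : EuclideanSpace ℝ (Fin K)) (H * Γ * Hᵀ))) := by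

  obtain ⟨c, A, hc, hA, hmom⟩ := SpatialFactor.exists_hasExpMoments K μ γ C c₁ hc₂
  have h : SpatialFactor.IsAsymptoticModel μ k₀ γ C c A f P L :=
    { two_lt := hγ
      c_pos := hc
      one_le := hA
      model := hmodel
      basic := hbasic
      moments := (hbasic.and hsub_eps).mono fun N hN =>
        hmom N f (P N) (hmodel N) hN.1 hsub_f hN.2
      posDef := hstrong
      estimate := hL }
  refine ⟨⟨h.tendsto_isUnit tendsto_fst tendsto_snd,
    h.isBigOInProb_fhat tendsto_fst tendsto_snd⟩, fun H d hH hd hHd hsign l h₁ h₂ ho => ?_⟩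
  have h₃ := ho.tendsto_div_nhds_zero
  refine ⟨fun i j => ?_, fun i j => ?_, fun t Γ _ hclt =>
    ⟨h.tendstoInMeasure_fhat_sub hH hd hHd hsign h₁ h₂ h₃ t,
      SpatialFactor.tendstoInDistribution_fhat h hL_meas hH hd hHd hsign h₁ h₂ h₃ hclt⟩⟩
  · refine SpatialFactor.tendstoInMeasure_of_forall_not_le fun ε δ hε hδ => ?_
    filter_upwards [h.eventually_norm_rotation_sub_le hH hd hHd hsign h₁ h₂ hε hδ] with q hq
    exact SpatialFactor.measure_not_le_of_imp (fun ω hω =>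
      (SpatialFactor.abs_apply_le_frobenius_norm _ i j).trans hω.1) hq
  · refine SpatialFactor.tendstoInMeasure_of_forall_not_le fun ε δ hε hδ => ?_
    filter_upwards [h.eventually_norm_rotation_sub_le hH hd hHd hsign h₁ h₂ hε hδ] with q hq
    exact SpatialFactor.measure_not_le_of_imp (fun ω hω =>
      (SpatialFactor.abs_apply_le_frobenius_norm _ i j).trans hω.2) hq
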